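/- Let $\mathbf{C}$ be a category and $W$ a class of arrows of $\mathbf{C}$ which admits a calculus of fractions and satisfies the 2-out-of-3 property. That is: $W$ contains all isomorphisms and is closed under composition; for all $f\colon C\to B$ and $w\colon A\to B$ with $w\in W$ there are $\bar f\colon D\to A$ and $\bar w\colon D\to C$ with $\bar w\in W$ and $f\bar w=w\bar f$; whenever $wf=wg$ with $w\in W$ there is $\tilde w\in W$ with $f\tilde w=g\tilde w$; and if two of $f$, $g$, $gf$ are in $W$, so is the third. Double categories are strict, and functors between them are strict double functors. A horizontal transformation $a\colon G\Rightarrow K$ has horizontal arrows $a_X\colon GX\to KX$ and, for every vertical arrow $v\colon X\to Y$, a cell $a_v$ with vertical domain $a_X$, vertical codomain $a_Y$, horizontal domain $Gv$ and horizontal codomain $Kv$; these are strictly functorial in $v$ (including identities) and natural with respect to horizontal arrows and cells. For a double category $\mathbb{X}$ let $h\mathbb{X}$ be its category of horizontal arrows, $v\mathbb{X}=\mathbb{X}_0$ its category of vertical arrows, and $\mathbb{X}_1$ the category of horizontal arrows and cells under vertical composition. $\mathbb{X}$ is weakly globular if the canonical functor $\mathbb{X}_0\to\mathbb{X}_0^d$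 to the discrete category of path components of $\mathbb{X}_0$ is an equivalence and the induced functors $\mathbb{X}_1\times_{\mathbb{X}_0}\cdots\times_{\mathbb{X}_0}\mathbb{X}_1\to\mathbb{X}_1\times_{\mathbb{X}_0^d}\cdots\times_{\mathbb{X}_0^d}\mathbb{X}_1$ ($n$ factors) are equivalences for all $n\ge 2$. $\mathsf{WGDbl}_h$ is the 2-category of weakly globular double categories, strict functors and horizontal transformations. For a category $\mathbf{A}$, $H\mathbf{A}$ (resp. $V\mathbf{A}$) is the double category whose horizontal (resp. vertical) arrows are the arrows of $\mathbf{A}$, and whose vertical (resp. horizontal) arrows and cells are identities. The double category $\mathbf{C}\{W\}$. Its objects are the arrows $(w)$ in $W$. A horizontal arrow from $(w\colon A\to B)$ to $(w'\colon A'\to B')$ is an arrow $A\to A'$ of $\mathbf{C}$. A vertical arrow from $(w_1\colon A_1\to B)$ to $(w_2\colon A_2\to B)$ is an equivalence class $[u_1,C,u_2]$ of diagrams $A_1\xleftarrow{u_1}C\xrightarrow{u_2}A_2$ with $w_1u_1=w_2u_2\in W$, where $(u_1,C,u_2)$ and $(v_1,D,v_2)$ are equivalent if there are $r\colon E\to C$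 and $s\colon E\to D$ with $u_ir=v_is$ ($i=1,2$) and $w_1u_1r\in W$. A double cell with vertical domain $f_1\colon(w_1)\to(w_1')$, vertical codomain $f_2\colon(w_2)\to(w_2')$, horizontal domain $\ell$ and horizontal codomain $\ell'$ is an equivalence class of families that assign to each pair of representatives $(u_1,C,u_2)$ of $\ell$ and $(u_1',C',u_2')$ of $\ell'$ a (possibly empty) set of arrows $\varphi\colon C\to C'$ with $u_i'\varphi=f_iu_i$ ($i=1,2$); a family has to be closed under precomposition with any $r\colon D\to C$ such that $w_1u_1r\in W$ (passing to the representative $(u_1r,D,u_2r)$), and for each pair of representatives the set at $(u_1r,D,u_2r)$, $(u_1',C',u_2')$ has to be non-empty for some such $r$. Two families are equivalent if for each pair of representatives there is such an $r$ for which their sets at $(u_1r,D,u_2r)$, $(u_1',C',u_2')$ share an arrow. Any two parallel vertical arrows are equal and there is at most one double cell with a given boundary; vertical arrows are composed by means of squares $u_2\bar v_1=v_1\bar u_2$, and double cells by composing components. $\mathcal{J}_{\mathbf{C}}\colon H\mathbf{C}\to\mathbf{C}\{W\}$ is the strict inclusion, $A\mapsto(1_A)$, $f\mapsto f$. Companions.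 For a double category $\mathbb{D}$, $\mathbb{C}\mathrm{omp}(\mathbb{D})$ has the objects and horizontal arrows of $\mathbb{D}$. Its vertical arrows $A\to B$ are the quadruples $\theta=(h,v,\psi,\chi)$ of a horizontal arrow $h\colon A\to B$, a vertical arrow $v\colon A\to B$ and binding cells: $\psi$ with vertical domain $1_A$, vertical codomain $h$, horizontal domain $1_A$, horizontal codomain $v$; $\chi$ with vertical domain $h$, vertical codomain $1_B$, horizontal domain $v$, horizontal codomain $1_B$; such that the horizontal composite of $\psi$ and $\chi$ is the vertical identity cell of $h$ and their vertical composite is the horizontal identity cell of $v$. A cell with vertical domain $f$, vertical codomain $g$, horizontal domain $\theta$ and horizontal codomain $\theta'$ is a cell $\alpha$ of $\mathbb{D}$ with vertical domain $f$, vertical codomain $g$, horizontal domain $v$ and horizontal codomain $v'$ such that $h'f=gh$, the horizontal composite of $\alpha$ and $\chi'$ equals that of $\chi$ and $1_g$, and the horizontal composite of $\psi$ and $\alpha$ equals that of $1_f$ and $\psi'$. Companion pairs are composed by the usual pasting. Let $h_-\colon v\,\mathbb{C}\mathrm{omp}(\mathbb{D})\to h\mathbb{D}$ be the identity on objects and $\theta\mapsto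 h$ on arrows. $\mathbb{C}\mathrm{omp}(-)$ acts on strict functors and on horizontal transformations. $W$-friendly functors. $\nabla W$ is the category with the arrows of $W$ as objects, in which an arrow from $w\colon A\to B$ to $w'\colon A'\to B$ is an arrow $u\colon A\to A'$ with $w'u=w$; $D_0\colon\nabla W\to\mathbf{C}$ takes domains. A $W$-friendly functor $H\mathbf{C}\to\mathbb{D}$ is a triple $(G,\Gamma,\gamma)$ of strict functors $G\colon H\mathbf{C}\to\mathbb{D}$ and $\Gamma\colon V\nabla W\to\mathbb{C}\mathrm{omp}(\mathbb{D})$ and a natural isomorphism $\gamma\colon h_-\circ v\Gamma\Rightarrow hG\circ D_0$. A $W$-friendly horizontal transformation $(G,\Gamma,\gamma)\Rightarrow(L,\Lambda,\lambda)$ is a pair of horizontal transformations $a\colon G\Rightarrow L$ and $\alpha\colon\Gamma\Rightarrow\Lambda$ with $\lambda_w\circ\alpha_w=a_{D_0w}\circ\gamma_w$ for all $w\in W$. These form a category $\mathrm{Hom}_{\mathsf{WGDbl}_h,W}(H\mathbf{C},\mathbb{D})$. The functor $\mathcal{J}_{\mathbf{C}}$ has a canonical $W$-friendly structure $(\Phi,\varphi)$: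 $\Phi(w)=(w)$; an arrow $u\colon wu\to w$ of $\nabla W$, with $u\colon A\to A'$, is sent to the companion pair with horizontal arrow $u\colon(wu)\to(w)$, vertical arrow $[1_A,A,u]$ and binding cells represented by $1_A$ and by $u$; and $\varphi_w\colon(w)\to(1_A)$ is given by $1_A$, for $w\colon A\to B$. Theorem. For every weakly globular double category $\mathbb{D}$, composition with $\mathcal{J}_{\mathbf{C}}$, that is, the functor sending $L$ to $(L\mathcal{J}_{\mathbf{C}},\mathbb{C}\mathrm{omp}(L)\circ\Phi,L\varphi)$ and $b\colon L\Rightarrow L'$ to $(b\mathcal{J}_{\mathbf{C}},\mathbb{C}\mathrm{omp}(b)\circ\Phi)$, is an equivalence of categories $$\mathrm{Hom}_{\mathsf{WGDbl}_h}(\mathbf{C}\{W\},\mathbb{D})\simeq\mathrm{Hom}_{\mathsf{WGDbl}_h,W}(H\mathbf{C},\mathbb{D}).$$ -/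

import Mathlib

open CategoryTheory

universe u v₁ v₂ v₃ u' v₁' v₂' v₃' u'' v₁'' v₂'' v₃'' uC vC

/-- A strict double category. Composition is written in diagrammatic order. A cell of type
`Cell t b l r` has vertical domain `t`, vertical codomain `b`, horizontal domain `l` and
horizontal codomain `r`. -/
structure DblCat where
  Obj : Type u
  Hor : Obj → Obj → Type v₁
  Ver : Obj → Obj → Type v₂
  Cell : ∀ {a b c d : Obj}, Hor a b → Hor c d → Ver a c → Ver b d → Type v₃
  hId : ∀ a, Hor a a
  hComp : ∀ {a b c}, Hor a b → Hor b c → Hor a c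
  hId_comp : ∀ {a b} (f : Hor a b), hComp (hId a) f = f
  hComp_id : ∀ {a b} (f : Hor a b), hComp f (hId b) = f
  hAssoc : ∀ {a b c d} (f : Hor a b) (g : Hor b c) (k : Hor c d),
    hComp (hComp f g) k = hComp f (hComp g k)
  vId : ∀ a, Ver a a
  vComp : ∀ {a b c}, Ver a b → Ver b c → Ver a c
  vId_comp : ∀ {a b} (f : Ver a b), vComp (vId a) f = f
  vComp_id : ∀ {a b} (f : Ver a b), vComp f (vId b) = f
  vAssoc : ∀ {a b c d} (f : Ver a b) (g : Ver b c) (k : Ver c d),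
    vComp (vComp f g) k = vComp f (vComp g k)
  /-- the horizontal identity cell on a vertical arrow -/
  cellH : ∀ {a b} (v : Ver a b), Cell (hId a) (hId b) v v
  /-- the vertical identity cell on a horizontal arrow -/
  cellV : ∀ {a b} (f : Hor a b), Cell f f (vId a) (vId b)
  /-- horizontal composition of cells -/
  hCell : ∀ {a b c d e f} {t : Hor a b} {s : Hor c d} {l : Ver a c} {m : Ver b d}
    {t' : Hor b e} {s' : Hor d f} {r : Ver e f},
    Cell t s l m → Cell t' s' m r → Cell (hComp t t') (hComp s s') l r
  /-- vertical composition of cells -/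
  vCell : ∀ {a b c d e f} {t : Hor a b} {m : Hor c d} {s : Hor e f}
    {l : Ver a c} {r : Ver b d} {l' : Ver c e} {r' : Ver d f},
    Cell t m l r → Cell m s l' r' → Cell t s (vComp l l') (vComp r r')
  hCell_id_left : ∀ {a b c d} {t : Hor a b} {s : Hor c d} {l : Ver a c} {r : Ver b d}
    (x : Cell t s l r), HEq (hCell (cellH l) x) x
  hCell_id_right : ∀ {a b c d} {t : Hor a b} {s : Hor c d} {l : Ver a c} {r : Ver b d}
    (x : Cell t s l r), HEq (hCell x (cellH r)) x
  hCell_assoc : ∀ {a b c d a' b' c' d'} {t : Hor a b} {t' : Hor b c} {t'' : Hor c d}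
    {s : Hor a' b'} {s' : Hor b' c'} {s'' : Hor c' d'}
    {l : Ver a a'} {m : Ver b b'} {n : Ver c c'} {r : Ver d d'}
    (x : Cell t s l m) (y : Cell t' s' m n) (z : Cell t'' s'' n r),
    HEq (hCell (hCell x y) z) (hCell x (hCell y z))
  vCell_id_left : ∀ {a b c d} {t : Hor a b} {s : Hor c d} {l : Ver a c} {r : Ver b d}
    (x : Cell t s l r), HEq (vCell (cellV t) x) x
  vCell_id_right : ∀ {a b c d} {t : Hor a b} {s : Hor c d} {l : Ver a c} {r : Ver b d}
    (x : Cell t s l r), HEq (vCell x (cellV s)) x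
  vCell_assoc : ∀ {a b c d a' b' c' d'} {l : Ver a b} {l' : Ver b c} {l'' : Ver c d}
    {r : Ver a' b'} {r' : Ver b' c'} {r'' : Ver c' d'}
    {t : Hor a a'} {m : Hor b b'} {n : Hor c c'} {s : Hor d d'}
    (x : Cell t m l r) (y : Cell m n l' r') (z : Cell n s l'' r''),
    HEq (vCell (vCell x y) z) (vCell x (vCell y z))
  /-- the middle four interchange law -/
  interchange : ∀ {a₁ a₂ a₃ b₁ b₂ b₃ c₁ c₂ c₃}
    {f : Hor a₁ a₂} {f' : Hor a₂ a₃} {g : Hor b₁ b₂} {g' : Hor b₂ b₃} {k : Hor c₁ c₂}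
    {k' : Hor c₂ c₃} {l : Ver a₁ b₁} {m : Ver a₂ b₂} {r : Ver a₃ b₃}
    {l' : Ver b₁ c₁} {m' : Ver b₂ c₂} {r' : Ver b₃ c₃}
    (x : Cell f g l m) (y : Cell f' g' m r) (z : Cell g k l' m') (w : Cell g' k' m' r'),
    vCell (hCell x y) (hCell z w) = hCell (vCell x z) (vCell y w)
  cellH_vId : ∀ a, cellH (vId a) = cellV (hId a)
  cellH_vComp : ∀ {a b c} (v : Ver a b) (w : Ver b c),
    cellH (vComp v w) = vCell (cellH v) (cellH w)
  cellV_hComp : ∀ {a b c} (f : Hor a b) (g : Hor b c),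
    cellV (hComp f g) = hCell (cellV f) (cellV g)

namespace DblCat

attribute [simp] hId_comp hComp_id hAssoc vId_comp vComp_id vAssoc

variable (D : DblCat.{u, v₁, v₂, v₃})

/-- The category of objects and horizontal arrows. -/
def HorCat := D.Obj

/-- The category of objects and vertical arrows. -/
def VerCat := D.Obj

instance : Category.{v₁} D.HorCat where
  Hom a b := D.Hor a b
  id a := D.hId a
  comp f g := D.hComp f g
  id_comp f := D.hId_comp f
  comp_id f := D.hComp_id f
  assoc f g k := D.hAssoc f g k

instance : Category.{v₂} D.VerCat where
  Hom a b := D.Ver a b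
  id a := D.vId a
  comp f g := D.vComp f g
  id_comp f := D.vId_comp f
  comp_id f := D.vComp_id f
  assoc f g k := D.vAssoc f g k

variable {D}

theorem hCell_congr {a b c d e f : D.Obj} {t t₁ : D.Hor a b} {s s₁ : D.Hor c d}
    {l l₁ : D.Ver a c} {m m₁ : D.Ver b d} {t' t'₁ : D.Hor b e} {s' s'₁ : D.Hor d f}
    {r r₁ : D.Ver e f} {x : D.Cell t s l m} {x₁ : D.Cell t₁ s₁ l₁ m₁}
    {y : D.Cell t' s' m r} {y₁ : D.Cell t'₁ s'₁ m₁ r₁}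
    (ht : t = t₁) (hs : s = s₁) (hl : l = l₁) (hm : m = m₁) (ht' : t' = t'₁) (hs' : s' = s'₁)
    (hr : r = r₁) (hx : HEq x x₁) (hy : HEq y y₁) : HEq (D.hCell x y) (D.hCell x₁ y₁) := by
  subst ht hs hl hm ht' hs' hr hx hy; rfl

theorem vCell_congr {a b c d e f : D.Obj} {t t₁ : D.Hor a b} {m m₁ : D.Hor c d}
    {s s₁ : D.Hor e f} {l l₁ : D.Ver a c} {r r₁ : D.Ver b d} {l' l'₁ : D.Ver c e}
    {r' r'₁ : D.Ver d f} {x : D.Cell t m l r} {x₁ : D.Cell t₁ m₁ l₁ r₁}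
    {y : D.Cell m s l' r'} {y₁ : D.Cell m₁ s₁ l'₁ r'₁}
    (ht : t = t₁) (hm : m = m₁) (hs : s = s₁) (hl : l = l₁) (hr : r = r₁) (hl' : l' = l'₁)
    (hr' : r' = r'₁) (hx : HEq x x₁) (hy : HEq y y₁) :
    HEq (D.vCell x y) (D.vCell x₁ y₁) := by
  subst ht hm hs hl hr hl' hr' hx hy; rfl

/-- Transport of a cell along equalities of its boundary arrows. -/
def castCell {a b c d : D.Obj} {t t₁ : D.Hor a b} {s s₁ : D.Hor c d} {l l₁ : D.Ver a c}
    {r r₁ : D.Ver b d} (ht : t = t₁) (hs : s = s₁) (hl : l = l₁) (hr : r = r₁)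
    (x : D.Cell t s l r) : D.Cell t₁ s₁ l₁ r₁ :=
  cast (by subst ht hs hl hr; rfl) x

theorem castCell_heq {a b c d : D.Obj} {t t₁ : D.Hor a b} {s s₁ : D.Hor c d} {l l₁ : D.Ver a c}
    {r r₁ : D.Ver b d} (ht : t = t₁) (hs : s = s₁) (hl : l = l₁) (hr : r = r₁)
    (x : D.Cell t s l r) : HEq (castCell ht hs hl hr x) x :=
  cast_heq _ _

end DblCat

open DblCat

/-! ### Strict functors -/

/-- A strict functor of double categories. -/
@[ext]
structure DblFunctor (X : DblCat.{u, v₁, v₂, v₃}) (Y : DblCat.{u', v₁', v₂', v₃'}) where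
  obj : X.Obj → Y.Obj
  hor : ∀ {a b}, X.Hor a b → Y.Hor (obj a) (obj b)
  ver : ∀ {a b}, X.Ver a b → Y.Ver (obj a) (obj b)
  cell : ∀ {a b c d} {t : X.Hor a b} {s : X.Hor c d} {l : X.Ver a c} {r : X.Ver b d},
    X.Cell t s l r → Y.Cell (hor t) (hor s) (ver l) (ver r)
  hor_id : ∀ a, hor (X.hId a) = Y.hId (obj a)
  hor_comp : ∀ {a b c} (f : X.Hor a b) (g : X.Hor b c),
    hor (X.hComp f g) = Y.hComp (hor f) (hor g)
  ver_id : ∀ a, ver (X.vId a) = Y.vId (obj a)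
  ver_comp : ∀ {a b c} (f : X.Ver a b) (g : X.Ver b c),
    ver (X.vComp f g) = Y.vComp (ver f) (ver g)
  cell_cellH : ∀ {a b} (v : X.Ver a b), HEq (cell (X.cellH v)) (Y.cellH (ver v))
  cell_cellV : ∀ {a b} (f : X.Hor a b), HEq (cell (X.cellV f)) (Y.cellV (hor f))
  cell_hCell : ∀ {a b c d e f} {t : X.Hor a b} {s : X.Hor c d} {l : X.Ver a c} {m : X.Ver b d}
    {t' : X.Hor b e} {s' : X.Hor d f} {r : X.Ver e f} (x : X.Cell t s l m)
    (y : X.Cell t' s' m r), HEq (cell (X.hCell x y)) (Y.hCell (cell x) (cell y))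
  cell_vCell : ∀ {a b c d e f} {t : X.Hor a b} {m : X.Hor c d} {s : X.Hor e f}
    {l : X.Ver a c} {r : X.Ver b d} {l' : X.Ver c e} {r' : X.Ver d f}
    (x : X.Cell t m l r) (y : X.Cell m s l' r'),
    HEq (cell (X.vCell x y)) (Y.vCell (cell x) (cell y))

namespace DblFunctor

attribute [simp] hor_id hor_comp ver_id ver_comp

variable {X : DblCat.{u, v₁, v₂, v₃}} {Y : DblCat.{u', v₁', v₂', v₃'}}
  {Z : DblCat.{u'', v₁'', v₂'', v₃''}}

theorem cell_congr (F : DblFunctor X Y) {a b c d : X.Obj} {t t₁ : X.Hor a b} {s s₁ : X.Hor c d}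
    {l l₁ : X.Ver a c} {r r₁ : X.Ver b d} (ht : t = t₁) (hs : s = s₁) (hl : l = l₁)
    (hr : r = r₁) {x : X.Cell t s l r} {x₁ : X.Cell t₁ s₁ l₁ r₁} (hx : HEq x x₁) :
    HEq (F.cell x) (F.cell x₁) := by
  subst ht hs hl hr hx; rfl

/-- Composition of strict functors, in diagrammatic order. -/
def comp (F : DblFunctor X Y) (G : DblFunctor Y Z) : DblFunctor X Z where
  obj a := G.obj (F.obj a)
  hor f := G.hor (F.hor f)
  ver f := G.ver (F.ver f)
  cell x := G.cell (F.cell x)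
  hor_id a := by simp
  hor_comp f g := by simp
  ver_id a := by simp
  ver_comp f g := by simp
  cell_cellH v := (G.cell_congr (by simp) (by simp) rfl rfl (F.cell_cellH v)).trans
    (G.cell_cellH _)
  cell_cellV f := (G.cell_congr rfl rfl (by simp) (by simp) (F.cell_cellV f)).trans
    (G.cell_cellV _)
  cell_hCell x y := (G.cell_congr (by simp) (by simp) rfl rfl (F.cell_hCell x y)).trans
    (G.cell_hCell _ _)
  cell_vCell x y := (G.cell_congr rfl rfl (by simp) (by simp) (F.cell_vCell x y)).trans
    (G.cell_vCell _ _)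

/-- The functor `hF` induced on categories of horizontal arrows. -/
def horFunctor (F : DblFunctor X Y) : X.HorCat ⥤ Y.HorCat where
  obj a := F.obj a
  map f := F.hor f
  map_id a := F.hor_id a
  map_comp f g := F.hor_comp f g

/-- The functor `vF` induced on categories of vertical arrows. -/
def verFunctor (F : DblFunctor X Y) : X.VerCat ⥤ Y.VerCat where
  obj a := F.obj a
  map f := F.ver f
  map_id a := F.ver_id a
  map_comp f g := F.ver_comp f g

end DblFunctor

/-! ### Horizontal transformations -/

/-- A horizontal transformation between strict functors. -/
structure HorTrans {X : DblCat.{u, v₁, v₂, v₃}} {Y : DblCat.{u', v₁', v₂', v₃'}}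
    (F G : DblFunctor X Y) where
  app : ∀ a, Y.Hor (F.obj a) (G.obj a)
  cell : ∀ {a b} (v : X.Ver a b), Y.Cell (app a) (app b) (F.ver v) (G.ver v)
  cell_id : ∀ a, HEq (cell (X.vId a)) (Y.cellV (app a))
  cell_comp : ∀ {a b c} (v : X.Ver a b) (w : X.Ver b c),
    HEq (cell (X.vComp v w)) (Y.vCell (cell v) (cell w))
  hor_naturality : ∀ {a b} (f : X.Hor a b),
    Y.hComp (F.hor f) (app b) = Y.hComp (app a) (G.hor f)
  cell_naturality : ∀ {a b c d} {t : X.Hor a b} {s : X.Hor c d} {l : X.Ver a c}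
    {r : X.Ver b d} (x : X.Cell t s l r),
    HEq (Y.hCell (F.cell x) (cell r)) (Y.hCell (cell l) (G.cell x))

namespace HorTrans

variable {X : DblCat.{u, v₁, v₂, v₃}} {Y : DblCat.{u', v₁', v₂', v₃'}}
  {Z : DblCat.{u'', v₁'', v₂'', v₃''}}

theorem ext_of_heq {F G : DblFunctor X Y} {α β : HorTrans F G} (h : ∀ a, α.app a = β.app a)
    (h' : ∀ {a b} (v : X.Ver a b), HEq (α.cell v) (β.cell v)) : α = β := by
  obtain ⟨p, q, _, _, _, _⟩ := α
  obtain ⟨p', q', _, _, _, _⟩ := β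
  obtain rfl : p = p' := funext h
  obtain rfl : @q = @q' := by
    funext a b v
    exact eq_of_heq (h' v)
  rfl

theorem cell_congr {F G : DblFunctor X Y} (α : HorTrans F G) {a b : X.Obj} {v w : X.Ver a b}
    (h : v = w) : HEq (α.cell v) (α.cell w) := by
  subst h; rfl

/-- The identity horizontal transformation. -/
def id (F : DblFunctor X Y) : HorTrans F F where
  app a := Y.hId _
  cell v := Y.cellH _
  cell_id a := by
    rw [F.ver_id, Y.cellH_vId]
  cell_comp v w := by
    rw [F.ver_comp, Y.cellH_vComp]
  hor_naturality f := by simp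
  cell_naturality x := (Y.hCell_id_right _).trans (Y.hCell_id_left _).symm

/-- The composite of horizontal transformations. -/
def comp {F G K : DblFunctor X Y} (α : HorTrans F G) (β : HorTrans G K) : HorTrans F K where
  app a := Y.hComp (α.app a) (β.app a)
  cell v := Y.hCell (α.cell v) (β.cell v)
  cell_id a := by
    rw [Y.cellV_hComp]
    exact hCell_congr rfl rfl (by simp) (by simp) rfl rfl (by simp) (α.cell_id a) (β.cell_id a)
  cell_comp v w := by
    rw [Y.interchange]
    exact hCell_congr rfl rfl (by simp) (by simp) rfl rfl (by simp) (α.cell_comp v w)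
      (β.cell_comp v w)
  hor_naturality f := by
    rw [← Y.hAssoc, α.hor_naturality, Y.hAssoc, β.hor_naturality, Y.hAssoc]
  cell_naturality {a b c d t s l r} x := by
    refine (Y.hCell_assoc _ _ _).symm.trans ?_
    refine (hCell_congr (α.hor_naturality t) (α.hor_naturality s) rfl rfl rfl rfl rfl
      (α.cell_naturality x) HEq.rfl).trans ?_
    refine (Y.hCell_assoc _ _ _).trans ?_
    refine (hCell_congr rfl rfl rfl rfl (β.hor_naturality t) (β.hor_naturality s) rfl HEq.rfl
      (β.cell_naturality x)).trans ?_
    exact (Y.hCell_assoc _ _ _).symm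

/-- Precomposition of a horizontal transformation with a strict functor. -/
def whiskerLeft (F : DblFunctor X Y) {G K : DblFunctor Y Z} (α : HorTrans G K) :
    HorTrans (F.comp G) (F.comp K) where
  app a := α.app (F.obj a)
  cell v := α.cell (F.ver v)
  cell_id a := (α.cell_congr (F.ver_id a)).trans (α.cell_id _)
  cell_comp v w := (α.cell_congr (F.ver_comp v w)).trans (α.cell_comp _ _)
  hor_naturality f := α.hor_naturality _
  cell_naturality x := α.cell_naturality _

end HorTrans

/-- The category of strict functors and horizontal transformations, i.e. the hom-category of
`DblCat_h` (and, `WGDbl_h` being a full sub-2-category, of `WGDbl_h`). -/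
instance {X : DblCat.{u, v₁, v₂, v₃}} {Y : DblCat.{u', v₁', v₂', v₃'}} :
    Category (DblFunctor X Y) where
  Hom F G := HorTrans F G
  id F := HorTrans.id F
  comp α β := HorTrans.comp α β
  id_comp α := HorTrans.ext_of_heq (fun _ => Y.hId_comp _) (fun _ => Y.hCell_id_left _)
  comp_id α := HorTrans.ext_of_heq (fun _ => Y.hComp_id _) (fun _ => Y.hCell_id_right _)
  assoc α β γ := HorTrans.ext_of_heq (fun _ => Y.hAssoc _ _ _) (fun _ => Y.hCell_assoc _ _ _)

/-! ### Companions -/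

/-- A companion pair (a vertical arrow of the double category of companions): a horizontal and a
vertical arrow together with binding cells satisfying the companion equations. -/
structure Companion (D : DblCat.{u, v₁, v₂, v₃}) (a b : D.Obj) where
  hor : D.Hor a b
  ver : D.Ver a b
  psi : D.Cell (D.hId a) hor (D.vId a) ver
  chi : D.Cell hor (D.hId b) ver (D.vId b)
  hor_eq : HEq (D.hCell psi chi) (D.cellV hor)
  ver_eq : HEq (D.vCell psi chi) (D.cellH ver)

namespace Companion

variable {D : DblCat.{u, v₁, v₂, v₃}}

theorem ext_of_heq {a b : D.Obj} {x y : Companion D a b} (h₁ : x.hor = y.hor)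
    (h₂ : x.ver = y.ver) (h₃ : HEq x.psi y.psi) (h₄ : HEq x.chi y.chi) : x = y := by
  obtain ⟨h, v, p, q, _, _⟩ := x
  obtain ⟨h', v', p', q', _, _⟩ := y
  dsimp only at h₁ h₂ h₃ h₄
  subst h₁ h₂ h₃ h₄
  rfl

/-- The identity companion pair. -/
def id (D : DblCat.{u, v₁, v₂, v₃}) (a : D.Obj) : Companion D a a where
  hor := D.hId a
  ver := D.vId a
  psi := D.cellV _
  chi := D.cellV _
  hor_eq := by
    rw [← D.cellV_hComp, D.hId_comp]
  ver_eq := by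
    rw [D.cellH_vId]
    exact D.vCell_id_left _

/-- The pasting defining the first binding cell of a composite companion pair. -/
def psiComp {a b c : D.Obj} (x : Companion D a b) (y : Companion D b c) :=
  D.vCell (D.hCell x.psi (D.cellH x.ver)) (D.hCell (D.cellV x.hor) y.psi)

/-- The pasting defining the second binding cell of a composite companion pair. -/
def chiComp {a b c : D.Obj} (x : Companion D a b) (y : Companion D b c) :=
  D.vCell (D.hCell x.chi (D.cellV y.hor)) (D.hCell (D.cellH y.ver) y.chi)

theorem hCell_psiComp_chiComp {a b c : D.Obj} (x : Companion D a b) (y : Companion D b c) :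
    HEq (D.hCell (psiComp x y) (chiComp x y)) (D.cellV (D.hComp x.hor y.hor)) := by
  unfold psiComp chiComp
  rw [← D.interchange]
  have e₁ : HEq (D.hCell (D.hCell x.psi (D.cellH x.ver)) (D.hCell x.chi (D.cellV y.hor)))
      (D.cellV (D.hComp x.hor y.hor)) := by
    refine (D.hCell_assoc _ _ _).trans ?_
    refine (hCell_congr rfl rfl rfl rfl ?_ ?_ rfl HEq.rfl
      ((D.hCell_assoc _ _ _).symm.trans (hCell_congr ?_ ?_ rfl rfl rfl rfl rfl
        (D.hCell_id_left _) HEq.rfl))).trans ?_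
    · simp
    · simp
    · simp
    · simp
    refine (D.hCell_assoc _ _ _).symm.trans ?_
    rw [D.cellV_hComp]
    exact hCell_congr (by simp) (by simp) rfl rfl rfl rfl rfl x.hor_eq HEq.rfl
  have e₂ : HEq (D.hCell (D.hCell (D.cellV x.hor) y.psi) (D.hCell (D.cellH y.ver) y.chi))
      (D.cellV (D.hComp x.hor y.hor)) := by
    refine (D.hCell_assoc _ _ _).trans ?_
    refine (hCell_congr rfl rfl rfl rfl ?_ ?_ rfl HEq.rfl
      ((D.hCell_assoc _ _ _).symm.trans (hCell_congr ?_ ?_ rfl rfl rfl rfl rfl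
        (D.hCell_id_right _) HEq.rfl))).trans ?_
    · simp
    · simp
    · simp
    · simp
    rw [D.cellV_hComp]
    exact hCell_congr rfl rfl rfl rfl (by simp) (by simp) rfl HEq.rfl y.hor_eq
  refine (vCell_congr (by simp) (by simp) (by simp) rfl rfl rfl rfl e₁ e₂).trans ?_
  exact D.vCell_id_left _

theorem vCell_psiComp_chiComp {a b c : D.Obj} (x : Companion D a b) (y : Companion D b c) :
    HEq (D.vCell (psiComp x y) (chiComp x y)) (D.cellH (D.vComp x.ver y.ver)) := by
  unfold psiComp chiComp
  have m : HEq (D.vCell (D.hCell (D.cellV x.hor) y.psi) (D.hCell x.chi (D.cellV y.hor)))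
      (D.hCell x.chi y.psi) := by
    rw [D.interchange]
    exact hCell_congr rfl rfl (by simp) (by simp) rfl rfl (by simp) (D.vCell_id_left _)
      (D.vCell_id_right _)
  refine (D.vCell_assoc _ _ _).trans ?_
  refine (vCell_congr rfl rfl rfl rfl rfl ?_ ?_ HEq.rfl
    ((D.vCell_assoc _ _ _).symm.trans (vCell_congr rfl rfl rfl ?_ ?_ rfl rfl m HEq.rfl))).trans ?_
  · simp
  · simp
  · simp
  · simp
  refine (D.vCell_assoc _ _ _).symm.trans ?_
  rw [D.interchange x.psi]
  have e : HEq (D.hCell (D.vCell x.psi x.chi) (D.vCell (D.cellH x.ver) y.psi))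
      (D.vCell (D.cellH x.ver) y.psi) := by
    refine (hCell_congr rfl rfl (by simp) rfl rfl rfl rfl
      (x.ver_eq.trans (show HEq (D.cellH x.ver) (D.cellH (D.vComp x.ver (D.vId b))) by
        rw [D.vComp_id])) HEq.rfl).trans ?_
    exact D.hCell_id_left _
  refine (vCell_congr (by simp) (by simp) (by simp) (by simp) (by simp) rfl (by simp) e
    (D.hCell_id_left _)).trans ?_
  refine (D.vCell_assoc _ _ _).trans ?_
  rw [D.cellH_vComp]
  exact vCell_congr rfl rfl rfl rfl rfl (by simp) (by simp) HEq.rfl y.ver_eq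

/-- Composition of companion pairs. -/
def comp {a b c : D.Obj} (x : Companion D a b) (y : Companion D b c) : Companion D a c where
  hor := D.hComp x.hor y.hor
  ver := D.vComp x.ver y.ver
  psi := castCell (by simp) rfl (by simp) rfl (psiComp x y)
  chi := castCell rfl (by simp) rfl (by simp) (chiComp x y)
  hor_eq := (hCell_congr (by simp) rfl (by simp) rfl rfl (by simp) (by simp)
    (castCell_heq _ _ _ _ _) (castCell_heq _ _ _ _ _)).trans (hCell_psiComp_chiComp x y)
  ver_eq := (vCell_congr (by simp) rfl (by simp) (by simp) rfl rfl (by simp)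
    (castCell_heq _ _ _ _ _) (castCell_heq _ _ _ _ _)).trans (vCell_psiComp_chiComp x y)

theorem comp_psi {a b c : D.Obj} (x : Companion D a b) (y : Companion D b c) :
    HEq (comp x y).psi (psiComp x y) :=
  castCell_heq (by simp) rfl (by simp) rfl _

theorem comp_chi {a b c : D.Obj} (x : Companion D a b) (y : Companion D b c) :
    HEq (comp x y).chi (chiComp x y) :=
  castCell_heq rfl (by simp) rfl (by simp) _

theorem id_comp {a b : D.Obj} (x : Companion D a b) : comp (id D a) x = x := by
  refine ext_of_heq (D.hId_comp _) (D.vId_comp _) ((comp_psi _ _).trans ?_)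
    ((comp_chi _ _).trans ?_)
  · refine (vCell_congr (by simp [id]) (by simp [id]) (by simp [id]) rfl (by simp [id]) rfl rfl
      (D.hCell_id_right _) (y₁ := x.psi) ?_).trans (D.vCell_id_left _)
    dsimp only [id]
    rw [← D.cellH_vId]
    exact D.hCell_id_left _
  · refine (vCell_congr (by simp [id]) (by simp [id]) (by simp [id]) rfl (by simp [id]) rfl rfl
      (x₁ := D.cellV x.hor) ?_ (D.hCell_id_left _)).trans (D.vCell_id_left _)
    dsimp only [id]
    rw [← D.cellV_hComp, D.hId_comp]

theorem comp_id {a b : D.Obj} (x : Companion D a b) : comp x (id D b) = x := by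
  refine ext_of_heq (D.hComp_id _) (D.vComp_id _) ((comp_psi _ _).trans ?_)
    ((comp_chi _ _).trans ?_)
  · refine (vCell_congr (by simp [id]) (by simp [id]) (by simp [id]) rfl rfl rfl rfl
      (D.hCell_id_right _) (y₁ := D.cellV x.hor) ?_).trans (D.vCell_id_right _)
    dsimp only [id]
    rw [← D.cellV_hComp, D.hComp_id]
  · refine (vCell_congr (by simp [id]) (by simp [id]) (by simp [id]) rfl rfl rfl rfl
      (x₁ := x.chi) ?_ (y₁ := D.cellV (D.hId b)) (D.hCell_id_left _)).trans (D.vCell_id_right _)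
    dsimp only [id]
    rw [← D.cellH_vId]
    exact D.hCell_id_right _

theorem assoc {a b c d : D.Obj} (x : Companion D a b) (y : Companion D b c)
    (z : Companion D c d) : comp (comp x y) z = comp x (comp y z) := by
  refine ext_of_heq (D.hAssoc _ _ _) (D.vAssoc _ _ _) ?_ ?_
  · refine (comp_psi _ _).trans (HEq.trans ?_ (comp_psi _ _).symm)
    -- both sides are the pasting of three rows of three cells
    have e₁ : HEq (psiComp (comp x y) z)
        (D.vCell (D.vCell (D.hCell (D.hCell x.psi (D.cellH x.ver)) (D.cellH x.ver))
          (D.hCell (D.hCell (D.cellV x.hor) y.psi) (D.cellH y.ver)))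
          (D.hCell (D.cellV (D.hComp x.hor y.hor)) z.psi)) := by
      rw [D.interchange, ← D.cellH_vComp]
      exact vCell_congr (by simp) rfl rfl (by simp) rfl rfl rfl
        (hCell_congr (by simp) rfl (by simp) rfl rfl rfl rfl
          (comp_psi _ _) HEq.rfl) HEq.rfl
    obtain ⟨A, hA⟩ : ∃ A : D.Cell (D.hId b) (D.hComp y.hor (D.hId c)) (D.vId b) y.ver,
        HEq A (D.hCell y.psi (D.cellH y.ver)) :=
      ⟨castCell (D.hId_comp _) rfl rfl rfl _, castCell_heq (D.hId_comp _) rfl rfl rfl _⟩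
    have e₂ : HEq (psiComp x (comp y z))
        (D.vCell (D.hCell x.psi (D.cellH x.ver))
          (D.vCell (D.hCell (D.cellV x.hor) A)
            (D.hCell (D.cellV x.hor) (D.hCell (D.cellV y.hor) z.psi)))) := by
      rw [D.interchange (D.cellV x.hor)]
      refine vCell_congr rfl rfl rfl rfl rfl (by simp) rfl HEq.rfl ?_
      refine hCell_congr rfl rfl (by simp) (by simp) rfl rfl rfl
        (D.vCell_id_left _).symm ((comp_psi _ _).trans ?_)
      exact vCell_congr (by simp) rfl rfl rfl rfl rfl rfl hA.symm HEq.rfl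
    refine e₁.trans (HEq.trans ?_ e₂.symm)
    refine (D.vCell_assoc _ _ _).trans ?_
    refine vCell_congr (by simp) (by simp) (by simp) rfl rfl rfl rfl ?_ ?_
    · refine (D.hCell_assoc _ _ _).trans (hCell_congr rfl rfl rfl rfl (by simp) (by simp) rfl
        HEq.rfl (D.hCell_id_left _))
    · refine vCell_congr (by simp) (by simp) (by simp) rfl rfl rfl rfl
        ((D.hCell_assoc _ _ _).trans (hCell_congr rfl rfl rfl rfl (by simp) rfl rfl HEq.rfl
          hA.symm)) ?_
      rw [D.cellV_hComp]
      exact D.hCell_assoc _ _ _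
  · refine (comp_chi _ _).trans (HEq.trans ?_ (comp_chi _ _).symm)
    obtain ⟨A, hA⟩ : ∃ A : D.Cell (D.hComp (D.hId b) y.hor) (D.hId c) y.ver (D.vId c),
        HEq A (D.hCell (D.cellH y.ver) y.chi) :=
      ⟨castCell rfl (D.hComp_id _) rfl rfl _, castCell_heq rfl (D.hComp_id _) rfl rfl _⟩
    have e₁ : HEq (chiComp (comp x y) z)
        (D.vCell (D.vCell (D.hCell (D.hCell x.chi (D.cellV y.hor)) (D.cellV z.hor))
          (D.hCell A (D.cellV z.hor)))
          (D.hCell (D.cellH z.ver) z.chi)) := by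
      rw [D.interchange]
      refine vCell_congr rfl rfl rfl rfl (by simp) rfl rfl ?_ HEq.rfl
      refine hCell_congr rfl rfl rfl (by simp) rfl rfl (by simp)
        ((comp_chi _ _).trans ?_) (D.vCell_id_left _).symm
      exact vCell_congr rfl rfl (by simp) rfl rfl rfl rfl HEq.rfl hA.symm
    obtain ⟨B, hB⟩ : ∃ B : D.Cell (D.hComp (D.hId c) z.hor) (D.hId d) z.ver (D.vId d),
        HEq B (D.hCell (D.cellH z.ver) z.chi) :=
      ⟨castCell rfl (D.hComp_id _) rfl rfl _, castCell_heq rfl (D.hComp_id _) rfl rfl _⟩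
    have e₂ : HEq (chiComp x (comp y z))
        (D.vCell (D.hCell x.chi (D.cellV (D.hComp y.hor z.hor)))
          (D.vCell (D.hCell (D.cellH y.ver) (D.hCell y.chi (D.cellV z.hor)))
            (D.hCell (D.cellH z.ver) B))) := by
      rw [D.interchange (D.cellH y.ver), ← D.cellH_vComp]
      refine vCell_congr rfl rfl rfl rfl rfl rfl (by simp) HEq.rfl ?_
      refine hCell_congr rfl rfl rfl rfl rfl rfl (by simp)
        HEq.rfl ((comp_chi _ _).trans ?_)
      exact vCell_congr rfl rfl (by simp) rfl rfl rfl rfl HEq.rfl hB.symm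
    refine e₁.trans (HEq.trans ?_ e₂.symm)
    refine (D.vCell_assoc _ _ _).trans ?_
    refine vCell_congr (by simp) (by simp) (by simp) rfl rfl rfl rfl ?_ ?_
    · rw [D.cellV_hComp]
      exact D.hCell_assoc _ _ _
    · refine vCell_congr (by simp) (by simp) (by simp) rfl rfl rfl rfl
        ((hCell_congr rfl (by simp) rfl rfl rfl rfl rfl hA HEq.rfl).trans
          (D.hCell_assoc _ _ _)) ?_
      exact hB.symm.trans (D.hCell_id_left _).symm

end Companion

/-- A double cell of the double category of companions. -/
structure CompCell {D : DblCat.{u, v₁, v₂, v₃}} {a b c d : D.Obj} (t : D.Hor a b) (s : D.Hor c d)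
    (l : Companion D a c) (r : Companion D b d) where
  cell : D.Cell t s l.ver r.ver
  hor_comm : D.hComp t r.hor = D.hComp l.hor s
  chi_eq : HEq (D.hCell cell r.chi) (D.hCell l.chi (D.cellV s))
  psi_eq : HEq (D.hCell l.psi cell) (D.hCell (D.cellV t) r.psi)

namespace CompCell

variable {D : DblCat.{u, v₁, v₂, v₃}}

@[ext]
theorem ext' {a b c d : D.Obj} {t : D.Hor a b} {s : D.Hor c d} {l : Companion D a c}
    {r : Companion D b d} {x y : CompCell t s l r} (h : x.cell = y.cell) : x = y := by
  cases x; cases y; cases h; rfl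

theorem heq_of_heq {a b c d : D.Obj} {t t₁ : D.Hor a b} {s s₁ : D.Hor c d}
    {l l₁ : Companion D a c} {r r₁ : Companion D b d} (ht : t = t₁) (hs : s = s₁) (hl : l = l₁)
    (hr : r = r₁) {x : CompCell t s l r} {y : CompCell t₁ s₁ l₁ r₁}
    (h : HEq x.cell y.cell) : HEq x y := by
  subst ht hs hl hr
  exact heq_of_eq (ext' (eq_of_heq h))

def cellH {a b : D.Obj} (x : Companion D a b) : CompCell (D.hId a) (D.hId b) x x where
  cell := D.cellH _
  hor_comm := by simp
  chi_eq := (D.hCell_id_left _).trans (by rw [← D.cellH_vId]; exact (D.hCell_id_right _).symm)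
  psi_eq := (D.hCell_id_right _).trans (by rw [← D.cellH_vId]; exact (D.hCell_id_left _).symm)

def cellV {a b : D.Obj} (f : D.Hor a b) :
    CompCell f f (Companion.id D a) (Companion.id D b) where
  cell := D.cellV f
  hor_comm := by simp [Companion.id]
  chi_eq := by
    dsimp only [Companion.id]
    rw [← D.cellV_hComp, ← D.cellV_hComp, D.hId_comp, D.hComp_id]
  psi_eq := by
    dsimp only [Companion.id]
    rw [← D.cellV_hComp, ← D.cellV_hComp, D.hId_comp, D.hComp_id]

def hCell {a b c d e f : D.Obj} {t : D.Hor a b} {s : D.Hor c d} {l : Companion D a c}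
    {m : Companion D b d} {t' : D.Hor b e} {s' : D.Hor d f} {r : Companion D e f}
    (x : CompCell t s l m) (y : CompCell t' s' m r) :
    CompCell (D.hComp t t') (D.hComp s s') l r where
  cell := D.hCell x.cell y.cell
  hor_comm := by rw [D.hAssoc, y.hor_comm, ← D.hAssoc, x.hor_comm, D.hAssoc]
  chi_eq := by
    refine (D.hCell_assoc _ _ _).trans ?_
    refine (hCell_congr rfl rfl rfl rfl y.hor_comm (by simp) rfl HEq.rfl y.chi_eq).trans ?_
    refine (D.hCell_assoc _ _ _).symm.trans ?_
    refine (hCell_congr x.hor_comm (by simp) rfl rfl rfl rfl rfl x.chi_eq HEq.rfl).trans ?_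
    rw [D.cellV_hComp]
    exact D.hCell_assoc _ _ _
  psi_eq := by
    refine (D.hCell_assoc _ _ _).symm.trans ?_
    refine (hCell_congr (by simp) x.hor_comm.symm rfl rfl rfl rfl rfl x.psi_eq HEq.rfl).trans ?_
    refine (D.hCell_assoc _ _ _).trans ?_
    refine (hCell_congr rfl rfl rfl rfl (by simp) y.hor_comm.symm rfl HEq.rfl y.psi_eq).trans ?_
    rw [D.cellV_hComp]
    exact (D.hCell_assoc _ _ _).symm

def vCell {a b c d e f : D.Obj} {t : D.Hor a b} {m : D.Hor c d} {s : D.Hor e f}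
    {l : Companion D a c} {r : Companion D b d} {l' : Companion D c e} {r' : Companion D d f}
    (x : CompCell t m l r) (y : CompCell m s l' r') :
    CompCell t s (l.comp l') (r.comp r') where
  cell := D.vCell x.cell y.cell
  hor_comm := by
    change D.hComp t (D.hComp r.hor r'.hor) = D.hComp (D.hComp l.hor l'.hor) s
    rw [← D.hAssoc, x.hor_comm, D.hAssoc, y.hor_comm, D.hAssoc]
  chi_eq := by
    have e₁ : HEq (D.hCell (D.vCell x.cell y.cell) (r.comp r').chi)
        (D.vCell (D.hCell x.cell (D.hCell r.chi (D.cellV r'.hor)))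
          (D.hCell y.cell (D.hCell (D.cellH r'.ver) r'.chi))) := by
      rw [D.interchange]
      exact hCell_congr rfl rfl rfl rfl rfl (by simp) (by simp) HEq.rfl (Companion.comp_chi _ _)
    have e₂ : HEq (D.hCell (l.comp l').chi (D.cellV s))
        (D.vCell (D.hCell (D.hCell l.chi (D.cellV l'.hor)) (D.cellV s))
          (D.hCell (D.hCell (D.cellH l'.ver) l'.chi) (D.cellV s))) := by
      rw [D.interchange]
      exact hCell_congr rfl (by simp) rfl (by simp) rfl rfl (by simp) (Companion.comp_chi _ _)
        (D.vCell_id_left _).symm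
    refine e₁.trans (HEq.trans ?_ e₂.symm)
    refine vCell_congr ?_ ?_ ?_ rfl rfl rfl rfl ?_ ?_
    · rw [← D.hAssoc, x.hor_comm, D.hAssoc, y.hor_comm, D.hAssoc]
    · simp [y.hor_comm]
    · simp
    · refine (D.hCell_assoc _ _ _).symm.trans ?_
      refine (hCell_congr x.hor_comm (by simp) rfl rfl rfl rfl rfl x.chi_eq HEq.rfl).trans ?_
      refine (D.hCell_assoc _ _ _).trans (HEq.trans ?_ (D.hCell_assoc _ _ _).symm)
      rw [← D.cellV_hComp, ← D.cellV_hComp, y.hor_comm]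
    · refine (hCell_congr rfl rfl rfl rfl (by simp) (by simp) rfl HEq.rfl
        (D.hCell_id_left _)).trans ?_
      refine y.chi_eq.trans ?_
      exact (hCell_congr (by simp) (by simp) rfl rfl rfl rfl rfl (D.hCell_id_left _).symm HEq.rfl)
  psi_eq := by
    have e₁ : HEq (D.hCell (l.comp l').psi (D.vCell x.cell y.cell))
        (D.vCell (D.hCell (D.hCell l.psi (D.cellH l.ver)) x.cell)
          (D.hCell (D.hCell (D.cellV l.hor) l'.psi) y.cell)) := by
      rw [D.interchange]
      exact hCell_congr (by simp) rfl (by simp) rfl rfl rfl rfl (Companion.comp_psi _ _) HEq.rfl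
    have e₂ : HEq (D.hCell (D.cellV t) (r.comp r').psi)
        (D.vCell (D.hCell (D.cellV t) (D.hCell r.psi (D.cellH r.ver)))
          (D.hCell (D.cellV t) (D.hCell (D.cellV r.hor) r'.psi))) := by
      rw [D.interchange]
      exact hCell_congr rfl rfl (by simp) (by simp) (by simp) rfl rfl (D.vCell_id_left _).symm
        (Companion.comp_psi _ _)
    refine e₁.trans (HEq.trans ?_ e₂.symm)
    refine vCell_congr ?_ ?_ ?_ rfl rfl rfl rfl ?_ ?_
    · simp
    · simp [x.hor_comm]
    · rw [← D.hAssoc t, x.hor_comm, D.hAssoc, D.hAssoc, y.hor_comm]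
    · refine (hCell_congr (by simp) (by simp) rfl rfl rfl rfl rfl (D.hCell_id_right _)
        HEq.rfl).trans ?_
      refine x.psi_eq.trans ?_
      exact hCell_congr rfl rfl rfl rfl (by simp) (by simp) rfl HEq.rfl (D.hCell_id_right _).symm
    · refine (D.hCell_assoc _ _ _).trans ?_
      refine (hCell_congr rfl rfl rfl rfl (by simp) y.hor_comm.symm rfl HEq.rfl y.psi_eq).trans ?_
      refine (D.hCell_assoc _ _ _).symm.trans (HEq.trans ?_ (D.hCell_assoc _ _ _))
      rw [← D.cellV_hComp, ← D.cellV_hComp, x.hor_comm]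

end CompCell

/-- The double category of companions in `D`: it has the objects and horizontal arrows of `D`,
companion pairs as vertical arrows, and cells compatible with the binding cells. -/
def Comp (D : DblCat.{u, v₁, v₂, v₃}) : DblCat where
  Obj := D.Obj
  Hor := D.Hor
  Ver := Companion D
  Cell t s l r := CompCell t s l r
  hId := D.hId
  hComp := D.hComp
  hId_comp := D.hId_comp
  hComp_id := D.hComp_id
  hAssoc := D.hAssoc
  vId := Companion.id D
  vComp := Companion.comp
  vId_comp := Companion.id_comp
  vComp_id := Companion.comp_id
  vAssoc := Companion.assoc
  cellH := CompCell.cellH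
  cellV := CompCell.cellV
  hCell := CompCell.hCell
  vCell := CompCell.vCell
  hCell_id_left _ := CompCell.heq_of_heq (by simp) (by simp) rfl rfl (D.hCell_id_left _)
  hCell_id_right _ := CompCell.heq_of_heq (by simp) (by simp) rfl rfl (D.hCell_id_right _)
  hCell_assoc _ _ _ := CompCell.heq_of_heq (by simp) (by simp) rfl rfl (D.hCell_assoc _ _ _)
  vCell_id_left _ := CompCell.heq_of_heq rfl rfl (Companion.id_comp _) (Companion.id_comp _)
    (D.vCell_id_left _)
  vCell_id_right _ := CompCell.heq_of_heq rfl rfl (Companion.comp_id _) (Companion.comp_id _)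
    (D.vCell_id_right _)
  vCell_assoc _ _ _ := CompCell.heq_of_heq rfl rfl (Companion.assoc _ _ _)
    (Companion.assoc _ _ _) (D.vCell_assoc _ _ _)
  interchange _ _ _ _ := CompCell.ext' (D.interchange _ _ _ _)
  cellH_vId _ := CompCell.ext' (D.cellH_vId _)
  cellH_vComp _ _ := CompCell.ext' (D.cellH_vComp _ _)
  cellV_hComp _ _ := CompCell.ext' (D.cellV_hComp _ _)

/-- The functor `h_-` from companion pairs to horizontal arrows: the identity on objects, sending
a companion pair to its horizontal component. -/
def companionHor (D : DblCat.{u, v₁, v₂, v₃}) : (Comp D).VerCat ⥤ D.HorCat where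
  obj a := a
  map x := Companion.hor x
  map_id _ := rfl
  map_comp _ _ := rfl

/-- The companion pair obtained by applying a strict functor to a companion pair. -/
def Companion.map {X : DblCat.{u, v₁, v₂, v₃}} {Y : DblCat.{u', v₁', v₂', v₃'}}
    (F : DblFunctor X Y) {a b : X.Obj} (x : Companion X a b) :
    Companion Y (F.obj a) (F.obj b) where
  hor := F.hor x.hor
  ver := F.ver x.ver
  psi := castCell (F.hor_id _) rfl (F.ver_id _) rfl (F.cell x.psi)
  chi := castCell rfl (F.hor_id _) rfl (F.ver_id _) (F.cell x.chi)
  hor_eq := by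
    refine (hCell_congr (F.hor_id _).symm rfl (F.ver_id _).symm rfl rfl (F.hor_id _).symm
      (F.ver_id _).symm (castCell_heq _ _ _ _ _) (castCell_heq _ _ _ _ _)).trans ?_
    refine (F.cell_hCell _ _).symm.trans ?_
    exact (F.cell_congr (by simp) (by simp) rfl rfl x.hor_eq).trans (F.cell_cellV _)
  ver_eq := by
    refine (vCell_congr (F.hor_id _).symm rfl (F.hor_id _).symm (F.ver_id _).symm rfl rfl
      (F.ver_id _).symm (castCell_heq _ _ _ _ _) (castCell_heq _ _ _ _ _)).trans ?_
    refine (F.cell_vCell _ _).symm.trans ?_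
    exact (F.cell_congr rfl rfl (by simp) (by simp) x.ver_eq).trans (F.cell_cellH _)

section CompMap

variable {X : DblCat.{u, v₁, v₂, v₃}} {Y : DblCat.{u', v₁', v₂', v₃'}}

theorem Companion.map_id (F : DblFunctor X Y) (a : X.Obj) :
    Companion.map F (Companion.id X a) = Companion.id Y (F.obj a) :=
  Companion.ext_of_heq (F.hor_id _) (F.ver_id _)
    ((castCell_heq (F.hor_id _) rfl (F.ver_id _) rfl _).trans
      ((F.cell_cellV _).trans (by dsimp only [Companion.id]; rw [F.hor_id])))
    ((castCell_heq rfl (F.hor_id _) rfl (F.ver_id _) _).trans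
      ((F.cell_cellV _).trans (by dsimp only [Companion.id]; rw [F.hor_id])))

theorem Companion.map_comp (F : DblFunctor X Y) {a b c : X.Obj} (x : Companion X a b)
    (y : Companion X b c) :
    Companion.map F (Companion.comp x y) = (Companion.map F x).comp (Companion.map F y) := by
  refine Companion.ext_of_heq (F.hor_comp _ _) (F.ver_comp _ _) ?_ ?_
  · refine (castCell_heq (F.hor_id _) rfl (F.ver_id _) rfl _).trans ?_
    refine (F.cell_congr (by simp) rfl (by simp) rfl (Companion.comp_psi x y)).trans ?_
    refine HEq.trans ?_ (Companion.comp_psi _ _).symm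
    refine (F.cell_vCell _ _).trans ?_
    refine vCell_congr (by simp) (by simp [Companion.map])
      (by simp [Companion.map, Companion.comp]) (by simp) rfl (by simp) rfl ?_ ?_
    · refine (F.cell_hCell _ _).trans ?_
      exact hCell_congr (F.hor_id _) rfl (F.ver_id _) rfl (F.hor_id _) (F.hor_id _) rfl
        (castCell_heq (F.hor_id _) rfl (F.ver_id _) rfl _).symm (F.cell_cellH _)
    · refine (F.cell_hCell _ _).trans ?_
      exact hCell_congr rfl rfl (F.ver_id _) (F.ver_id _) (F.hor_id _) rfl rfl
        (F.cell_cellV _) (castCell_heq (F.hor_id _) rfl (F.ver_id _) rfl _).symm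
  · refine (castCell_heq rfl (F.hor_id _) rfl (F.ver_id _) _).trans ?_
    refine (F.cell_congr rfl (by simp) rfl (by simp) (Companion.comp_chi x y)).trans ?_
    refine HEq.trans ?_ (Companion.comp_chi _ _).symm
    refine (F.cell_vCell _ _).trans ?_
    refine vCell_congr (by simp [Companion.map, Companion.comp]) (by simp [Companion.map])
      (by simp) rfl (by simp) rfl (by simp) ?_ ?_
    · refine (F.cell_hCell _ _).trans ?_
      exact hCell_congr rfl (F.hor_id _) rfl (F.ver_id _) rfl rfl (F.ver_id _)
        (castCell_heq rfl (F.hor_id _) rfl (F.ver_id _) _).symm (F.cell_cellV _)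
    · refine (F.cell_hCell _ _).trans ?_
      exact hCell_congr (F.hor_id _) (F.hor_id _) rfl rfl rfl (F.hor_id _) (F.ver_id _)
        (F.cell_cellH _) (castCell_heq rfl (F.hor_id _) rfl (F.ver_id _) _).symm

/-- The cell of companions obtained by applying a strict functor. -/
def CompCell.map (F : DblFunctor X Y) {a b c d : X.Obj} {t : X.Hor a b} {s : X.Hor c d}
    {l : Companion X a c} {r : Companion X b d} (x : CompCell t s l r) :
    CompCell (F.hor t) (F.hor s) (l.map F) (r.map F) where
  cell := F.cell (x.cell)
  hor_comm := by
    change Y.hComp (F.hor t) (F.hor (r.hor)) =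
      Y.hComp (F.hor (l.hor)) (F.hor s)
    rw [← F.hor_comp, ← F.hor_comp, x.hor_comm]
  chi_eq := by
    refine (hCell_congr rfl rfl rfl rfl rfl (F.hor_id _).symm (F.ver_id _).symm HEq.rfl
      (castCell_heq rfl (F.hor_id _) rfl (F.ver_id _) _)).trans ?_
    refine (F.cell_hCell _ _).symm.trans ?_
    refine (F.cell_congr (x.hor_comm) (by simp) rfl rfl (x.chi_eq)).trans ?_
    refine (F.cell_hCell _ _).trans ?_
    exact hCell_congr rfl (F.hor_id _) rfl (F.ver_id _) rfl rfl (F.ver_id _)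
      (castCell_heq rfl (F.hor_id _) rfl (F.ver_id _) _).symm (F.cell_cellV _)
  psi_eq := by
    refine (hCell_congr (F.hor_id _).symm rfl (F.ver_id _).symm rfl rfl rfl rfl
      (castCell_heq (F.hor_id _) rfl (F.ver_id _) rfl _) HEq.rfl).trans ?_
    refine (F.cell_hCell _ _).symm.trans ?_
    refine (F.cell_congr (by simp) (x.hor_comm).symm rfl rfl
      (x.psi_eq)).trans ?_
    refine (F.cell_hCell _ _).trans ?_
    exact hCell_congr rfl rfl (F.ver_id _) (F.ver_id _) (F.hor_id _) rfl rfl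
      (F.cell_cellV _) (castCell_heq (F.hor_id _) rfl (F.ver_id _) rfl _).symm

/-- The strict functor `Comp(F)` induced by a strict functor `F` on double categories of
companions. -/
def DblFunctor.compMap (F : DblFunctor X Y) : DblFunctor (Comp X) (Comp Y) where
  obj := F.obj
  hor := F.hor
  ver x := Companion.map F x
  cell x := CompCell.map F x
  hor_id := F.hor_id
  hor_comp := F.hor_comp
  ver_id a := Companion.map_id F a
  ver_comp x y := Companion.map_comp F x y
  cell_cellH x := CompCell.heq_of_heq (F.hor_id _) (F.hor_id _) rfl rfl (F.cell_cellH _)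
  cell_cellV f := CompCell.heq_of_heq rfl rfl (Companion.map_id F _) (Companion.map_id F _)
    (F.cell_cellV f)
  cell_hCell x y := CompCell.heq_of_heq (F.hor_comp _ _) (F.hor_comp _ _) rfl rfl
    (F.cell_hCell _ _)
  cell_vCell x y := CompCell.heq_of_heq rfl rfl (Companion.map_comp F _ _)
    (Companion.map_comp F _ _) (F.cell_vCell _ _)

/-- The horizontal transformation `Comp(α)` induced by a horizontal transformation `α`. -/
def HorTrans.compMap {F G : DblFunctor X Y} (α : HorTrans F G) : HorTrans F.compMap G.compMap where
  app a := α.app a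
  cell v :=
    { cell := α.cell (Companion.ver v)
      hor_comm := (α.hor_naturality _).symm
      chi_eq := by
        refine (hCell_congr rfl rfl rfl rfl rfl (G.hor_id _).symm (G.ver_id _).symm HEq.rfl
          (castCell_heq rfl (G.hor_id _) rfl (G.ver_id _) _)).trans ?_
        refine (α.cell_naturality _).symm.trans ?_
        exact hCell_congr rfl (F.hor_id _) rfl (F.ver_id _) rfl rfl (G.ver_id _)
          (castCell_heq rfl (F.hor_id _) rfl (F.ver_id _) _).symm (α.cell_id _)
      psi_eq := by
        refine (hCell_congr (F.hor_id _).symm rfl (F.ver_id _).symm rfl rfl rfl rfl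
          (castCell_heq (F.hor_id _) rfl (F.ver_id _) rfl _) HEq.rfl).trans ?_
        refine (α.cell_naturality _).trans ?_
        exact hCell_congr rfl rfl (F.ver_id _) (G.ver_id _) (G.hor_id _) rfl rfl
          (α.cell_id _) (castCell_heq (G.hor_id _) rfl (G.ver_id _) rfl _).symm }
  cell_id a := CompCell.heq_of_heq rfl rfl (F.compMap.ver_id a) (G.compMap.ver_id a)
    (α.cell_id a)
  cell_comp v w := CompCell.heq_of_heq rfl rfl (F.compMap.ver_comp v w) (G.compMap.ver_comp v w)
    (α.cell_comp _ _)
  hor_naturality f := α.hor_naturality f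
  cell_naturality x := CompCell.heq_of_heq (α.hor_naturality _) (α.hor_naturality _) rfl rfl
    (α.cell_naturality _)

end CompMap

/-! ### The double categories `HC` and `VC` -/

section HV

variable (C : Type uC) [Category.{vC} C]

/-- The double category `HC`: the horizontal arrows are the arrows of `C`, the vertical arrows are
identities and the cells are vertical identity cells. -/
def horDbl : DblCat.{uC, vC, 0, 0} where
  Obj := C
  Hor a b := a ⟶ b
  Ver a b := PLift (a = b)
  Cell t s l r := PLift (t ≫ eqToHom r.down = eqToHom l.down ≫ s)
  hId a := 𝟙 a
  hComp f g := f ≫ g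
  hId_comp := Category.id_comp
  hComp_id := Category.comp_id
  hAssoc := Category.assoc
  vId _ := ⟨rfl⟩
  vComp f g := ⟨f.down.trans g.down⟩
  vId_comp _ := rfl
  vComp_id _ := rfl
  vAssoc _ _ _ := rfl
  cellH _ := ⟨by simp⟩
  cellV _ := ⟨by simp⟩
  hCell x y := ⟨by rw [Category.assoc, y.down, ← Category.assoc, x.down, Category.assoc]⟩
  vCell {_ _ _ _ _ _ t m s l r l' r'} x y := ⟨by
    rw [← eqToHom_trans r.down r'.down, ← Category.assoc, x.down, Category.assoc, y.down,
      ← Category.assoc, eqToHom_trans]⟩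
  hCell_id_left _ := Subsingleton.helim (by simp) _ _
  hCell_id_right _ := Subsingleton.helim (by simp) _ _
  hCell_assoc _ _ _ := Subsingleton.helim (by simp) _ _
  vCell_id_left _ := Subsingleton.helim rfl _ _
  vCell_id_right _ := Subsingleton.helim rfl _ _
  vCell_assoc _ _ _ := Subsingleton.helim rfl _ _
  interchange _ _ _ _ := rfl
  cellH_vId _ := rfl
  cellH_vComp _ _ := rfl
  cellV_hComp _ _ := rfl

/-- The double category `VC`: the vertical arrows are the arrows of `C`, the horizontal arrows are
identities and the cells are horizontal identity cells. -/
def verDbl : DblCat.{uC, 0, vC, 0} where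
  Obj := C
  Hor a b := PLift (a = b)
  Ver a b := a ⟶ b
  Cell t s l r := PLift (l ≫ eqToHom s.down = eqToHom t.down ≫ r)
  hId _ := ⟨rfl⟩
  hComp f g := ⟨f.down.trans g.down⟩
  hId_comp _ := rfl
  hComp_id _ := rfl
  hAssoc _ _ _ := rfl
  vId a := 𝟙 a
  vComp f g := f ≫ g
  vId_comp := Category.id_comp
  vComp_id := Category.comp_id
  vAssoc := Category.assoc
  cellH _ := ⟨by simp⟩
  cellV _ := ⟨by simp⟩
  hCell {_ _ _ _ _ _ t s l m t' s' r} x y := ⟨by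
    rw [← eqToHom_trans s.down s'.down, ← Category.assoc, x.down, Category.assoc, y.down,
      ← Category.assoc, eqToHom_trans]⟩
  vCell x y := ⟨by rw [Category.assoc, y.down, ← Category.assoc, x.down, Category.assoc]⟩
  hCell_id_left _ := Subsingleton.helim rfl _ _
  hCell_id_right _ := Subsingleton.helim rfl _ _
  hCell_assoc _ _ _ := Subsingleton.helim rfl _ _
  vCell_id_left _ := Subsingleton.helim (by simp) _ _
  vCell_id_right _ := Subsingleton.helim (by simp) _ _
  vCell_assoc _ _ _ := Subsingleton.helim (by simp) _ _
  interchange _ _ _ _ := rfl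
  cellH_vId _ := rfl
  cellH_vComp _ _ := rfl
  cellV_hComp _ _ := rfl

variable {C} {D : DblCat.{u, v₁, v₂, v₃}}

/-- The functor `hG : C ⥤ hD` underlying a strict functor `G : HC → D`. -/
def horDbl.functor (G : DblFunctor (horDbl C) D) : C ⥤ D.HorCat where
  obj a := G.obj a
  map f := G.hor f
  map_id a := G.hor_id a
  map_comp f g := G.hor_comp f g

/-- The functor `vG : C ⥤ vD` underlying a strict functor `G : VC → D`. -/
def verDbl.functor (G : DblFunctor (verDbl C) D) : C ⥤ D.VerCat where
  obj a := G.obj a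
  map f := G.ver f
  map_id a := G.ver_id a
  map_comp f g := G.ver_comp f g

end HV

/-! ### The double category of fractions -/

section Fractions

variable {C : Type uC} [Category.{vC} C]

/-- The arrows in `W`. They are the objects of both `∇W` and `C{W}`. -/
structure WArrow (W : MorphismProperty C) where
  dom : C
  cod : C
  hom : dom ⟶ cod
  mem : W hom

/-- A diagram `(u₁, C, u₂)` representing a vertical arrow of `C{W}`; the arrow `eqToHom cod_eq` only
records that the codomains of the two arrows in `W` are equal. -/
structure VSpan {W : MorphismProperty C} (X Y : WArrow W) where
  cod_eq : X.cod = Y.cod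
  apex : C
  fst : apex ⟶ X.dom
  snd : apex ⟶ Y.dom
  comm : (fst ≫ X.hom) ≫ eqToHom cod_eq = snd ≫ Y.hom
  mem : W (fst ≫ X.hom)

namespace VSpan

variable {W : MorphismProperty C}

/-- Two diagrams are related if they agree after restriction along some `r`, `s`. -/
def Rel {X Y : WArrow W} (p q : VSpan X Y) : Prop :=
  ∃ (E : C) (r : E ⟶ p.apex) (s : E ⟶ q.apex),
    r ≫ p.fst = s ≫ q.fst ∧ r ≫ p.snd = s ≫ q.snd ∧ W (r ≫ p.fst ≫ X.hom)

/-- `p'` is the diagram `(u₁ e, D, u₂ e)` obtained by restricting `p = (u₁, C, u₂)` along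
`e : D ⟶ C` (that `w₁ u₁ e` is in `W` is part of `p'` being a diagram). -/
def IsRestriction {X Y : WArrow W} {p' p : VSpan X Y} (e : p'.apex ⟶ p.apex) : Prop :=
  p'.fst = e ≫ p.fst ∧ p'.snd = e ≫ p.snd

theorem mem_snd {X Y : WArrow W} (p : VSpan X Y) : W (p.snd ≫ Y.hom) := by
  obtain ⟨A, B, w, hw⟩ := X
  obtain ⟨A', B', w', hw'⟩ := Y
  obtain ⟨h, E, f, s, c, m⟩ := p
  dsimp only at h
  subst h
  simp only [eqToHom_refl, Category.comp_id] at c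
  exact c ▸ m

/-- The identity diagram. -/
def id (X : WArrow W) : VSpan X X where
  cod_eq := rfl
  apex := X.dom
  fst := 𝟙 _
  snd := 𝟙 _
  comm := by simp
  mem := by simpa using X.mem

end VSpan

/-- Vertical arrows of `C{W}`. -/
def VArrow {W : MorphismProperty C} (X Y : WArrow W) := Quot (VSpan.Rel (X := X) (Y := Y))

/-- The vertical arrow represented by a diagram. -/
def VSpan.toArrow {W : MorphismProperty C} {X Y : WArrow W} (p : VSpan X Y) : VArrow X Y :=
  Quot.mk _ p

/-- The vertical identity arrow. -/
def VArrow.id {W : MorphismProperty C} (X : WArrow W) : VArrow X X := (VSpan.id X).toArrow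

/-- The diagrams representing a given vertical arrow. -/
abbrev VArrow.Rep {W : MorphismProperty C} {X Y : WArrow W} (l : VArrow X Y) :=
  {p : VSpan X Y // p.toArrow = l}

/-- A family of arrows defining a double cell of `C{W}`. For every pair of representatives of the
two vertical arrows it comprises a (possibly empty) set of arrows filling the diagram. -/
structure CellFamily {W : MorphismProperty C} {X X' Y Y' : WArrow W} (f : X.dom ⟶ X'.dom)
    (g : Y.dom ⟶ Y'.dom) (l : VArrow X Y) (r : VArrow X' Y') where
  arrows : ∀ (p : l.Rep) (q : r.Rep), Set (p.1.apex ⟶ q.1.apex)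
  comm_fst : ∀ {p : l.Rep} {q : r.Rep} {φ : p.1.apex ⟶ q.1.apex}, φ ∈ arrows p q →
    φ ≫ q.1.fst = p.1.fst ≫ f
  comm_snd : ∀ {p : l.Rep} {q : r.Rep} {φ : p.1.apex ⟶ q.1.apex}, φ ∈ arrows p q →
    φ ≫ q.1.snd = p.1.snd ≫ g
  exists_restriction : ∀ (p : l.Rep) (q : r.Rep), ∃ (p' : l.Rep) (e : p'.1.apex ⟶ p.1.apex),
    VSpan.IsRestriction e ∧ (arrows p' q).Nonempty
  restriction_mem : ∀ {p p' : l.Rep} {q : r.Rep} {φ : p.1.apex ⟶ q.1.apex}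
    (e : p'.1.apex ⟶ p.1.apex), VSpan.IsRestriction e → φ ∈ arrows p q → e ≫ φ ∈ arrows p' q

/-- Two families represent the same double cell if, for every pair of representatives of the
vertical arrows, they share an arrow after restriction. -/
def CellFamily.Rel {W : MorphismProperty C} {X X' Y Y' : WArrow W} {f : X.dom ⟶ X'.dom}
    {g : Y.dom ⟶ Y'.dom} {l : VArrow X Y} {r : VArrow X' Y'} (F G : CellFamily f g l r) : Prop :=
  ∀ (p : l.Rep) (q : r.Rep), ∃ (p' : l.Rep) (e : p'.1.apex ⟶ p.1.apex), VSpan.IsRestriction e ∧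
    ∃ φ, φ ∈ F.arrows p' q ∧ φ ∈ G.arrows p' q

/-- Double cells of `C{W}`. -/
def WCell {W : MorphismProperty C} {X X' Y Y' : WArrow W} (f : X.dom ⟶ X'.dom)
    (g : Y.dom ⟶ Y'.dom) (l : VArrow X Y) (r : VArrow X' Y') :=
  Quot (CellFamily.Rel (f := f) (g := g) (l := l) (r := r))

variable {W : MorphismProperty C} [W.HasRightCalculusOfFractions]

/-- Condition CF2. -/
theorem exists_square {A B D : C} (f : A ⟶ B) (w : D ⟶ B) (hw : W w) :
    ∃ (E : C) (s : E ⟶ A) (t : E ⟶ D), W s ∧ s ≫ f = t ≫ w := by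
  obtain ⟨ψ, h⟩ := MorphismProperty.HasRightCalculusOfFractions.exists_rightFraction
    (W := W) ⟨f, w, hw⟩
  exact ⟨_, ψ.s, ψ.f, ψ.hs, h⟩

/-- Condition CF3. -/
theorem exists_equalize {A B D : C} (f g : A ⟶ B) (w : B ⟶ D) (hw : W w) (h : f ≫ w = g ≫ w) :
    ∃ (E : C) (s : E ⟶ A), W s ∧ s ≫ f = s ≫ g := by
  obtain ⟨E, s, hs, h'⟩ := MorphismProperty.HasRightCalculusOfFractions.ext f g w hw h
  exact ⟨E, s, hs, h'⟩

/-- Condition CF2 followed by CF3. -/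
theorem exists_square_of_comp {A B B' D : C} (f : A ⟶ B) (w : D ⟶ B) (v : B ⟶ B') (hv : W v)
    (hw : W (w ≫ v)) : ∃ (E : C) (s : E ⟶ A) (t : E ⟶ D), W s ∧ s ≫ f = t ≫ w := by
  obtain ⟨E, s, t, hs, e⟩ := exists_square (W := W) (f ≫ v) (w ≫ v) hw
  obtain ⟨E', k, hk, e'⟩ := exists_equalize (W := W) (s ≫ f) (t ≫ w) v hv (by simpa using e)
  exact ⟨E', k ≫ s, k ≫ t, W.comp_mem _ _ hk hs, by simpa using e'⟩

namespace VSpan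

/-- Any two parallel diagrams are related. -/
theorem rel {X Y : WArrow W} (p q : VSpan X Y) : Rel p q := by
  obtain ⟨E, s, t, hs, e⟩ := exists_square_of_comp p.fst q.fst X.hom X.mem q.mem
  have e' : (s ≫ p.snd) ≫ Y.hom = (t ≫ q.snd) ≫ Y.hom := by
    rw [Category.assoc, Category.assoc, ← p.comm, ← q.comm]
    simp only [← Category.assoc, e]
  obtain ⟨E', k, hk, h⟩ := exists_equalize _ _ _ Y.mem e'
  refine ⟨E', k ≫ s, k ≫ t, by simp [e], by simpa using h, ?_⟩
  exact W.comp_mem _ _ (W.comp_mem _ _ hk hs) p.mem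

theorem exists_of_cod_eq (X Y : WArrow W) (h : X.cod = Y.cod) : Nonempty (VSpan X Y) := by
  obtain ⟨A, B, w, hw⟩ := X
  obtain ⟨A', B', w', hw'⟩ := Y
  dsimp only at h
  subst h
  obtain ⟨E, s, t, hs, e⟩ := exists_square w w' hw'
  exact ⟨⟨rfl, E, s, t, by simpa using e, W.comp_mem _ _ hs hw⟩⟩

theorem exists_comp {X Y Z : WArrow W} (p : VSpan X Y) (q : VSpan Y Z) :
    ∃ (E : C) (s : E ⟶ p.apex) (t : E ⟶ q.apex), W s ∧ s ≫ p.snd = t ≫ q.fst :=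
  exists_square_of_comp p.snd q.fst Y.hom Y.mem q.mem

/-- Composition of diagrams along a chosen square given by CF2 (and CF3). -/
noncomputable def comp {X Y Z : WArrow W} (p : VSpan X Y) (q : VSpan Y Z) : VSpan X Z where
  cod_eq := p.cod_eq.trans q.cod_eq
  apex := (exists_comp p q).choose
  fst := (exists_comp p q).choose_spec.choose ≫ p.fst
  snd := (exists_comp p q).choose_spec.choose_spec.choose ≫ q.snd
  comm := by
    have h := (exists_comp p q).choose_spec.choose_spec.choose_spec.2
    have c := p.comm
    have c' := q.comm
    simp only [Category.assoc] at c c' ⊢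
    rw [← c', ← reassoc_of% h, ← reassoc_of% c, eqToHom_trans]
  mem := by
    rw [Category.assoc]
    exact W.comp_mem _ _ (exists_comp p q).choose_spec.choose_spec.choose_spec.1 p.mem

end VSpan

instance VArrow.instSubsingleton {X Y : WArrow W} : Subsingleton (VArrow X Y) :=
  ⟨fun a b => by
    obtain ⟨p, rfl⟩ := Quot.exists_rep a
    obtain ⟨q, rfl⟩ := Quot.exists_rep b
    exact Quot.sound (VSpan.rel p q)⟩

/-- The diagram `p`, viewed as a representative of a vertical arrow. -/
def VArrow.rep {X Y : WArrow W} (l : VArrow X Y) (p : VSpan X Y) : l.Rep :=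
  ⟨p, Subsingleton.elim (α := VArrow X Y) _ _⟩

/-- Composition of vertical arrows. -/
noncomputable def VArrow.comp {X Y Z : WArrow W} (l : VArrow X Y) (m : VArrow Y Z) : VArrow X Z :=
  Quot.lift (fun p => Quot.lift (fun q => (p.comp q).toArrow)
    (fun _ _ _ => Subsingleton.elim _ _) m) (fun _ _ _ => Subsingleton.elim _ _) l

namespace WCell

variable {X X' Y Y' : WArrow W} {f : X.dom ⟶ X'.dom} {g : Y.dom ⟶ Y'.dom} {l : VArrow X Y}
  {r : VArrow X' Y'}

instance instSubsingleton : Subsingleton (WCell f g l r) := ⟨fun a b => by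
  obtain ⟨F, rfl⟩ := Quot.exists_rep a
  obtain ⟨G, rfl⟩ := Quot.exists_rep b
  refine Quot.sound fun p q => ?_
  obtain ⟨p₁, e₁, h₁, φ, hφ⟩ := F.exists_restriction p q
  obtain ⟨p₂, e₂, h₂, ψ, hψ⟩ := G.exists_restriction p q
  -- a common refinement of `e₁` and `e₂`
  obtain ⟨E, s, t, hs, e⟩ := exists_square (W := W) (p₁.1.fst ≫ X.hom) (p₂.1.fst ≫ X.hom) p₂.1.mem
  obtain ⟨E₁, k, hk, e'⟩ := exists_equalize (W := W) (s ≫ e₁) (t ≫ e₂) (p.1.fst ≫ X.hom) p.1.mem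
    (by simpa [h₁.1, h₂.1] using e)
  obtain ⟨E₂, j, hj, e''⟩ := exists_equalize (W := W) (k ≫ s ≫ φ) (k ≫ t ≫ ψ)
    (q.1.fst ≫ X'.hom) q.1.mem (by
      have a₁ := F.comm_fst hφ
      have a₂ := G.comm_fst hψ
      rw [h₁.1] at a₁
      rw [h₂.1] at a₂
      simp only [Category.assoc] at e' ⊢
      rw [reassoc_of% a₁, reassoc_of% a₂, reassoc_of% e'])
  let p₃ : VSpan X Y :=
    { cod_eq := p.1.cod_eq
      apex := E₂
      fst := j ≫ k ≫ s ≫ p₁.1.fst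
      snd := j ≫ k ≫ s ≫ p₁.1.snd
      comm := by
        have := p₁.1.comm
        simp only [Category.assoc] at this ⊢
        rw [this]
      mem := by
        have := W.comp_mem _ _ hj (W.comp_mem _ _ hk (W.comp_mem _ _ hs p₁.1.mem))
        simpa using this }
  refine ⟨l.rep p₃, j ≫ k ≫ s ≫ e₁, ⟨?_, ?_⟩, j ≫ k ≫ s ≫ φ, ?_, ?_⟩
  · simp [VArrow.rep, p₃, h₁.1]
  · simp [VArrow.rep, p₃, h₁.2]
  · have := F.restriction_mem (p := p₁) (p' := l.rep p₃) (j ≫ k ≫ s)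
      ⟨by simp [VArrow.rep, p₃], by simp [VArrow.rep, p₃]⟩ hφ
    have e : j ≫ k ≫ s ≫ φ = (j ≫ k ≫ s) ≫ φ := by simp only [Category.assoc]
    exact (congrArg (fun z => z ∈ F.arrows (l.rep p₃) q) e).mpr this
  · have := G.restriction_mem (p := p₂) (p' := l.rep p₃) (j ≫ k ≫ t)
      ⟨by simp [VArrow.rep, p₃, h₁.1, h₂.1, reassoc_of% e'],
        by simp [VArrow.rep, p₃, h₁.2, h₂.2, reassoc_of% e']⟩ hψ
    have e : j ≫ k ≫ s ≫ φ = (j ≫ k ≫ t) ≫ ψ := by simp only [Category.assoc, e'']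
    exact (congrArg (fun z => z ∈ G.arrows (l.rep p₃) q) e).mpr this⟩

/-- Every commutative diagram extends to a double cell. -/
theorem exists_of_arrow (p : VSpan X Y) (q : VSpan X' Y') (φ : p.apex ⟶ q.apex)
    (h₁ : φ ≫ q.fst = p.fst ≫ f) (h₂ : φ ≫ q.snd = p.snd ≫ g) : Nonempty (WCell f g l r) :=
  ⟨Quot.mk _
    { arrows := fun p q => {φ | φ ≫ q.1.fst = p.1.fst ≫ f ∧ φ ≫ q.1.snd = p.1.snd ≫ g}
      comm_fst := fun h => h.1
      comm_snd := fun h => h.2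
      exists_restriction := fun p' q' => by
        obtain ⟨E, a, b, h₃, h₄, h₅⟩ := VSpan.rel p p'.1
        obtain ⟨F, c, d, h₆, h₇, h₈⟩ := VSpan.rel q q'.1
        -- lift `a ≫ φ` through `c` after restriction
        obtain ⟨G, s, t, hs, e⟩ := exists_square_of_comp (W := W) (a ≫ φ) c (q.fst ≫ X'.hom)
          q.mem h₈
        let p₃ : VSpan X Y :=
          { cod_eq := p.cod_eq
            apex := G
            fst := s ≫ a ≫ p.fst
            snd := s ≫ a ≫ p.snd
            comm := by
              have := p.comm
              simp only [Category.assoc] at this ⊢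
              rw [this]
            mem := by simpa using W.comp_mem _ _ hs h₅ }
        refine ⟨l.rep p₃, s ≫ b, ⟨?_, ?_⟩, t ≫ d, ?_, ?_⟩
        · simp [VArrow.rep, p₃, h₃]
        · simp [VArrow.rep, p₃, h₄]
        · change (t ≫ d) ≫ q'.1.fst = (s ≫ a ≫ p.fst) ≫ f
          simp only [Category.assoc] at e ⊢
          rw [← h₆, ← reassoc_of% e, h₁]
        · change (t ≫ d) ≫ q'.1.snd = (s ≫ a ≫ p.snd) ≫ g
          simp only [Category.assoc] at e ⊢
          rw [← h₇, ← reassoc_of% e, h₂]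
      restriction_mem := fun e he h => ⟨by rw [Category.assoc, h.1, he.1, Category.assoc],
        by rw [Category.assoc, h.2, he.2, Category.assoc]⟩ }⟩

/-- A double cell has a component at every pair of diagrams, after restriction of the first. -/
theorem exists_arrow (x : WCell f g l r) (p : VSpan X Y) (q : VSpan X' Y') :
    ∃ (p' : VSpan X Y) (e : p'.apex ⟶ p.apex) (φ : p'.apex ⟶ q.apex), VSpan.IsRestriction e ∧
      φ ≫ q.fst = p'.fst ≫ f ∧ φ ≫ q.snd = p'.snd ≫ g := by
  obtain ⟨F, rfl⟩ := Quot.exists_rep x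
  obtain ⟨p', e, he, φ, hφ⟩ := F.exists_restriction (l.rep p) (r.rep q)
  exact ⟨p'.1, e, φ, he, F.comm_fst hφ, F.comm_snd hφ⟩

theorem exists_cellH (v : VArrow X Y) : Nonempty (WCell (𝟙 X.dom) (𝟙 Y.dom) v v) := by
  obtain ⟨p, rfl⟩ := Quot.exists_rep v
  exact exists_of_arrow p p (𝟙 _) (by simp) (by simp)

theorem exists_cellV (f : X.dom ⟶ Y.dom) :
    Nonempty (WCell f f (VArrow.id X) (VArrow.id Y)) :=
  exists_of_arrow (VSpan.id X) (VSpan.id Y) f (by simp [VSpan.id]) (by simp [VSpan.id])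

/-- Horizontal composites of double cells are obtained by composing components. -/
theorem exists_hCell {X'' Y'' : WArrow W} {f' : X'.dom ⟶ X''.dom} {g' : Y'.dom ⟶ Y''.dom}
    {r' : VArrow X'' Y''} (x : WCell f g l r) (y : WCell f' g' r r') :
    Nonempty (WCell (f ≫ f') (g ≫ g') l r') := by
  obtain ⟨p, -⟩ := Quot.exists_rep l
  obtain ⟨q, -⟩ := Quot.exists_rep r
  obtain ⟨q', -⟩ := Quot.exists_rep r'
  obtain ⟨q₁, -, ψ, -, h₁, h₂⟩ := y.exists_arrow q q'
  obtain ⟨p₁, -, φ, -, h₃, h₄⟩ := x.exists_arrow p q₁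
  exact exists_of_arrow p₁ q' (φ ≫ ψ) (by simp [h₁, reassoc_of% h₃])
    (by simp [h₂, reassoc_of% h₄])

/-- Vertical composites of double cells are obtained by composing components. -/
theorem exists_vCell {Z Z' : WArrow W} {k : Z.dom ⟶ Z'.dom} {l' : VArrow Y Z}
    {r' : VArrow Y' Z'} (x : WCell f g l r) (y : WCell g k l' r') :
    Nonempty (WCell f k (l.comp l') (r.comp r')) := by
  obtain ⟨p, -⟩ := Quot.exists_rep l
  obtain ⟨p', -⟩ := Quot.exists_rep l'
  obtain ⟨q, -⟩ := Quot.exists_rep r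
  obtain ⟨q', -⟩ := Quot.exists_rep r'
  obtain ⟨p₁, -, φ, -, h₁, h₂⟩ := x.exists_arrow p q
  obtain ⟨p₁', -, ψ, -, h₃, h₄⟩ := y.exists_arrow p' q'
  obtain ⟨E, a, b, ha, hab⟩ := VSpan.exists_comp p₁ p₁'
  obtain ⟨E', a', b', ha', hab'⟩ := VSpan.exists_comp q q'
  obtain ⟨G, s, t, hs, e⟩ := exists_square_of_comp (W := W) (a ≫ φ) a' (q.fst ≫ X'.hom) q.mem
    (W.comp_mem _ _ ha' q.mem)
  obtain ⟨G', m, hm, e'⟩ := exists_equalize (W := W) (t ≫ b') (s ≫ b ≫ ψ) (q'.fst ≫ Y'.hom)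
    q'.mem (by
      have e₁ : (t ≫ b') ≫ q'.fst = (s ≫ b ≫ ψ) ≫ q'.fst := by
        simp only [Category.assoc] at e ⊢
        rw [← hab', ← reassoc_of% e, h₂, h₃, reassoc_of% hab]
      rw [← Category.assoc, e₁, Category.assoc])
  let P : VSpan X Z :=
    { cod_eq := p₁.cod_eq.trans p₁'.cod_eq
      apex := G'
      fst := m ≫ s ≫ a ≫ p₁.fst
      snd := m ≫ s ≫ b ≫ p₁'.snd
      comm := by
        have c := p₁.comm
        have c' := p₁'.comm
        simp only [Category.assoc] at c c' ⊢
        rw [← c', ← reassoc_of% hab, ← reassoc_of% c, eqToHom_trans]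
      mem := by
        have := W.comp_mem _ _ hm (W.comp_mem _ _ hs (W.comp_mem _ _ ha p₁.mem))
        simpa using this }
  let Q : VSpan X' Z' :=
    { cod_eq := q.cod_eq.trans q'.cod_eq
      apex := E'
      fst := a' ≫ q.fst
      snd := b' ≫ q'.snd
      comm := by
        have c := q.comm
        have c' := q'.comm
        simp only [Category.assoc] at c c' ⊢
        rw [← c', ← reassoc_of% hab', ← reassoc_of% c, eqToHom_trans]
      mem := by simpa using W.comp_mem _ _ ha' q.mem }
  refine exists_of_arrow P Q (m ≫ t) ?_ ?_
  · simp only [P, Q, Category.assoc] at e ⊢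
    rw [← reassoc_of% e, h₁]
  · simp only [P, Q, Category.assoc] at e' ⊢
    rw [reassoc_of% e', h₄]

end WCell

variable (W)

/-- The double category of fractions `C{W}`. Since there is at most one double cell with a given
boundary, the identity and composite cells are determined by their existence. -/
noncomputable def fractionsDbl :
    DblCat.{max uC vC, vC, max uC vC, max uC vC} where
  Obj := WArrow W
  Hor X Y := X.dom ⟶ Y.dom
  Ver X Y := VArrow X Y
  Cell t s l r := WCell t s l r
  hId X := 𝟙 X.dom
  hComp f g := f ≫ g
  hId_comp f := Category.id_comp f
  hComp_id f := Category.comp_id f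
  hAssoc f g k := Category.assoc f g k
  vId X := VArrow.id X
  vComp l m := l.comp m
  vId_comp _ := Subsingleton.elim _ _
  vComp_id _ := Subsingleton.elim _ _
  vAssoc _ _ _ := Subsingleton.elim _ _
  cellH v := Classical.choice (WCell.exists_cellH v)
  cellV f := Classical.choice (WCell.exists_cellV f)
  hCell x y := Classical.choice (WCell.exists_hCell x y)
  vCell x y := Classical.choice (WCell.exists_vCell x y)
  hCell_id_left _ := Subsingleton.helim (by simp) _ _
  hCell_id_right _ := Subsingleton.helim (by simp) _ _
  hCell_assoc _ _ _ := Subsingleton.helim (by simp) _ _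
  vCell_id_left _ := Subsingleton.helim (by congr 1 <;> exact Subsingleton.elim _ _) _ _
  vCell_id_right _ := Subsingleton.helim (by congr 1 <;> exact Subsingleton.elim _ _) _ _
  vCell_assoc _ _ _ := Subsingleton.helim (by congr 1 <;> exact Subsingleton.elim _ _) _ _
  interchange _ _ _ _ := Subsingleton.elim _ _
  cellH_vId _ := Subsingleton.elim _ _
  cellH_vComp _ _ := Subsingleton.elim _ _
  cellV_hComp _ _ := Subsingleton.elim _ _

end Fractions

/-! ### `W`-friendly functors -/

section Friendly

variable {C : Type uC} [Category.{vC} C]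

/-- The objects of the category `∇W`: the arrows in `W`. -/
def Nabla (W : MorphismProperty C) := WArrow W

/-- An arrow of `∇W` is an arrow between the domains which forms a commutative triangle with the
two arrows in `W`. -/
@[ext]
structure Nabla.Hom {W : MorphismProperty C} (X Y : WArrow W) where
  hom : X.dom ⟶ Y.dom
  cod_eq : X.cod = Y.cod
  comm : hom ≫ Y.hom = X.hom ≫ eqToHom cod_eq

instance (W : MorphismProperty C) : Category.{vC} (Nabla W) where
  Hom X Y := Nabla.Hom (W := W) X Y
  id X := ⟨𝟙 (WArrow.dom X), rfl, by simp⟩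
  comp f g := ⟨f.hom ≫ g.hom, f.cod_eq.trans g.cod_eq, by
    rw [Category.assoc, g.comm, ← Category.assoc, f.comm, Category.assoc, eqToHom_trans]⟩
  id_comp f := Nabla.Hom.ext (Category.id_comp _)
  comp_id f := Nabla.Hom.ext (Category.comp_id _)
  assoc f g k := Nabla.Hom.ext (Category.assoc _ _ _)

/-- The functor `D₀ : ∇W ⥤ C` taking domains. -/
def nablaDom (W : MorphismProperty C) : Nabla W ⥤ C where
  obj X := WArrow.dom X
  map f := Nabla.Hom.hom f
  map_id _ := rfl
  map_comp _ _ := rfl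

/-- A `W`-friendly functor from `HC` to `D`: a strict functor `G : HC → D` together with a
`W`-friendly structure `(Γ, γ)`. -/
structure WFriendly (W : MorphismProperty C) (D : DblCat.{u, v₁, v₂, v₃}) where
  G : DblFunctor (horDbl C) D
  Γ : DblFunctor (verDbl (Nabla W)) (Comp D)
  γ : verDbl.functor Γ ⋙ companionHor D ≅ nablaDom W ⋙ horDbl.functor G

namespace WFriendly

variable {W : MorphismProperty C} {D : DblCat.{u, v₁, v₂, v₃}}

/-- A `W`-friendly horizontal transformation. -/
@[ext]
structure Hom (P Q : WFriendly W D) where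
  a : P.G ⟶ Q.G
  α : P.Γ ⟶ Q.Γ
  comm : ∀ w : Nabla W, D.hComp (HorTrans.app α w) (Q.γ.hom.app w) =
    D.hComp (P.γ.hom.app w) (HorTrans.app a ((nablaDom W).obj w))

instance : Category (WFriendly W D) where
  Hom P Q := Hom P Q
  id P := ⟨𝟙 P.G, 𝟙 P.Γ, fun w => (D.hId_comp _).trans (D.hComp_id _).symm⟩
  comp f g := ⟨f.a ≫ g.a, f.α ≫ g.α, fun w =>
    (D.hAssoc _ _ _).trans <| (congrArg (D.hComp _) (g.comm w)).trans <|
      (D.hAssoc _ _ _).symm.trans <| (congrArg (fun z => D.hComp z _) (f.comm w)).trans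
        (D.hAssoc _ _ _)⟩
  id_comp f := Hom.ext (Category.id_comp _) (Category.id_comp _)
  comp_id f := Hom.ext (Category.comp_id _) (Category.comp_id _)
  assoc f g k := Hom.ext (Category.assoc _ _ _) (Category.assoc _ _ _)

end WFriendly

/-! ### The canonical `W`-friendly functor `J_C : HC → C{W}` -/

variable (W : MorphismProperty C) [W.HasRightCalculusOfFractions]

instance : ∀ X Y, Subsingleton ((fractionsDbl W).Ver X Y) :=
  fun X Y => @VArrow.instSubsingleton C _ W _ X Y

theorem fractionsDbl_ver_eq {a b : (fractionsDbl W).Obj} (l r : (fractionsDbl W).Ver a b) : l = r :=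
  Subsingleton.elim _ _

theorem fractionsDbl_cell_heq {a b c d : (fractionsDbl W).Obj} {t t' : (fractionsDbl W).Hor a b}
    {s s' : (fractionsDbl W).Hor c d} {l l' : (fractionsDbl W).Ver a c}
    {r r' : (fractionsDbl W).Ver b d} (ht : t = t') (hs : s = s')
    (x : (fractionsDbl W).Cell t s l r) (y : (fractionsDbl W).Cell t' s' l' r') : HEq x y := by
  obtain rfl : l = l' := Subsingleton.elim _ _
  obtain rfl : r = r' := Subsingleton.elim _ _
  subst ht hs
  exact heq_of_eq ((@WCell.instSubsingleton C _ W _ a b c d t s l r).elim x y)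

/-- The object `(1_A)` of `C{W}`. -/
def idArrow (A : C) : WArrow W := ⟨A, A, 𝟙 A, W.id_mem A⟩

/-- The diagram representing the image under `J_C` of the vertical identity `A = B`. -/
def idSpan {A B : C} (h : A = B) : VSpan (idArrow W A) (idArrow W B) where
  cod_eq := h
  apex := A
  fst := 𝟙 A
  snd := eqToHom h
  comm := by subst h; simp [idArrow]
  mem := by simpa [idArrow] using W.id_mem A

theorem idSpan_cell {A A' B B' : C} (f : A ⟶ A') (g : B ⟶ B') (l : A = B) (r : A' = B')
    (h : f ≫ eqToHom r = eqToHom l ≫ g) :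
    Nonempty (WCell (X := idArrow W A) (X' := idArrow W A') (Y := idArrow W B)
      (Y' := idArrow W B') f g (idSpan W l).toArrow (idSpan W r).toArrow) :=
  WCell.exists_of_arrow (idSpan W l) (idSpan W r) f ((Category.comp_id f).trans
    (Category.id_comp f).symm) h

/-- The strict inclusion `J_C : HC → C{W}`, sending `A` to `(1_A)`. -/
noncomputable def inclusionJ : DblFunctor (horDbl C) (fractionsDbl W) where
  obj (A : C) := idArrow W A
  hor f := f
  ver h := (idSpan W h.down).toArrow
  cell {_ _ _ _ t s l r} x := Classical.choice (idSpan_cell W t s l.down r.down x.down)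
  hor_id _ := rfl
  hor_comp _ _ := rfl
  ver_id _ := fractionsDbl_ver_eq W _ _
  ver_comp _ _ := fractionsDbl_ver_eq W _ _
  cell_cellH _ := fractionsDbl_cell_heq W rfl rfl _ _
  cell_cellV _ := fractionsDbl_cell_heq W rfl rfl _ _
  cell_hCell _ _ := fractionsDbl_cell_heq W rfl rfl _ _
  cell_vCell _ _ := fractionsDbl_cell_heq W rfl rfl _ _

variable {W}

/-- The diagram `(1_A, A, u)` representing the vertical companion of `u : (wu) → (w)`. -/
def companionSpan {X Y : Nabla W} (u : X ⟶ Y) : VSpan (W := W) X Y where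
  cod_eq := Nabla.Hom.cod_eq u
  apex := WArrow.dom X
  fst := 𝟙 _
  snd := Nabla.Hom.hom u
  comm := by
    rw [Category.id_comp]
    exact (Nabla.Hom.comm u).symm
  mem := by simpa using WArrow.mem X

/-- The canonical companion pair in `C{W}` given by an arrow `u : (wu) → (w)` of `∇W`. Its binding
cells are represented by the identity of the domain of `u` and by `u`, respectively. -/
noncomputable def canonicalCompanion {X Y : Nabla W} (u : X ⟶ Y) :
    Companion (fractionsDbl W) X Y where
  hor := Nabla.Hom.hom u
  ver := (companionSpan u).toArrow
  psi := Classical.choice (WCell.exists_of_arrow (VSpan.id X) (companionSpan u)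
    (𝟙 (WArrow.dom X)) rfl rfl)
  chi := Classical.choice (WCell.exists_of_arrow (companionSpan u) (VSpan.id Y)
    (Nabla.Hom.hom u) ((Category.comp_id _).trans (Category.id_comp _).symm) rfl)
  hor_eq := fractionsDbl_cell_heq W (Category.id_comp _) (Category.comp_id _) _ _
  ver_eq := fractionsDbl_cell_heq W rfl rfl _ _

theorem Companion.ext_fractions {X Y : WArrow W} {x y : Companion (fractionsDbl W) X Y}
    (h : x.hor = y.hor) : x = y :=
  Companion.ext_of_heq h (fractionsDbl_ver_eq W _ _) (fractionsDbl_cell_heq W rfl h _ _)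
    (fractionsDbl_cell_heq W h rfl _ _)

theorem CompCell.heq_fractions {a b c d : WArrow W} {t t' : (fractionsDbl W).Hor a b}
    {s s' : (fractionsDbl W).Hor c d} {l l' : Companion (fractionsDbl W) a c}
    {r r' : Companion (fractionsDbl W) b d} (ht : t = t') (hs : s = s') (hl : l.hor = l'.hor)
    (hr : r.hor = r'.hor) (x : (Comp (fractionsDbl W)).Cell t s l r)
    (y : (Comp (fractionsDbl W)).Cell t' s' l' r') : HEq x y :=
  CompCell.heq_of_heq ht hs (Companion.ext_fractions hl) (Companion.ext_fractions hr)
    (fractionsDbl_cell_heq W ht hs _ _)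

theorem canonicalCompanion_cell {X X' Y Y' : Nabla W} (u : X ⟶ Y) (u' : X' ⟶ Y') (t : X = X')
    (s : Y = Y') (h : u ≫ eqToHom s = eqToHom t ≫ u') :
    Nonempty (CompCell (D := fractionsDbl W)
      (eqToHom (congrArg (nablaDom W).obj t)) (eqToHom (congrArg (nablaDom W).obj s))
      (canonicalCompanion u) (canonicalCompanion u')) := by
  subst t s
  obtain rfl : u = u' := by simpa using h
  exact ⟨CompCell.cellH _⟩

/-- The double functor `Φ : V∇W → Comp(C{W})`. -/
noncomputable def canonicalΦ (W : MorphismProperty C) [W.HasRightCalculusOfFractions] :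
    DblFunctor (verDbl (Nabla W)) (Comp (fractionsDbl W)) where
  obj X := X
  hor h := eqToHom (congrArg (nablaDom W).obj h.down)
  ver u := canonicalCompanion u
  cell {_ _ _ _ t s l r} x :=
    Classical.choice (canonicalCompanion_cell l r t.down s.down x.down)
  hor_id _ := rfl
  hor_comp _ _ := (eqToHom_trans _ _).symm
  ver_id _ := Companion.ext_fractions rfl
  ver_comp _ _ := Companion.ext_fractions rfl
  cell_cellH _ := CompCell.heq_fractions rfl rfl rfl rfl _ _
  cell_cellV _ := CompCell.heq_fractions rfl rfl rfl rfl _ _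
  cell_hCell _ _ := CompCell.heq_fractions (eqToHom_trans _ _).symm (eqToHom_trans _ _).symm
    rfl rfl _ _
  cell_vCell {_ _ _ _ _ _ _ _ _ l r l' r'} _ _ := CompCell.heq_fractions
    (l := canonicalCompanion (l ≫ l')) (r := canonicalCompanion (r ≫ r'))
    (l' := (canonicalCompanion l).comp (canonicalCompanion l'))
    (r' := (canonicalCompanion r).comp (canonicalCompanion r')) rfl rfl rfl rfl _ _

/-- The horizontal isomorphism `φ_w : (w) → (1_A)` for `w : A ⟶ B`, given by the identity of `A`. -/
def canonicalIso (X : Nabla W) :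
    (verDbl.functor (canonicalΦ W) ⋙ companionHor (fractionsDbl W)).obj X ≅
      (nablaDom W ⋙ horDbl.functor (inclusionJ W)).obj X where
  hom := show (fractionsDbl W).Hor X (idArrow W (WArrow.dom X)) from 𝟙 (WArrow.dom X)
  inv := show (fractionsDbl W).Hor (idArrow W (WArrow.dom X)) X from 𝟙 (WArrow.dom X)
  hom_inv_id := Category.id_comp (𝟙 (WArrow.dom X))
  inv_hom_id := Category.id_comp (𝟙 (WArrow.dom X))

/-- The functor `J_C` with its canonical `W`-friendly structure `(Φ, φ)`. -/
noncomputable def canonicalWFriendly (W : MorphismProperty C) [W.HasRightCalculusOfFractions] :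
    WFriendly W (fractionsDbl W) where
  G := inclusionJ W
  Γ := canonicalΦ W
  γ := NatIso.ofComponents canonicalIso
    (fun f => (Category.comp_id (Nabla.Hom.hom f)).trans (Category.id_comp _).symm)

/-- Postcomposition of a `W`-friendly functor `(G, Γ, γ)` with a strict functor `L`, which is
`(LG, Comp(L)Γ, Lγ)`. -/
def WFriendly.postcomp {D : DblCat.{u, v₁, v₂, v₃}} {D' : DblCat.{u', v₁', v₂', v₃'}}
    (P : WFriendly W D) (L : DblFunctor D D') : WFriendly W D' where
  G := P.G.comp L
  Γ := P.Γ.comp L.compMap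
  γ := NatIso.ofComponents (fun X => L.horFunctor.mapIso (P.γ.app X)) (fun f =>
    (L.hor_comp _ _).symm.trans <| (congrArg L.hor (P.γ.hom.naturality f)).trans (L.hor_comp _ _))

/-- Composition with `J_C`: the functor `Hom(C{W}, D) ⥤ Hom_W(HC, D)` sending `L` to
`(L J_C, Comp(L) Φ, L φ)` and `b` to `(b J_C, Comp(b) Φ)`. -/
noncomputable def precompJ (W : MorphismProperty C) [W.HasRightCalculusOfFractions]
    (D : DblCat.{u, v₁, v₂, v₃}) : DblFunctor (fractionsDbl W) D ⥤ WFriendly W D where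
  obj L := (canonicalWFriendly W).postcomp L
  map {L L'} b := WFriendly.Hom.mk (P := (canonicalWFriendly W).postcomp L)
    (Q := (canonicalWFriendly W).postcomp L') (HorTrans.whiskerLeft (inclusionJ W) b)
    (HorTrans.whiskerLeft (canonicalΦ W) (HorTrans.compMap b))
    (fun w => (HorTrans.hor_naturality b (canonicalIso w).hom).symm)
  map_id _ := rfl
  map_comp _ _ := rfl

end Friendly

/-! ### Weakly globular double categories -/

section WeaklyGlobular

/-- A horizontal arrow of a double category, with its horizontal domain and codomain. -/
structure HorArrow (D : DblCat.{u, v₁, v₂, v₃}) where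
  dom : D.Obj
  cod : D.Obj
  arrow : D.Hor dom cod

/-- A cell, as an arrow from its vertical domain to its vertical codomain. -/
structure HorArrow.Hom {D : DblCat.{u, v₁, v₂, v₃}} (x y : HorArrow D) where
  left : D.Ver x.dom y.dom
  right : D.Ver x.cod y.cod
  cell : D.Cell x.arrow y.arrow left right

theorem HorArrow.Hom.ext_of_heq {D : DblCat.{u, v₁, v₂, v₃}} {x y : HorArrow D}
    {f g : HorArrow.Hom x y} (h₁ : f.left = g.left) (h₂ : f.right = g.right)
    (h₃ : HEq f.cell g.cell) : f = g := by
  obtain ⟨l, r, c⟩ := f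
  obtain ⟨l', r', c'⟩ := g
  dsimp only at h₁ h₂ h₃
  subst h₁ h₂ h₃
  rfl

/-- The category `X₁` of horizontal arrows and cells with vertical composition. -/
instance (D : DblCat.{u, v₁, v₂, v₃}) : Category (HorArrow D) where
  Hom x y := HorArrow.Hom x y
  id x := ⟨_, _, D.cellV x.arrow⟩
  comp f g := ⟨_, _, D.vCell f.cell g.cell⟩
  id_comp f := HorArrow.Hom.ext_of_heq (D.vId_comp _) (D.vId_comp _) (D.vCell_id_left _)
  comp_id f := HorArrow.Hom.ext_of_heq (D.vComp_id _) (D.vComp_id _) (D.vCell_id_right _)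
  assoc f g k := HorArrow.Hom.ext_of_heq (D.vAssoc _ _ _) (D.vAssoc _ _ _) (D.vCell_assoc _ _ _)

/-- The domain functor `d₀ : X₁ ⥤ X₀`. -/
def horDom (D : DblCat.{u, v₁, v₂, v₃}) : HorArrow D ⥤ D.VerCat where
  obj x := x.dom
  map f := HorArrow.Hom.left f
  map_id _ := rfl
  map_comp _ _ := rfl

/-- The codomain functor `d₁ : X₁ ⥤ X₀`. -/
def horCod (D : DblCat.{u, v₁, v₂, v₃}) : HorArrow D ⥤ D.VerCat where
  obj x := x.cod
  map f := HorArrow.Hom.right f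
  map_id _ := rfl
  map_comp _ _ := rfl

/-- The iterated strict fibre product `A ×_B ⋯ ×_B A` of `n + 1` copies of `A`, formed with respect
to `T` on the left and `S` on the right of each product sign. -/
structure FiberChain {A : Type*} [Category* A] {B : Type*} [Category* B] (S T : A ⥤ B) (n : ℕ) where
  obj : Fin (n + 1) → A
  eq : ∀ i : Fin n, T.obj (obj i.castSucc) = S.obj (obj i.succ)

/-- An arrow of an iterated strict fibre product. -/
@[ext]
structure FiberChain.Hom {A : Type*} [Category* A] {B : Type*} [Category* B] {S T : A ⥤ B} {n : ℕ}
    (x y : FiberChain S T n) where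
  hom : ∀ i, x.obj i ⟶ y.obj i
  comm : ∀ i : Fin n, T.map (hom i.castSucc) ≫ eqToHom (y.eq i) =
    eqToHom (x.eq i) ≫ S.map (hom i.succ)

instance {A : Type*} [Category* A] {B : Type*} [Category* B] (S T : A ⥤ B) (n : ℕ) :
    Category (FiberChain S T n) where
  Hom x y := FiberChain.Hom x y
  id x := ⟨fun i => 𝟙 _, fun i => by simp⟩
  comp f g := ⟨fun i => f.hom i ≫ g.hom i, fun i => by
    rw [T.map_comp, S.map_comp, Category.assoc, g.comm, ← Category.assoc, f.comm, Category.assoc]⟩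
  id_comp f := FiberChain.Hom.ext (funext fun _ => Category.id_comp _)
  comp_id f := FiberChain.Hom.ext (funext fun _ => Category.comp_id _)
  assoc f g k := FiberChain.Hom.ext (funext fun _ => Category.assoc _ _ _)

/-- The functor between iterated fibre products induced by `P : B ⥤ B'`. -/
def FiberChain.map {A : Type*} [Category* A] {B : Type*} [Category* B] {B' : Type*} [Category* B']
    (S T : A ⥤ B) (P : B ⥤ B') (n : ℕ) :
    FiberChain S T n ⥤ FiberChain (S ⋙ P) (T ⋙ P) n where
  obj x := ⟨x.obj, fun i => congrArg P.obj (x.eq i)⟩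
  map {x y} f :=
    { hom := fun i => FiberChain.Hom.hom (x := x) (y := y) f i
      comm := fun i => by
        have := congrArg P.map (FiberChain.Hom.comm (x := x) (y := y) f i)
        rw [P.map_comp, P.map_comp, eqToHom_map, eqToHom_map] at this
        exact this }
  map_id _ := rfl
  map_comp _ _ := rfl

/-- The canonical functor from a category to the discrete category of its path components. -/
def toComponents (A : Type*) [Category* A] : A ⥤ Discrete (ConnectedComponents A) :=
  ConnectedComponents.functorToDiscrete _ id

/-- A double category `X` is weakly globular if the canonical functor from its category of vertical
arrows `X₀` to the discrete category `X₀ᵈ` of path components of `X₀` is an equivalence, and induces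
equivalences from `X₁ ×_{X₀} ⋯ ×_{X₀} X₁` to the fibre product `X₁ ×_{X₀ᵈ} ⋯ ×_{X₀ᵈ} X₁`, for any
number `n + 1 ≥ 2` of factors. -/
structure DblCat.IsWeaklyGlobular (D : DblCat.{u, v₁, v₂, v₃}) : Prop where
  equiv : (toComponents D.VerCat).IsEquivalence
  segal : ∀ n : ℕ, 1 ≤ n →
    (FiberChain.map (horDom D) (horCod D) (toComponents D.VerCat) n).IsEquivalence

namespace DblCat

variable {D : DblCat.{u, v₁, v₂, v₃}}

theorem nonempty_ver_of_toComponents (h : ∀ {a b : D.Obj}, D.Ver a b → Nonempty (D.Ver b a))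
    {a b : D.VerCat} (e : (toComponents D.VerCat).obj a = (toComponents D.VerCat).obj b) :
    Nonempty (D.Ver a b) := by
  have z : Zigzag a b := Quotient.exact (congrArg Discrete.as e)
  clear e
  induction z with
  | refl => exact ⟨D.vId a⟩
  | tail _ z ih =>
    obtain ⟨v⟩ := ih
    obtain ⟨⟨w⟩⟩ | ⟨⟨w⟩⟩ := z
    · exact ⟨D.vComp v w⟩
    · obtain ⟨w'⟩ := h w
      exact ⟨D.vComp v w'⟩

theorem exists_chain (h : ∀ {a b : D.Obj}, D.Ver a b → Nonempty (D.Ver b a))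
    (hfill : ∀ (f : HorArrow D) {b : D.Obj}, D.Ver b f.cod →
      ∃ (a : D.Obj) (g : D.Hor a b), Nonempty (HorArrow.mk a b g ≅ f))
    (n : ℕ) (x : Fin (n + 1) → HorArrow D)
    (hx : ∀ i : Fin n, Nonempty (D.Ver (x i.castSucc).cod (x i.succ).dom)) :
    ∃ y : Fin (n + 1) → HorArrow D, (∀ i : Fin n, (y i.castSucc).cod = (y i.succ).dom) ∧
      ∀ i, Nonempty (y i ≅ x i) := by
  induction n with
  | zero => exact ⟨x, fun i => i.elim0, fun i => ⟨Iso.refl _⟩⟩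
  | succ n ih =>
    obtain ⟨y, hy, hyx⟩ := ih (fun i => x i.succ) (fun i => hx i.succ)
    obtain ⟨v⟩ := hx 0
    obtain ⟨e⟩ := hyx 0
    obtain ⟨w⟩ := h v
    obtain ⟨a, g, ⟨e'⟩⟩ := hfill (x 0) (b := (y 0).dom)
      (D.vComp (HorArrow.Hom.left e.hom) w)
    refine ⟨Fin.cons ⟨a, _, g⟩ y, fun i => ?_, fun i => ?_⟩
    · induction i using Fin.cases with
      | zero => rfl
      | succ i => exact hy i
    · induction i using Fin.cases with
      | zero => exact ⟨e'⟩
      | succ i => exact hyx i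

/-- A criterion for weak globularity: the category of vertical arrows is a posetal groupoid and
the codomain functor `d₁ : X₁ ⥤ X₀` is an isofibration. -/
theorem isWeaklyGlobular_of_fill (hs : ∀ a b, Subsingleton (D.Ver a b))
    (h : ∀ {a b : D.Obj}, D.Ver a b → Nonempty (D.Ver b a))
    (hfill : ∀ (f : HorArrow D) {b : D.Obj}, D.Ver b f.cod →
      ∃ (a : D.Obj) (g : D.Hor a b), Nonempty (HorArrow.mk a b g ≅ f)) :
    D.IsWeaklyGlobular where
  equiv :=
    { faithful := ⟨fun {a b} f g _ => ((hs a b).elim f g)⟩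
      full := ⟨fun {a b} f =>
        ⟨(nonempty_ver_of_toComponents h (Discrete.ext f.down.down)).some, Subsingleton.elim _ _⟩⟩
      essSurj := ⟨fun ⟨c⟩ => by
        obtain ⟨a, rfl⟩ := Quotient.exists_rep c
        exact ⟨a, ⟨Iso.refl _⟩⟩⟩ }
  segal n _ :=
    { faithful := ⟨fun {x y} f g e => FiberChain.Hom.ext (congrArg
        (FiberChain.Hom.hom (S := horDom D ⋙ toComponents D.VerCat)
          (T := horCod D ⋙ toComponents D.VerCat)) e)⟩
      full := ⟨fun {x y} f => ⟨{
          hom := fun i => FiberChain.Hom.hom f i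
          comm := fun i => (hs _ _).elim _ _ }, rfl⟩⟩
      essSurj := ⟨fun x => by
        obtain ⟨y, hy, e⟩ := exists_chain h hfill n x.obj
          (fun i => nonempty_ver_of_toComponents h (x.eq i))
        refine ⟨⟨y, hy⟩, ⟨⟨{ hom := fun i => (e i).some.hom, comm := ?_ },
          { hom := fun i => (e i).some.inv, comm := ?_ }, ?_, ?_⟩⟩⟩
        · exact fun i => Subsingleton.elim _ _
        · exact fun i => Subsingleton.elim _ _
        · exact FiberChain.Hom.ext (funext fun i => (e i).some.hom_inv_id)
        · exact FiberChain.Hom.ext (funext fun i => (e i).some.inv_hom_id)⟩ }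

end DblCat

variable {C : Type uC} [Category.{vC} C]

/-- `HC` is weakly globular. -/
theorem horDbl_isWeaklyGlobular : (horDbl C).IsWeaklyGlobular := by
  refine DblCat.isWeaklyGlobular_of_fill (fun a b =>
    inferInstanceAs (Subsingleton (PLift (a = b)))) (fun v => ⟨⟨v.down.symm⟩⟩) (fun f b v => ?_)
  obtain ⟨a, c, f⟩ := f
  obtain ⟨h⟩ := v
  dsimp only at h
  subst h
  exact ⟨a, f, ⟨Iso.refl _⟩⟩

/-- The diagram obtained by exchanging the two arrows of a diagram. -/
def VSpan.symm {W : MorphismProperty C} {X Y : WArrow W} (p : VSpan X Y) : VSpan Y X where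
  cod_eq := p.cod_eq.symm
  apex := p.apex
  fst := p.snd
  snd := p.fst
  comm := by rw [← p.comm]; simp
  mem := p.mem_snd

/-- `C{W}` is weakly globular. -/
theorem fractionsDbl_isWeaklyGlobular (W : MorphismProperty C) [W.HasRightCalculusOfFractions] :
    (fractionsDbl W).IsWeaklyGlobular := by
  refine DblCat.isWeaklyGlobular_of_fill inferInstance (fun {a b} v => ?_) (fun f b v => ?_)
  · obtain ⟨p, -⟩ := Quot.exists_rep v
    exact ⟨p.symm.toArrow⟩
  · obtain ⟨c, d, f⟩ := f
    obtain ⟨p, -⟩ := Quot.exists_rep v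
    obtain ⟨G, s, t, hs, e⟩ := exists_square_of_comp (W := W) f p.snd (WArrow.hom d)
      (WArrow.mem d) p.mem_snd
    let a : WArrow W := ⟨G, _, s ≫ WArrow.hom c, W.comp_mem _ _ hs (WArrow.mem c)⟩
    let q : VSpan a c := ⟨rfl, G, 𝟙 G, s, by simp [a], by simpa [a] using a.mem⟩
    obtain ⟨x⟩ := WCell.exists_of_arrow (f := t ≫ p.fst) (g := f) (l := q.toArrow)
      (r := p.toArrow) q p t (Category.id_comp _).symm e.symm
    obtain ⟨y⟩ := WCell.exists_of_arrow (f := f) (g := t ≫ p.fst) (l := q.symm.toArrow)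
      (r := p.symm.toArrow) q.symm p.symm t e.symm (Category.id_comp _).symm
    refine ⟨a, t ≫ p.fst, ⟨⟨⟨_, _, x⟩, ⟨_, _, y⟩, ?_, ?_⟩⟩⟩
    · exact HorArrow.Hom.ext_of_heq (fractionsDbl_ver_eq W _ _) (fractionsDbl_ver_eq W _ _)
        (fractionsDbl_cell_heq W rfl rfl _ _)
    · exact HorArrow.Hom.ext_of_heq (fractionsDbl_ver_eq W _ _) (fractionsDbl_ver_eq W _ _)
        (fractionsDbl_cell_heq W rfl rfl _ _)

end WeaklyGlobular

/-!
Composition with `J_C` is an equivalence because both sides see only the horizontal arrows of `D`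
and its companion pairs, and in a weakly globular `D` the vertical arrows form a groupoid with at
most one arrow between two objects.

Two facts carry the argument. The first concerns cells between companion pairs in an arbitrary
double category: there is one with a given boundary exactly if the square of horizontal arrows
commutes (`CompCell.nonempty`), it is then unique (`CompCell.cellEq`), because the binding cells
express it as a pasting, and for a `D` with vertical arrows as above it is vertically invertible
(`CompCell.vInvertible`). Thus a horizontal transformation between functors into `Comp(D)` amounts
to its horizontal components.

The second is a description of the vertical part of `C{W}` by spans. A vertical arrow is the
formal quotient of two arrows of `∇W`, and a double cell is the formal quotient of two commutative
squares of `C` whose sides are arrows of `∇W`. By the calculus of fractions, cospans in these two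
categories complete to commutative squares and parallel arrows are equalized, so that a functor
which inverts all arrows extends uniquely, and functorially, along spans (`spanLift`).

Essential surjectivity: for a `W`-friendly functor `(G, Γ, γ)`, let `L` be `Γ` on objects and
`γ⁻¹ ∘ G(f) ∘ γ` on horizontal arrows. A commutative square with sides in `∇W` determines a cell
between the companion pairs given by `Γ`, this cell is vertically invertible, and extension along
spans defines `L` on double cells (`WFriendly.lift`). Full faithfulness: the horizontal components
of a transformation determine its cells at companions, hence all its cells; conversely the cells of
a given `W`-friendly transformation at companions extend along spans (`WFriendly.Hom.extend`), and
naturality with respect to a double cell follows by cancelling one of the two squares whose quotient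
it is.
-/

/-! ### Equality of cells along equal boundaries -/

namespace DblCat

variable {D : DblCat.{u, v₁, v₂, v₃}}

/-- Equality of two cells with the same corners together with equality of their boundary arrows.
Unlike `HEq`, it is a congruence for both compositions without side conditions. -/
inductive CellEq {a b c d : D.Obj} {t : D.Hor a b} {s : D.Hor c d} {l : D.Ver a c}
    {r : D.Ver b d} (x : D.Cell t s l r) :
    ∀ {t₁ : D.Hor a b} {s₁ : D.Hor c d} {l₁ : D.Ver a c} {r₁ : D.Ver b d},
      D.Cell t₁ s₁ l₁ r₁ → Prop
  | refl : CellEq x x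

namespace CellEq

section

variable {a b c d : D.Obj} {t t₁ t₂ : D.Hor a b} {s s₁ s₂ : D.Hor c d} {l l₁ l₂ : D.Ver a c}
  {r r₁ r₂ : D.Ver b d} {x : D.Cell t s l r} {x₁ : D.Cell t₁ s₁ l₁ r₁} {x₂ : D.Cell t₂ s₂ l₂ r₂}

theorem symm (h : CellEq x x₁) : CellEq x₁ x := by
  cases h; exact refl

theorem trans (h : CellEq x x₁) (h' : CellEq x₁ x₂) : CellEq x x₂ := by
  cases h; exact h'

theorem heq (h : CellEq x x₁) : HEq x x₁ := by
  cases h; rfl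

theorem left (h : CellEq x x₁) : l = l₁ := by
  cases h; rfl

theorem right (h : CellEq x x₁) : r = r₁ := by
  cases h; rfl

theorem of_heq (ht : t = t₁) (hs : s = s₁) (hl : l = l₁) (hr : r = r₁) (h : HEq x x₁) :
    CellEq x x₁ := by
  subst ht hs hl hr h; exact refl

theorem of_eq {x y : D.Cell t s l r} (h : x = y) : CellEq x y := by
  subst h; exact refl

theorem cast (ht : t = t₁) (hs : s = s₁) (hl : l = l₁) (hr : r = r₁) (x : D.Cell t s l r) :
    CellEq (castCell ht hs hl hr x) x :=
  of_heq ht.symm hs.symm hl.symm hr.symm (castCell_heq ht hs hl hr x)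

theorem hId_left (x : D.Cell t s l r) : CellEq (D.hCell (D.cellH l) x) x :=
  of_heq (D.hId_comp _) (D.hId_comp _) rfl rfl (D.hCell_id_left x)

theorem hId_right (x : D.Cell t s l r) : CellEq (D.hCell x (D.cellH r)) x :=
  of_heq (D.hComp_id _) (D.hComp_id _) rfl rfl (D.hCell_id_right x)

theorem vId_left (x : D.Cell t s l r) : CellEq (D.vCell (D.cellV t) x) x :=
  of_heq rfl rfl (D.vId_comp _) (D.vId_comp _) (D.vCell_id_left x)

theorem vId_right (x : D.Cell t s l r) : CellEq (D.vCell x (D.cellV s)) x :=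
  of_heq rfl rfl (D.vComp_id _) (D.vComp_id _) (D.vCell_id_right x)

end

theorem hCell {a b c d e f : D.Obj} {t t₁ : D.Hor a b} {s s₁ : D.Hor c d}
    {l l₁ : D.Ver a c} {m m₁ : D.Ver b d} {t' t'₁ : D.Hor b e} {s' s'₁ : D.Hor d f}
    {r r₁ : D.Ver e f} {x : D.Cell t s l m} {x₁ : D.Cell t₁ s₁ l₁ m₁}
    {y : D.Cell t' s' m r} {y₁ : D.Cell t'₁ s'₁ m₁ r₁} (hx : CellEq x x₁) (hy : CellEq y y₁) :
    CellEq (D.hCell x y) (D.hCell x₁ y₁) := by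
  cases hx; cases hy; exact refl

theorem vCell {a b c d e f : D.Obj} {t t₁ : D.Hor a b} {m m₁ : D.Hor c d}
    {s s₁ : D.Hor e f} {l l₁ : D.Ver a c} {r r₁ : D.Ver b d} {l' l'₁ : D.Ver c e}
    {r' r'₁ : D.Ver d f} {x : D.Cell t m l r} {x₁ : D.Cell t₁ m₁ l₁ r₁}
    {y : D.Cell m s l' r'} {y₁ : D.Cell m₁ s₁ l'₁ r'₁} (hx : CellEq x x₁) (hy : CellEq y y₁) :
    CellEq (D.vCell x y) (D.vCell x₁ y₁) := by
  cases hx; cases hy; exact refl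

theorem hAssoc {a b c d a' b' c' d' : D.Obj} {t : D.Hor a b} {t' : D.Hor b c} {t'' : D.Hor c d}
    {s : D.Hor a' b'} {s' : D.Hor b' c'} {s'' : D.Hor c' d'}
    {l : D.Ver a a'} {m : D.Ver b b'} {n : D.Ver c c'} {r : D.Ver d d'}
    (x : D.Cell t s l m) (y : D.Cell t' s' m n) (z : D.Cell t'' s'' n r) :
    CellEq (D.hCell (D.hCell x y) z) (D.hCell x (D.hCell y z)) :=
  of_heq (D.hAssoc _ _ _) (D.hAssoc _ _ _) rfl rfl (D.hCell_assoc x y z)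

theorem vAssoc {a b c d a' b' c' d' : D.Obj} {l : D.Ver a b} {l' : D.Ver b c} {l'' : D.Ver c d}
    {r : D.Ver a' b'} {r' : D.Ver b' c'} {r'' : D.Ver c' d'}
    {t : D.Hor a a'} {m : D.Hor b b'} {n : D.Hor c c'} {s : D.Hor d d'}
    (x : D.Cell t m l r) (y : D.Cell m n l' r') (z : D.Cell n s l'' r'') :
    CellEq (D.vCell (D.vCell x y) z) (D.vCell x (D.vCell y z)) :=
  of_heq rfl rfl (D.vAssoc _ _ _) (D.vAssoc _ _ _) (D.vCell_assoc x y z)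

theorem interchange {a₁ a₂ a₃ b₁ b₂ b₃ c₁ c₂ c₃ : D.Obj}
    {f : D.Hor a₁ a₂} {f' : D.Hor a₂ a₃} {g : D.Hor b₁ b₂} {g' : D.Hor b₂ b₃}
    {k : D.Hor c₁ c₂} {k' : D.Hor c₂ c₃} {l : D.Ver a₁ b₁} {m : D.Ver a₂ b₂} {r : D.Ver a₃ b₃}
    {l' : D.Ver b₁ c₁} {m' : D.Ver b₂ c₂} {r' : D.Ver b₃ c₃}
    (x : D.Cell f g l m) (y : D.Cell f' g' m r) (z : D.Cell g k l' m')
    (w : D.Cell g' k' m' r') :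
    CellEq (D.vCell (D.hCell x y) (D.hCell z w)) (D.hCell (D.vCell x z) (D.vCell y w)) :=
  of_eq (D.interchange x y z w)

theorem cellV {a b : D.Obj} {f g : D.Hor a b} (h : f = g) : CellEq (D.cellV f) (D.cellV g) := by
  subst h; exact refl

theorem cellH {a b : D.Obj} {v w : D.Ver a b} (h : v = w) : CellEq (D.cellH v) (D.cellH w) := by
  subst h; exact refl

theorem cellH_vId (a : D.Obj) : CellEq (D.cellH (D.vId a)) (D.cellV (D.hId a)) :=
  of_eq (D.cellH_vId a)

theorem cellH_vComp {a b c : D.Obj} (v : D.Ver a b) (w : D.Ver b c) :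
    CellEq (D.vCell (D.cellH v) (D.cellH w)) (D.cellH (D.vComp v w)) :=
  of_eq (D.cellH_vComp v w).symm

theorem cellV_hComp {a b c : D.Obj} (f : D.Hor a b) (g : D.Hor b c) :
    CellEq (D.hCell (D.cellV f) (D.cellV g)) (D.cellV (D.hComp f g)) :=
  of_eq (D.cellV_hComp f g).symm

theorem hCell_cellV_hId_left {a b c : D.Obj} {t : D.Hor a b} {s : D.Hor a c} {r : D.Ver b c}
    (x : D.Cell t s (D.vId a) r) : CellEq (D.hCell (D.cellV (D.hId a)) x) x :=
  ((cellH_vId a).symm.hCell refl).trans (hId_left x)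

theorem hCell_cellV_hId_right {a b c : D.Obj} {t : D.Hor a c} {s : D.Hor b c} {l : D.Ver a b}
    (x : D.Cell t s l (D.vId c)) : CellEq (D.hCell x (D.cellV (D.hId c))) x :=
  (refl.hCell (cellH_vId c).symm).trans (hId_right x)

theorem exists_cast {a b c d : D.Obj} {t t₁ : D.Hor a b} {s s₁ : D.Hor c d} {l l₁ : D.Ver a c}
    {r r₁ : D.Ver b d} (ht : t = t₁) (hs : s = s₁) (hl : l = l₁) (hr : r = r₁)
    (x : D.Cell t s l r) : ∃ y : D.Cell t₁ s₁ l₁ r₁, CellEq y x :=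
  ⟨castCell ht hs hl hr x, cast ht hs hl hr x⟩

end CellEq

end DblCat

/-! ### Cells between companion pairs -/

namespace Companion

variable {D : DblCat.{u, v₁, v₂, v₃}} {a b : D.Obj}

theorem hCell_psi_chi (x : Companion D a b) : CellEq (D.hCell x.psi x.chi) (D.cellV x.hor) :=
  .of_heq (D.hId_comp _) (D.hComp_id _) rfl rfl x.hor_eq

theorem vCell_psi_chi (x : Companion D a b) : CellEq (D.vCell x.psi x.chi) (D.cellH x.ver) :=
  .of_heq rfl rfl (D.vId_comp _) (D.vComp_id _) x.ver_eq

end Companion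

namespace CompCell

variable {D : DblCat.{u, v₁, v₂, v₃}} {a b c d : D.Obj} {t t' : D.Hor a b} {s s' : D.Hor c d}
  {l l' : Companion D a c} {r r' : Companion D b d}

/-- Cells between companion pairs exist as soon as the square of horizontal arrows commutes: the
filler is the pasting of the second binding cell on the left below the first one on the right. -/
theorem nonempty (h : D.hComp t r.hor = D.hComp l.hor s) : Nonempty (CompCell t s l r) := by
  obtain ⟨y, hy⟩ := CellEq.exists_cast h.symm rfl rfl rfl (D.hCell l.chi (D.cellV s))
  obtain ⟨x, e⟩ := CellEq.exists_cast (D.hComp_id t) (D.hId_comp s) (D.vId_comp l.ver)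
    (D.vComp_id r.ver) (D.vCell (D.hCell (D.cellV t) r.psi) y)
  refine ⟨⟨x, h, CellEq.heq ?_, CellEq.heq ?_⟩⟩
  · refine (e.hCell (CellEq.vId_right r.chi).symm).trans ?_
    refine (CellEq.interchange _ _ _ _).symm.trans ?_
    refine (CellEq.vCell ((CellEq.hAssoc _ _ _).trans
      ((CellEq.refl.hCell r.hCell_psi_chi).trans (CellEq.cellV_hComp _ _)))
      (CellEq.hCell_cellV_hId_right _)).trans ?_
    exact (CellEq.vId_left y).trans hy
  · refine ((CellEq.vId_left l.psi).symm.hCell e).trans ?_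
    refine (CellEq.interchange _ _ _ _).symm.trans ?_
    refine (CellEq.vCell (y₁ := D.cellV (D.hComp t r.hor)) (CellEq.hCell_cellV_hId_left _)
      ?_).trans (CellEq.vId_right _)
    refine (CellEq.refl.hCell hy).trans ((CellEq.hAssoc _ _ _).symm.trans ?_)
    refine (l.hCell_psi_chi.hCell CellEq.refl).trans ((CellEq.cellV_hComp _ _).trans ?_)
    exact CellEq.cellV h.symm

theorem hCell_psi_cell (x : CompCell t s l r) :
    CellEq (D.hCell l.psi x.cell) (D.hCell (D.cellV t) r.psi) :=
  .of_heq ((D.hId_comp _).trans (D.hComp_id _).symm) x.hor_comm.symm rfl rfl x.psi_eq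

/-- A cell between companion pairs is the pasting of `ψ | x` and `χ | 1`, and the compatibility of
`x` with the binding cells computes the first of these. -/
theorem cell_eq_pasting (x : CompCell t s l r) :
    CellEq x.cell (D.vCell (D.hCell l.psi x.cell) (D.hCell l.chi (D.cellV s))) :=
  (CellEq.hId_left x.cell).symm.trans ((l.vCell_psi_chi.symm.hCell
    (CellEq.vId_right x.cell).symm).trans (CellEq.interchange _ _ _ _).symm)

/-- Cells between companion pairs are determined by their boundary. -/
theorem cellEq (x : CompCell t s l r) (y : CompCell t' s' l' r') (ht : t = t') (hs : s = s')
    (hl : l = l') (hr : r = r') : CellEq x.cell y.cell := by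
  subst ht hs hl hr
  exact x.cell_eq_pasting.trans (((x.hCell_psi_cell.trans y.hCell_psi_cell.symm).vCell
    CellEq.refl).trans y.cell_eq_pasting.symm)

end CompCell

/-! ### Vertically invertible cells -/

/-- A double category is vertically thin if its category of vertical arrows is a groupoid with at
most one arrow between any two objects. -/
class DblCat.IsVerticallyThin (D : DblCat.{u, v₁, v₂, v₃}) : Prop where
  subsingleton : ∀ a b : D.Obj, Subsingleton (D.Ver a b)
  symm : ∀ {a b : D.Obj}, D.Ver a b → Nonempty (D.Ver b a)

theorem DblCat.IsWeaklyGlobular.isVerticallyThin {D : DblCat.{u, v₁, v₂, v₃}}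
    (hD : D.IsWeaklyGlobular) : D.IsVerticallyThin where
  subsingleton a b := by
    have := hD.equiv
    let a' : D.VerCat := a
    let b' : D.VerCat := b
    exact ⟨fun v w => (toComponents D.VerCat).map_injective (X := a') (Y := b')
      (Subsingleton.elim _ _)⟩
  symm {a b} v := by
    have := hD.equiv
    let a' : D.VerCat := a
    let b' : D.VerCat := b
    let v' : a' ⟶ b' := v
    exact ⟨(toComponents D.VerCat).preimage (X := b') (Y := a')
      (Discrete.eqToHom (Discrete.eq_of_hom ((toComponents D.VerCat).map v')).symm)⟩

namespace DblCat

variable {D : DblCat.{u, v₁, v₂, v₃}}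

theorem ver_subsingleton [hD : D.IsVerticallyThin] {a b : D.Obj} (v w : D.Ver a b) : v = w :=
  (hD.subsingleton a b).elim v w

/-- A cell with an inverse for vertical composition. -/
def VInvertible {a b c d : D.Obj} {t : D.Hor a b} {s : D.Hor c d} {l : D.Ver a c} {r : D.Ver b d}
    (x : D.Cell t s l r) : Prop :=
  ∃ (l' : D.Ver c a) (r' : D.Ver d b) (y : D.Cell s t l' r'),
    CellEq (D.vCell x y) (D.cellV t) ∧ CellEq (D.vCell y x) (D.cellV s)

theorem VInvertible.congr {a b c d : D.Obj} {t t₁ : D.Hor a b} {s s₁ : D.Hor c d}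
    {l l₁ : D.Ver a c} {r r₁ : D.Ver b d} {x : D.Cell t s l r} {x₁ : D.Cell t₁ s₁ l₁ r₁}
    (h : VInvertible x) (e : CellEq x x₁) : VInvertible x₁ := by
  cases e; exact h

theorem vInvertible_cellV {a b : D.Obj} (f : D.Hor a b) : VInvertible (D.cellV f) :=
  ⟨_, _, D.cellV f, CellEq.vId_left _, CellEq.vId_left _⟩

theorem VInvertible.vCell {a b c d e f : D.Obj} {t : D.Hor a b} {m : D.Hor c d} {s : D.Hor e f}
    {l : D.Ver a c} {r : D.Ver b d} {l' : D.Ver c e} {r' : D.Ver d f} {x : D.Cell t m l r}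
    {y : D.Cell m s l' r'} (hx : VInvertible x) (hy : VInvertible y) :
    VInvertible (D.vCell x y) := by
  obtain ⟨_, _, x', h₁, h₂⟩ := hx
  obtain ⟨_, _, y', h₃, h₄⟩ := hy
  refine ⟨_, _, D.vCell y' x', ?_, ?_⟩
  · refine (CellEq.vAssoc _ _ _).trans ((CellEq.refl.vCell ((CellEq.vAssoc _ _ _).symm.trans
      ((h₃.vCell CellEq.refl).trans (CellEq.vId_left _)))).trans h₁)
  · refine (CellEq.vAssoc _ _ _).trans ((CellEq.refl.vCell ((CellEq.vAssoc _ _ _).symm.trans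
      ((h₂.vCell CellEq.refl).trans (CellEq.vId_left _)))).trans h₄)

theorem VInvertible.hCell [D.IsVerticallyThin] {a b c d e f : D.Obj} {t : D.Hor a b}
    {s : D.Hor c d} {l : D.Ver a c} {m : D.Ver b d} {t' : D.Hor b e} {s' : D.Hor d f}
    {r : D.Ver e f} {x : D.Cell t s l m} {y : D.Cell t' s' m r} (hx : VInvertible x)
    (hy : VInvertible y) : VInvertible (D.hCell x y) := by
  obtain ⟨_, m', x', h₁, h₂⟩ := hx
  obtain ⟨m'', _, y', h₃, h₄⟩ := hy
  obtain rfl : m' = m'' := ver_subsingleton _ _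
  exact ⟨_, _, D.hCell x' y',
    (CellEq.interchange _ _ _ _).trans ((h₁.hCell h₃).trans (CellEq.cellV_hComp _ _)),
    (CellEq.interchange _ _ _ _).trans ((h₂.hCell h₄).trans (CellEq.cellV_hComp _ _))⟩

/-- Vertically invertible cells can be cancelled from above. -/
theorem VInvertible.cancel {a b c d e f : D.Obj} {t t₁ : D.Hor a b} {m m₁ : D.Hor c d}
    {s s₁ : D.Hor e f} {l l₁ : D.Ver a c} {r r₁ : D.Ver b d} {l' l'₁ : D.Ver c e}
    {r' r'₁ : D.Ver d f} {x : D.Cell t m l r} {x₁ : D.Cell t₁ m₁ l₁ r₁}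
    {y : D.Cell m s l' r'} {z : D.Cell m₁ s₁ l'₁ r'₁} (hx : VInvertible x) (e : CellEq x x₁)
    (h : CellEq (D.vCell x y) (D.vCell x₁ z)) : CellEq y z := by
  cases e
  obtain ⟨_, _, x', -, h₂⟩ := hx
  have k : ∀ {s : D.Hor e f} {l' : D.Ver c e} {r' : D.Ver d f} (w : D.Cell m s l' r'),
      CellEq w (D.vCell x' (D.vCell x w)) := fun w =>
    (CellEq.vId_left w).symm.trans ((h₂.symm.vCell CellEq.refl).trans (CellEq.vAssoc _ _ _))
  exact (k y).trans ((CellEq.refl.vCell h).trans (k z).symm)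

/-- A cell, as an arrow of the category of horizontal arrows. -/
abbrev horArrowHom {a b c d : D.Obj} {t : D.Hor a b} {s : D.Hor c d} {l : D.Ver a c}
    {r : D.Ver b d} (x : D.Cell t s l r) : HorArrow.mk a b t ⟶ HorArrow.mk c d s :=
  HorArrow.Hom.mk l r x

theorem CellEq.horArrowHom_eq {x y : HorArrow D} {f g : x ⟶ y}
    (h : CellEq (HorArrow.Hom.cell f) (HorArrow.Hom.cell g)) : f = g :=
  HorArrow.Hom.ext_of_heq h.left h.right h.heq

theorem cellEq_of_horArrowHom_eq {x y : HorArrow D} {f g : x ⟶ y} (h : f = g) :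
    CellEq (HorArrow.Hom.cell f) (HorArrow.Hom.cell g) := by
  subst h; exact .refl

theorem VInvertible.isIso {x y : HorArrow D} {f : x ⟶ y}
    (h : VInvertible (HorArrow.Hom.cell f)) : IsIso f := by
  obtain ⟨l', r', g, h₁, h₂⟩ := h
  exact ⟨⟨l', r', g⟩, h₁.horArrowHom_eq, h₂.horArrowHom_eq⟩

end DblCat

/-! ### Companions of invertible vertical arrows -/

namespace Companion

variable {D : DblCat.{u, v₁, v₂, v₃}} [hD : D.IsVerticallyThin] {a b : D.Obj}

/-- If the vertical arrow of a companion pair has an inverse `v'`, then the pasting of `χ`, `v'` and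
`ψ` is an identity: it is an endomorphism of the horizontal arrow which does not change `χ`. -/
theorem vCell_chi_psi (x : Companion D a b) (v' : D.Ver b a) :
    CellEq (D.vCell (D.vCell x.chi (D.cellH v')) x.psi) (D.cellV x.hor) := by
  obtain ⟨e, he⟩ := CellEq.exists_cast rfl rfl (ver_subsingleton _ (D.vId a))
    (ver_subsingleton _ (D.vId b)) (D.vCell (D.vCell x.chi (D.cellH v')) x.psi)
  refine he.symm.trans ?_
  have h₁ : CellEq (D.vCell e x.chi) x.chi := by
    refine (he.vCell CellEq.refl).trans ((CellEq.vAssoc _ _ _).trans ?_)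
    refine (CellEq.refl.vCell x.vCell_psi_chi).trans ((CellEq.vAssoc _ _ _).trans ?_)
    refine (CellEq.refl.vCell ((CellEq.cellH_vComp _ _).trans ((CellEq.cellH
      (ver_subsingleton _ (D.vId b))).trans (CellEq.cellH_vId b)))).trans (CellEq.vId_right _)
  have h₂ : CellEq (D.hCell (D.vCell (D.cellV (D.hId a)) x.psi) (D.vCell e x.chi)) e :=
    (CellEq.interchange _ _ _ _).symm.trans
      (((CellEq.hCell_cellV_hId_left e).vCell x.hCell_psi_chi).trans (CellEq.vId_right e))
  exact h₂.symm.trans (((CellEq.vId_left x.psi).hCell h₁).trans x.hCell_psi_chi)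

theorem vInvertible_psi (x : Companion D a b) : VInvertible x.psi := by
  obtain ⟨v'⟩ := hD.symm x.ver
  refine ⟨_, _, D.vCell x.chi (D.cellH v'), ?_, x.vCell_chi_psi v'⟩
  refine (CellEq.vAssoc _ _ _).symm.trans ((x.vCell_psi_chi.vCell CellEq.refl).trans ?_)
  exact (CellEq.cellH_vComp _ _).trans
    ((CellEq.cellH (ver_subsingleton _ _)).trans (CellEq.cellH_vId a))

theorem vInvertible_chi (x : Companion D a b) : VInvertible x.chi := by
  obtain ⟨v'⟩ := hD.symm x.ver
  refine ⟨_, _, D.vCell (D.cellH v') x.psi, (CellEq.vAssoc _ _ _).symm.trans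
    (x.vCell_chi_psi v'), ?_⟩
  refine (CellEq.vAssoc _ _ _).trans ((CellEq.refl.vCell x.vCell_psi_chi).trans ?_)
  exact (CellEq.cellH_vComp _ _).trans
    ((CellEq.cellH (ver_subsingleton _ _)).trans (CellEq.cellH_vId b))

end Companion

/-- Cells between companions of invertible vertical arrows are vertically invertible, being pastings
of binding cells. -/
theorem CompCell.vInvertible {D : DblCat.{u, v₁, v₂, v₃}} [D.IsVerticallyThin] {a b c d : D.Obj}
    {t : D.Hor a b} {s : D.Hor c d} {l : Companion D a c} {r : Companion D b d}
    (x : CompCell t s l r) : VInvertible x.cell :=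
  ((((vInvertible_cellV t).hCell r.vInvertible_psi).congr x.hCell_psi_cell.symm).vCell
    (l.vInvertible_chi.hCell (vInvertible_cellV s))).congr x.cell_eq_pasting.symm

/-! ### Extension of functors along spans -/

/-- A category in which cospans complete to commutative squares and parallel arrows can be
equalized from the left: a cofiltered category, except that it need not be connected. -/
class IsPseudoCofiltered (N : Type*) [Category* N] : Prop where
  exists_square : ∀ {X Y Z : N} (f : X ⟶ Z) (g : Y ⟶ Z),
    ∃ (P : N) (a : P ⟶ X) (b : P ⟶ Y), a ≫ f = b ≫ g
  exists_equalize : ∀ {X Y : N} (f g : X ⟶ Y), ∃ (P : N) (a : P ⟶ X), a ≫ f = a ≫ g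

section SpanLift

variable {N : Type*} [Category* N] {E : Type*} [Category* E]

/-- Two objects are joined by a span. -/
def HasSpan (X Y : N) : Prop := ∃ P : N, Nonempty (P ⟶ X) ∧ Nonempty (P ⟶ Y)

theorem HasSpan.refl (X : N) : HasSpan X X := ⟨X, ⟨𝟙 X⟩, ⟨𝟙 X⟩⟩

variable [hN : IsPseudoCofiltered N] (F : N ⥤ E) [hF : ∀ {X Y : N} (f : X ⟶ Y), IsIso (F.map f)]

theorem HasSpan.trans {X Y Z : N} (h : HasSpan X Y) (h' : HasSpan Y Z) : HasSpan X Z := by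
  obtain ⟨P, ⟨a⟩, ⟨b⟩⟩ := h
  obtain ⟨Q, ⟨c⟩, ⟨d⟩⟩ := h'
  obtain ⟨R, s, t, -⟩ := hN.exists_square b c
  exact ⟨R, ⟨s ≫ a⟩, ⟨t ≫ d⟩⟩

/-- Since any two spans with the same feet have a common refinement, the arrow `F(a)⁻¹ F(b)` does
not depend on the span `(a, b)`. -/
theorem map_comp_eq_map {X Y : N} {k : F.obj X ⟶ F.obj Y} {P Q : N} {a : P ⟶ X} {b : P ⟶ Y}
    (h : F.map a ≫ k = F.map b) (c : Q ⟶ X) (d : Q ⟶ Y) : F.map c ≫ k = F.map d := by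
  obtain ⟨R, s, t, e⟩ := hN.exists_square a c
  obtain ⟨R', r, e'⟩ := hN.exists_equalize (s ≫ b) (t ≫ d)
  rw [← cancel_epi (F.map (r ≫ t)), ← F.map_comp_assoc, Category.assoc, ← e, F.map_comp,
    F.map_comp, Category.assoc, Category.assoc, h, ← F.map_comp, ← F.map_comp, e', ← F.map_comp,
    Category.assoc]

theorem exists_spanLift {X Y : N} (h : HasSpan X Y) : ∃ k : F.obj X ⟶ F.obj Y,
    ∀ {P : N} (a : P ⟶ X) (b : P ⟶ Y), F.map a ≫ k = F.map b := by
  obtain ⟨P, ⟨a⟩, ⟨b⟩⟩ := h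
  exact ⟨inv (F.map a) ≫ F.map b, map_comp_eq_map F (a := a) (b := b) (by simp)⟩

/-- The arrow `F(a)⁻¹ F(b)` for any span `(a, b)`. -/
noncomputable def spanLift {X Y : N} (h : HasSpan X Y) : F.obj X ⟶ F.obj Y :=
  (exists_spanLift F h).choose

theorem map_comp_spanLift {X Y : N} (h : HasSpan X Y) {P : N} (a : P ⟶ X) (b : P ⟶ Y) :
    F.map a ≫ spanLift F h = F.map b :=
  (exists_spanLift F h).choose_spec a b

theorem spanLift_refl {X : N} (h : HasSpan X X) : spanLift F h = 𝟙 _ := by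
  simpa using map_comp_spanLift F h (𝟙 X) (𝟙 X)

theorem spanLift_trans {X Y Z : N} (h : HasSpan X Y) (h' : HasSpan Y Z) (h'' : HasSpan X Z) :
    spanLift F h'' = spanLift F h ≫ spanLift F h' := by
  have ⟨P, ⟨a⟩, ⟨b⟩⟩ := h
  have ⟨Q, ⟨c⟩, ⟨d⟩⟩ := h'
  obtain ⟨R, s, t, e⟩ := hN.exists_square b c
  rw [← cancel_epi (F.map (s ≫ a)), map_comp_spanLift F h'' (s ≫ a) (t ≫ d), ← Category.assoc,
    map_comp_spanLift F h (s ≫ a) (s ≫ b), e, F.map_comp, F.map_comp, Category.assoc,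
    map_comp_spanLift F h' c d]

end SpanLift

/-! ### Spans in `∇W` and between its arrows -/

section NablaSpans

variable {C : Type uC} [Category.{vC} C] {W : MorphismProperty C}

/-- The restriction of an object of `∇W` along an arrow into its domain. -/
def Nabla.restrict (X : Nabla W) {E : C} (s : E ⟶ WArrow.dom X) (hs : W (s ≫ WArrow.hom X)) :
    Nabla W :=
  WArrow.mk E (WArrow.cod X) (s ≫ WArrow.hom X) hs

/-- The arrow of `∇W` from a restriction. -/
def Nabla.restrictHom (X : Nabla W) {E : C} (s : E ⟶ WArrow.dom X)
    (hs : W (s ≫ WArrow.hom X)) : X.restrict s hs ⟶ X :=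
  Nabla.Hom.mk s rfl (by simp [Nabla.restrict])

/-- A diagram of `C{W}` as an object of `∇W`. -/
abbrev VSpan.obj {X Y : Nabla W} (p : VSpan (W := W) X Y) : Nabla W := X.restrict p.fst p.mem

/-- The left leg of a diagram, as an arrow of `∇W`. -/
abbrev VSpan.left {X Y : Nabla W} (p : VSpan (W := W) X Y) : p.obj ⟶ X :=
  X.restrictHom p.fst p.mem

/-- The right leg of a diagram, as an arrow of `∇W`. -/
def VSpan.right {X Y : Nabla W} (p : VSpan (W := W) X Y) : p.obj ⟶ Y :=
  Nabla.Hom.mk p.snd p.cod_eq p.comm.symm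

theorem Nabla.hom_comp {X Y Z : Nabla W} (f : X ⟶ Y) (g : Y ⟶ Z) :
    Nabla.Hom.hom (f ≫ g) = Nabla.Hom.hom f ≫ Nabla.Hom.hom g := rfl

theorem Nabla.Hom.mem {X Y : Nabla W} (f : X ⟶ Y) : W (Nabla.Hom.hom f ≫ WArrow.hom Y) := by
  obtain ⟨A, B, w, hw⟩ := X
  obtain ⟨A', B', w', hw'⟩ := Y
  obtain ⟨f, h, c⟩ := f
  dsimp only at h f c ⊢
  subst h
  rw [c]
  simpa using hw

/-- Restricting the source of an arrow of `∇W`. -/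
def Nabla.liftHom {X Y Z : Nabla W} (f : X ⟶ Z) (g : Y ⟶ Z) {E : C} (s : E ⟶ WArrow.dom X)
    (hs : W (s ≫ WArrow.hom X)) (t : E ⟶ WArrow.dom Y)
    (e : s ≫ Nabla.Hom.hom f = t ≫ Nabla.Hom.hom g) : X.restrict s hs ⟶ Y :=
  Nabla.Hom.mk t ((Nabla.Hom.cod_eq f).trans (Nabla.Hom.cod_eq g).symm) (by
    have hf := Nabla.Hom.comm f
    have hg := Nabla.Hom.comm g
    rw [← cancel_mono (eqToHom (Nabla.Hom.cod_eq g))]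
    simp only [Nabla.restrict, Category.assoc, eqToHom_trans]
    rw [← hg, ← hf, reassoc_of% e])

theorem Nabla.hom_ext {X Y : Nabla W} {f g : X ⟶ Y} (h : Nabla.Hom.hom f = Nabla.Hom.hom g) :
    f = g :=
  Nabla.Hom.ext h

variable [W.HasRightCalculusOfFractions]

instance : IsPseudoCofiltered (Nabla W) where
  exists_square {X Y Z} f g := by
    obtain ⟨E, s, t, hs, e⟩ := exists_square_of_comp (W := W) (Nabla.Hom.hom f)
      (Nabla.Hom.hom g) (WArrow.hom Z) (WArrow.mem Z) (Nabla.Hom.mem g)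
    have hs' := W.comp_mem _ _ hs (WArrow.mem X)
    exact ⟨X.restrict s hs', X.restrictHom s hs', Nabla.liftHom f g s hs' t e,
      Nabla.hom_ext e⟩
  exists_equalize {X Y} f g := by
    obtain ⟨E, s, hs, e⟩ := exists_equalize (W := W) (Nabla.Hom.hom f) (Nabla.Hom.hom g)
      (WArrow.hom Y) (WArrow.mem Y) ((Nabla.Hom.comm f).trans (Nabla.Hom.comm g).symm)
    have hs' := W.comp_mem _ _ hs (WArrow.mem X)
    exact ⟨X.restrict s hs', X.restrictHom s hs', Nabla.hom_ext e⟩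

/-- An arrow of `C` into the domain of `Y` lifts through any arrow of `∇W` after restriction. -/
theorem Nabla.exists_lift {X Y Y' : Nabla W} (f : WArrow.dom X ⟶ WArrow.dom Y) (u : Y' ⟶ Y) :
    ∃ (X' : Nabla W) (k : X' ⟶ X) (t : WArrow.dom X' ⟶ WArrow.dom Y'),
      Nabla.Hom.hom k ≫ f = t ≫ Nabla.Hom.hom u := by
  obtain ⟨E, s, t, hs, e⟩ := exists_square_of_comp (W := W) f (Nabla.Hom.hom u) (WArrow.hom Y)
    (WArrow.mem Y) (Nabla.Hom.mem u)
  have hs' := W.comp_mem _ _ hs (WArrow.mem X)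
  exact ⟨X.restrict s hs', X.restrictHom s hs', t, e⟩

/-- Arrows of `C` which agree after composition with an arrow of `∇W` agree after restriction. -/
theorem Nabla.exists_equalize {X Y Y' : Nabla W} (f g : WArrow.dom X ⟶ WArrow.dom Y)
    (u : Y ⟶ Y') (h : f ≫ Nabla.Hom.hom u = g ≫ Nabla.Hom.hom u) :
    ∃ (X' : Nabla W) (k : X' ⟶ X), Nabla.Hom.hom k ≫ f = Nabla.Hom.hom k ≫ g := by
  obtain ⟨E, s, hs, e⟩ := _root_.exists_equalize (W := W) f g
    (Nabla.Hom.hom u ≫ WArrow.hom Y') (Nabla.Hom.mem u) (by rw [reassoc_of% h])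
  have hs' := W.comp_mem _ _ hs (WArrow.mem X)
  exact ⟨X.restrict s hs', X.restrictHom s hs', e⟩

variable (W) in
/-- The category of horizontal arrows of `C{W}`, with commutative squares in `C` as morphisms whose
two sides are arrows of `∇W`. -/
abbrev NablaSquare := Comma (nablaDom W) (nablaDom W)

instance : IsPseudoCofiltered (NablaSquare W) where
  exists_square {f₁ f₂ f₃} m n := by
    obtain ⟨X₁, Y₁, (f₁ : WArrow.dom X₁ ⟶ WArrow.dom Y₁)⟩ := f₁
    obtain ⟨X₂, Y₂, (f₂ : WArrow.dom X₂ ⟶ WArrow.dom Y₂)⟩ := f₂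
    obtain ⟨X₃, Y₃, (f₃ : WArrow.dom X₃ ⟶ WArrow.dom Y₃)⟩ := f₃
    obtain ⟨u, u', (hm : Nabla.Hom.hom u ≫ f₃ = f₁ ≫ Nabla.Hom.hom u')⟩ := m
    obtain ⟨v, v', (hn : Nabla.Hom.hom v ≫ f₃ = f₂ ≫ Nabla.Hom.hom v')⟩ := n
    dsimp only at u u' v v'
    obtain ⟨P, a, b, e⟩ := IsPseudoCofiltered.exists_square u v
    obtain ⟨P', a', b', e'⟩ := IsPseudoCofiltered.exists_square u' v'
    obtain ⟨Q, k, t, h⟩ := Nabla.exists_lift (Nabla.Hom.hom a ≫ f₁) a'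
    -- the two squares over `f₂` agree after composition with `v'`
    obtain ⟨R, j, h'⟩ := Nabla.exists_equalize (X := Q) (Y := Y₂)
      (t ≫ Nabla.Hom.hom b') (Nabla.Hom.hom k ≫ Nabla.Hom.hom b ≫ f₂) v' (by
        have e₁ := congrArg Nabla.Hom.hom e
        have e₂ := congrArg Nabla.Hom.hom e'
        simp only [Nabla.hom_comp] at e₁ e₂
        simp only [Category.assoc]
        rw [← e₂, ← reassoc_of% h, ← hm, ← hn, reassoc_of% e₁])
    refine ⟨⟨R, P', Nabla.Hom.hom j ≫ t⟩, ⟨j ≫ k ≫ a, a', ?_⟩, ⟨j ≫ k ≫ b, b', ?_⟩, ?_⟩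
    · change (Nabla.Hom.hom j ≫ Nabla.Hom.hom k ≫ Nabla.Hom.hom a) ≫ f₁ =
        (Nabla.Hom.hom j ≫ t) ≫ Nabla.Hom.hom a'
      simp only [Category.assoc, h]
    · change (Nabla.Hom.hom j ≫ Nabla.Hom.hom k ≫ Nabla.Hom.hom b) ≫ f₂ =
        (Nabla.Hom.hom j ≫ t) ≫ Nabla.Hom.hom b'
      simp only [Category.assoc, h']
    · ext
      · simp [e]
      · exact e'
  exists_equalize {f₁ f₂} m n := by
    obtain ⟨X₁, Y₁, (f₁ : WArrow.dom X₁ ⟶ WArrow.dom Y₁)⟩ := f₁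
    obtain ⟨P, a, e⟩ := IsPseudoCofiltered.exists_equalize m.left n.left
    obtain ⟨P', a', e'⟩ := IsPseudoCofiltered.exists_equalize m.right n.right
    obtain ⟨Q, k, t, h⟩ := Nabla.exists_lift (Nabla.Hom.hom a ≫ f₁) a'
    refine ⟨⟨Q, P', t⟩, ⟨k ≫ a, a', ?_⟩, ?_⟩
    · exact (Category.assoc _ _ _).trans h
    · ext
      · simp [e]
      · exact e'

/-- A horizontal arrow of `C{W}` as an object of the category of squares. -/
abbrev NablaSquare.of {X Y : Nabla W} (f : WArrow.dom X ⟶ WArrow.dom Y) : NablaSquare W :=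
  ⟨X, Y, f⟩

/-- A morphism of the category of squares. -/
abbrev NablaSquare.homMk {X X' Y Y' : Nabla W} {f : WArrow.dom X ⟶ WArrow.dom Y}
    {f' : WArrow.dom X' ⟶ WArrow.dom Y'} (u : X ⟶ X') (u' : Y ⟶ Y')
    (h : f ≫ Nabla.Hom.hom u' = Nabla.Hom.hom u ≫ f') :
    NablaSquare.of f ⟶ NablaSquare.of f' :=
  ⟨u, u', h.symm⟩

omit [W.HasRightCalculusOfFractions] in
theorem HasSpan.of_vArrow {X Y : Nabla W} (v : VArrow (W := W) X Y) : HasSpan X Y := by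
  obtain ⟨p, -⟩ := Quot.exists_rep v
  exact ⟨_, ⟨p.left⟩, ⟨p.right⟩⟩

/-- A double cell of `C{W}` comes from a span of squares. -/
theorem HasSpan.of_wCell {X X' Y Y' : Nabla W} {f : WArrow.dom X ⟶ WArrow.dom X'}
    {g : WArrow.dom Y ⟶ WArrow.dom Y'} {l : VArrow (W := W) X Y} {r : VArrow (W := W) X' Y'}
    (x : WCell (W := W) f g l r) : HasSpan (NablaSquare.of f) (NablaSquare.of g) := by
  obtain ⟨p, -⟩ := Quot.exists_rep l
  obtain ⟨q, -⟩ := Quot.exists_rep r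
  obtain ⟨p', e, φ, -, h₁, h₂⟩ := x.exists_arrow p q
  exact ⟨NablaSquare.of (X := p'.obj) (Y := q.obj) φ, ⟨NablaSquare.homMk p'.left q.left h₁⟩,
    ⟨NablaSquare.homMk p'.right q.right h₂⟩⟩

end NablaSpans

/-! ### Horizontal transformations determined by their horizontal components -/

namespace CompCell

variable {D : DblCat.{u, v₁, v₂, v₃}} {a b c d : D.Obj} {t t' : D.Hor a b} {s s' : D.Hor c d}
  {l l' : Companion D a c} {r r' : Companion D b d}

theorem heq (ht : t = t') (hs : s = s') (hl : l = l') (hr : r = r') (x : CompCell t s l r)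
    (y : CompCell t' s' l' r') : HEq x y :=
  heq_of_heq ht hs hl hr (cellEq x y ht hs hl hr).heq

end CompCell

namespace HorTrans

variable {X : DblCat.{u', v₁', v₂', v₃'}} {D : DblCat.{u, v₁, v₂, v₃}}

/-- The horizontal transformation between functors into `Comp(D)` with given horizontal components.
Its cells exist, and satisfy all required equations, because cells between companion pairs are
determined by their boundary. -/
noncomputable def intoComp {F G : DblFunctor X (Comp D)}
    (app : ∀ a, D.Hor (F.obj a) (G.obj a))
    (hhor : ∀ {a b} (f : X.Hor a b),
      D.hComp (F.hor f) (app b) = D.hComp (app a) (G.hor f))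
    (hver : ∀ {a b} (v : X.Ver a b),
      D.hComp (app a) (Companion.hor (G.ver v)) = D.hComp (Companion.hor (F.ver v)) (app b)) :
    HorTrans F G where
  app := app
  cell v := Classical.choice (CompCell.nonempty (hver v))
  cell_id a := CompCell.heq rfl rfl (F.ver_id a) (G.ver_id a) _ _
  cell_comp v w := CompCell.heq rfl rfl (F.ver_comp v w) (G.ver_comp v w) _ _
  hor_naturality := hhor
  cell_naturality _ := CompCell.heq (hhor _) (hhor _) rfl rfl _ _

theorem ext_intoComp {F G : DblFunctor X (Comp D)} {α β : HorTrans F G}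
    (h : ∀ a, α.app a = β.app a) : α = β :=
  ext_of_heq h fun {a b} v => CompCell.heq (l := F.ver v) (l' := F.ver v) (r := G.ver v)
    (r' := G.ver v) (h a) (h b) rfl rfl (α.cell v) (β.cell v)

variable {C : Type uC} [Category.{vC} C]

/-- The horizontal transformation between functors out of `HC` with given horizontal components. -/
def ofHorDbl {F G : DblFunctor (horDbl C) D} (app : ∀ a, D.Hor (F.obj a) (G.obj a))
    (hhor : ∀ {a b} (f : (horDbl C).Hor a b),
      D.hComp (F.hor f) (app b) = D.hComp (app a) (G.hor f)) : HorTrans F G where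
  app := app
  cell {a b} v := match b, v with
    | _, ⟨rfl⟩ => castCell rfl rfl (F.ver_id a).symm (G.ver_id a).symm (D.cellV (app a))
  cell_id a := castCell_heq _ _ (F.ver_id a).symm (G.ver_id a).symm (D.cellV (app a))
  cell_comp {a b c} v w := by
    obtain ⟨rfl⟩ := v
    obtain ⟨rfl⟩ := w
    have e : CellEq (castCell rfl rfl (F.ver_id a).symm (G.ver_id a).symm (D.cellV (app a)))
      (D.cellV (app a)) := CellEq.cast _ _ _ _ _
    exact (e.trans ((CellEq.vId_left _).symm.trans (e.symm.vCell e.symm))).heq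
  hor_naturality := hhor
  cell_naturality {a b c d t s l r} x := by
    obtain ⟨rfl⟩ := l
    obtain ⟨rfl⟩ := r
    have h : t = s := (Category.comp_id t).symm.trans (x.down.trans (Category.id_comp s))
    subst h
    have e (a : C) : CellEq (castCell rfl rfl (F.ver_id a).symm (G.ver_id a).symm
      (D.cellV (app a))) (D.cellV (app a)) := CellEq.cast _ _ _ _ _
    have hF : CellEq (F.cell x) (D.cellV (F.hor t)) :=
      .of_heq rfl rfl (F.ver_id a) (F.ver_id b) (F.cell_cellV t)
    have hG : CellEq (G.cell x) (D.cellV (G.hor t)) :=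
      .of_heq rfl rfl (G.ver_id a) (G.ver_id b) (G.cell_cellV t)
    refine ((hF.hCell (e b)).trans ((CellEq.cellV_hComp _ _).trans ?_)).heq
    exact (CellEq.cellV (hhor t)).trans ((CellEq.cellV_hComp _ _).symm.trans
      ((e a).symm.hCell hG.symm))

theorem ext_ofHorDbl {F G : DblFunctor (horDbl C) D} {α β : HorTrans F G}
    (h : ∀ a, α.app a = β.app a) : α = β := by
  refine ext_of_heq h ?_
  intro a b v
  obtain ⟨rfl⟩ := v
  refine (α.cell_id a).trans (HEq.trans ?_ (β.cell_id a).symm)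
  rw [h a]

end HorTrans

/-! ### The functor on `C{W}` induced by a `W`-friendly functor -/

namespace DblCat

variable {D : DblCat.{u, v₁, v₂, v₃}} {a a' b b' c c' : D.Obj} {i : D.Hor a a'}
  {f : D.Hor a' b'} {k : D.Hor b' b} {j : D.Hor b b'} {f' : D.Hor b' c'} {k' : D.Hor c' c}

theorem hComp_conj_comp (h : D.hComp k j = D.hId b') :
    D.hComp i (D.hComp (D.hComp f f') k') =
      D.hComp (D.hComp i (D.hComp f k)) (D.hComp j (D.hComp f' k')) := by
  simp only [D.hAssoc]
  rw [← D.hAssoc k, h, D.hId_comp]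

theorem hComp_conj_right (h : D.hComp k j = D.hId b') :
    D.hComp (D.hComp i (D.hComp f k)) j = D.hComp i f := by
  simp only [D.hAssoc, h, D.hComp_id]

theorem hComp_conj_eq {g : D.Hor a b} (h : D.hComp j k = D.hId b)
    (h' : D.hComp g j = D.hComp i f) : D.hComp i (D.hComp f k) = g := by
  rw [← D.hAssoc, ← h', D.hAssoc, h, D.hComp_id]

theorem hComp_inv_cancel (h : D.hComp j k = D.hId b) {f : D.Hor b c} :
    D.hComp j (D.hComp k f) = f := by
  rw [← D.hAssoc, h, D.hId_comp]

theorem hComp_naturality_of_inverse {a a' b b' c c' d d' : D.Obj}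
    {x : D.Hor a b}
    {x' : D.Hor a' b'} {α : D.Hor a a'} {β : D.Hor b b'} {p : D.Hor a c} {q : D.Hor b d}
    {p' : D.Hor a' c'} {q' : D.Hor b' d'} {q'' : D.Hor d' b'} {y : D.Hor c d} {y' : D.Hor c' d'}
    {e : D.Hor c c'} {e' : D.Hor d d'} (hq : D.hComp q' q'' = D.hId b')
    (hx : D.hComp x q = D.hComp p y) (hx' : D.hComp x' q' = D.hComp p' y')
    (hα : D.hComp α p' = D.hComp p e) (hβ : D.hComp β q' = D.hComp q e')
    (hy : D.hComp y e' = D.hComp e y') : D.hComp x β = D.hComp α x' := by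
  have h : D.hComp (D.hComp x β) q' = D.hComp (D.hComp α x') q' := by
    rw [D.hAssoc, hβ, ← D.hAssoc, hx, D.hAssoc, hy, D.hAssoc, hx', ← D.hAssoc, ← D.hAssoc, hα]
  have h' := congrArg (fun z => D.hComp z q'') h
  simpa only [D.hAssoc, hq, D.hComp_id] using h'

end DblCat

namespace WFriendly

variable {C : Type uC} [Category.{vC} C] {W : MorphismProperty C} {D : DblCat.{u, v₁, v₂, v₃}}
  (P : WFriendly W D)

/-- The object of `D` assigned to an object of `C`. -/
def GObj (A : C) : D.Obj := P.G.obj A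

/-- The horizontal arrow of `D` assigned to an arrow of `C`. -/
def GHor {A B : C} (f : A ⟶ B) : D.Hor (P.GObj A) (P.GObj B) := P.G.hor f

theorem GHor_id (A : C) : P.GHor (𝟙 A) = D.hId (P.GObj A) := P.G.hor_id A

theorem GHor_comp {A B E : C} (f : A ⟶ B) (g : B ⟶ E) :
    P.GHor (f ≫ g) = D.hComp (P.GHor f) (P.GHor g) := P.G.hor_comp f g

/-- The component of `γ` at `w`. -/
def γHor (X : Nabla W) : D.Hor (P.Γ.obj X) (P.GObj (WArrow.dom X)) := P.γ.hom.app X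

/-- The component of `γ⁻¹` at `w`. -/
def γInv (X : Nabla W) : D.Hor (P.GObj (WArrow.dom X)) (P.Γ.obj X) := P.γ.inv.app X

theorem γHor_γInv (X : Nabla W) : D.hComp (P.γHor X) (P.γInv X) = D.hId _ :=
  P.γ.hom_inv_id_app X

theorem γInv_γHor (X : Nabla W) : D.hComp (P.γInv X) (P.γHor X) = D.hId _ :=
  P.γ.inv_hom_id_app X

theorem γHor_naturality {X Y : Nabla W} (u : X ⟶ Y) :
    D.hComp (Companion.hor (P.Γ.ver u)) (P.γHor Y) =
      D.hComp (P.γHor X) (P.GHor (Nabla.Hom.hom u)) :=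
  P.γ.hom.naturality u

/-- The horizontal arrow `γ⁻¹ ∘ G(f) ∘ γ` assigned to a horizontal arrow `f` of `C{W}`. -/
def liftHor {X Y : Nabla W} (f : WArrow.dom X ⟶ WArrow.dom Y) :
    D.Hor (P.Γ.obj X) (P.Γ.obj Y) :=
  D.hComp (P.γHor X) (D.hComp (P.GHor f) (P.γInv Y))

theorem liftHor_id (X : Nabla W) : P.liftHor (𝟙 (WArrow.dom X)) = D.hId (P.Γ.obj X) :=
  hComp_conj_eq (P.γHor_γInv X) ((D.hId_comp _).trans
    ((D.hComp_id _).symm.trans (congrArg _ (P.GHor_id _).symm)))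

theorem liftHor_comp {X Y Z : Nabla W} (f : WArrow.dom X ⟶ WArrow.dom Y)
    (g : WArrow.dom Y ⟶ WArrow.dom Z) :
    P.liftHor (X := X) (Y := Z) (f ≫ g) = D.hComp (P.liftHor f) (P.liftHor g) :=
  (congrArg (fun z => D.hComp (P.γHor X) (D.hComp z (P.γInv Z))) (P.GHor_comp f g)).trans
    (hComp_conj_comp (P.γInv_γHor Y))

theorem liftHor_γHor {X Y : Nabla W} (f : WArrow.dom X ⟶ WArrow.dom Y) :
    D.hComp (P.liftHor f) (P.γHor Y) = D.hComp (P.γHor X) (P.GHor f) :=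
  hComp_conj_right (P.γInv_γHor Y)

/-- Naturality of `γ` identifies the horizontal arrow of `Γ(u)` with the one assigned to `u`. -/
theorem liftHor_hom {X Y : Nabla W} (u : X ⟶ Y) :
    P.liftHor (Nabla.Hom.hom u) = Companion.hor (P.Γ.ver u) :=
  hComp_conj_eq (P.γHor_γInv Y) (P.γHor_naturality u)

/-- The cell between companion pairs assigned to a commutative square. -/
noncomputable def liftSquare {X X' Y Y' : Nabla W} {f : WArrow.dom X ⟶ WArrow.dom Y}
    {f' : WArrow.dom X' ⟶ WArrow.dom Y'} (u : X ⟶ X') (u' : Y ⟶ Y')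
    (h : f ≫ Nabla.Hom.hom u' = Nabla.Hom.hom u ≫ f') :
    CompCell (D := D) (P.liftHor f) (P.liftHor f') (P.Γ.ver u) (P.Γ.ver u') :=
  Classical.choice (CompCell.nonempty (by
    rw [← liftHor_hom, ← liftHor_hom, ← liftHor_comp, ← liftHor_comp, h]))

/-- The functor on the category of squares which sends a square to the cell assigned to it. -/
noncomputable def squareFunctor : NablaSquare W ⥤ HorArrow D where
  obj f := HorArrow.mk (P.Γ.obj f.left) (P.Γ.obj f.right) (P.liftHor f.hom)
  map m := horArrowHom (P.liftSquare m.left m.right m.w.symm).cell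
  map_id f := CellEq.horArrowHom_eq (CompCell.cellEq _ (CompCell.cellV (P.liftHor f.hom)) rfl rfl
    (P.Γ.ver_id _) (P.Γ.ver_id _))
  map_comp m n := CellEq.horArrowHom_eq (CompCell.cellEq _
    ((P.liftSquare m.left m.right m.w.symm).vCell (P.liftSquare n.left n.right n.w.symm)) rfl rfl
    (P.Γ.ver_comp _ _) (P.Γ.ver_comp _ _))

variable [hD : D.IsVerticallyThin]

instance {f g : NablaSquare W} (m : f ⟶ g) : IsIso (P.squareFunctor.map m) :=
  VInvertible.isIso (CompCell.vInvertible _)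

variable [W.HasRightCalculusOfFractions]

omit [W.HasRightCalculusOfFractions] in
theorem nonempty_liftVer {X Y : Nabla W} (v : VArrow (W := W) X Y) :
    Nonempty (D.Ver (P.Γ.obj X) (P.Γ.obj Y)) := by
  obtain ⟨Q, ⟨a⟩, ⟨b⟩⟩ := HasSpan.of_vArrow v
  obtain ⟨w⟩ := hD.symm (Companion.ver (P.Γ.ver a))
  exact ⟨D.vComp w (Companion.ver (P.Γ.ver b))⟩

/-- The vertical arrow assigned to a vertical arrow of `C{W}`; there is only one choice. -/
noncomputable def liftVer {X Y : Nabla W} (v : VArrow (W := W) X Y) :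
    D.Ver (P.Γ.obj X) (P.Γ.obj Y) :=
  Classical.choice (P.nonempty_liftVer v)

/-- The cell assigned to a double cell of `C{W}`: the extension of the functor on squares along a
span of squares representing the double cell. -/
noncomputable def liftCell {X X' Y Y' : Nabla W} {f : WArrow.dom X ⟶ WArrow.dom X'}
    {g : WArrow.dom Y ⟶ WArrow.dom Y'} {l : VArrow (W := W) X Y} {r : VArrow (W := W) X' Y'}
    (x : WCell (W := W) f g l r) :
    D.Cell (P.liftHor f) (P.liftHor g) (P.liftVer l) (P.liftVer r) :=
  castCell rfl rfl (ver_subsingleton _ _) (ver_subsingleton _ _)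
    (HorArrow.Hom.cell (spanLift P.squareFunctor (HasSpan.of_wCell x)))

section

variable {X X' Y Y' : Nabla W} {f : WArrow.dom X ⟶ WArrow.dom X'}
  {g : WArrow.dom Y ⟶ WArrow.dom Y'} {l : VArrow (W := W) X Y} {r : VArrow (W := W) X' Y'}

theorem liftCell_cellEq (x : WCell (W := W) f g l r)
    (h : HasSpan (NablaSquare.of f) (NablaSquare.of g)) :
    CellEq (P.liftCell x) (HorArrow.Hom.cell (spanLift P.squareFunctor h)) :=
  CellEq.cast _ _ _ _ _

/-- The defining property of `liftCell`, for an arbitrary span of squares representing the cell. -/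
theorem vCell_liftSquare_liftCell (x : WCell (W := W) f g l r) {Z Z' : Nabla W}
    {k : WArrow.dom Z ⟶ WArrow.dom Z'} (u : Z ⟶ X) (u' : Z' ⟶ X') (v : Z ⟶ Y) (v' : Z' ⟶ Y')
    (h : k ≫ Nabla.Hom.hom u' = Nabla.Hom.hom u ≫ f)
    (h' : k ≫ Nabla.Hom.hom v' = Nabla.Hom.hom v ≫ g) :
    CellEq (D.vCell (P.liftSquare u u' h).cell (P.liftCell x)) (P.liftSquare v v' h').cell :=
  (CellEq.refl.vCell (P.liftCell_cellEq x (HasSpan.of_wCell x))).trans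
    (cellEq_of_horArrowHom_eq (map_comp_spanLift P.squareFunctor (HasSpan.of_wCell x)
      (NablaSquare.homMk u u' h) (NablaSquare.homMk v v' h')))

end

/-- A horizontal identity cell is represented by a span of identity squares, to which horizontal
identity cells are assigned. -/
theorem liftCell_cellH {X Y : Nabla W} {v : VArrow (W := W) X Y}
    (x : WCell (W := W) (𝟙 (WArrow.dom X)) (𝟙 (WArrow.dom Y)) v v) :
    CellEq (P.liftCell x) (D.cellH (P.liftVer v)) := by
  obtain ⟨p, -⟩ := Quot.exists_rep v
  have h {Z : Nabla W} (u : p.obj ⟶ Z) : 𝟙 (WArrow.dom p.obj) ≫ Nabla.Hom.hom u =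
      Nabla.Hom.hom u ≫ 𝟙 (WArrow.dom Z) := by simp
  have e {Z : Nabla W} (u : p.obj ⟶ Z) : CellEq (P.liftSquare u u (h u)).cell
      (D.cellH (Companion.ver (P.Γ.ver u))) :=
    CompCell.cellEq _ (CompCell.cellH (P.Γ.ver u)) (P.liftHor_id _) (P.liftHor_id _) rfl rfl
  refine (CompCell.vInvertible _).cancel (e p.left) ((P.vCell_liftSquare_liftCell x p.left p.left
    p.right p.right (h _) (h _)).trans ((e p.right).trans ?_))
  exact (CellEq.cellH (ver_subsingleton _ _)).trans (CellEq.cellH_vComp _ _).symm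

theorem liftCell_cellV {X Y : Nabla W} {f : WArrow.dom X ⟶ WArrow.dom Y}
    (x : WCell (W := W) f f (VArrow.id X) (VArrow.id Y)) :
    CellEq (P.liftCell x) (D.cellV (P.liftHor f)) :=
  (P.liftCell_cellEq x (HasSpan.refl _)).trans
    (cellEq_of_horArrowHom_eq (spanLift_refl P.squareFunctor _))

theorem liftCell_hCell {X X' X'' Y Y' Y'' : Nabla W} {f : WArrow.dom X ⟶ WArrow.dom X'}
    {g : WArrow.dom Y ⟶ WArrow.dom Y'} {l : VArrow (W := W) X Y} {m : VArrow (W := W) X' Y'}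
    {f' : WArrow.dom X' ⟶ WArrow.dom X''} {g' : WArrow.dom Y' ⟶ WArrow.dom Y''}
    {r : VArrow (W := W) X'' Y''} (x : WCell (W := W) f g l m) (y : WCell (W := W) f' g' m r)
    (z : WCell (W := W) (f ≫ f') (g ≫ g') l r) :
    CellEq (P.liftCell z) (D.hCell (P.liftCell x) (P.liftCell y)) := by
  obtain ⟨p, -⟩ := Quot.exists_rep l
  obtain ⟨q, -⟩ := Quot.exists_rep m
  obtain ⟨q', -⟩ := Quot.exists_rep r
  -- composable components of the two cells
  obtain ⟨q₁, -, ψ, -, h₁, h₂⟩ := y.exists_arrow q q'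
  obtain ⟨p₁, -, φ, -, h₃, h₄⟩ := x.exists_arrow p q₁
  have h₅ : (φ ≫ ψ) ≫ q'.fst = p₁.fst ≫ f ≫ f' := by
    rw [Category.assoc, h₁, reassoc_of% h₃]
  have h₆ : (φ ≫ ψ) ≫ q'.snd = p₁.snd ≫ g ≫ g' := by
    rw [Category.assoc, h₂, reassoc_of% h₄]
  have e := P.vCell_liftSquare_liftCell x p₁.left q₁.left p₁.right q₁.right h₃ h₄
  have e' := P.vCell_liftSquare_liftCell y q₁.left q'.left q₁.right q'.right h₁ h₂
  have e'' := P.vCell_liftSquare_liftCell z p₁.left q'.left p₁.right q'.right h₅ h₆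
  refine (CompCell.vInvertible _).cancel (CompCell.cellEq _ ((P.liftSquare p₁.left q₁.left h₃).hCell
    (P.liftSquare q₁.left q'.left h₁)) (P.liftHor_comp _ _) (P.liftHor_comp _ _) rfl rfl)
    (e''.trans ?_)
  refine (CompCell.cellEq _ ((P.liftSquare p₁.right q₁.right h₄).hCell
    (P.liftSquare q₁.right q'.right h₂)) (P.liftHor_comp _ _) (P.liftHor_comp _ _) rfl rfl).trans ?_
  exact (e.symm.hCell e'.symm).trans (CellEq.interchange _ _ _ _).symm

theorem liftCell_vCell {X X' Y Y' Z Z' : Nabla W} {f : WArrow.dom X ⟶ WArrow.dom X'}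
    {g : WArrow.dom Y ⟶ WArrow.dom Y'} {k : WArrow.dom Z ⟶ WArrow.dom Z'}
    {l : VArrow (W := W) X Y} {r : VArrow (W := W) X' Y'} {l' : VArrow (W := W) Y Z}
    {r' : VArrow (W := W) Y' Z'} {l'' : VArrow (W := W) X Z} {r'' : VArrow (W := W) X' Z'}
    (x : WCell (W := W) f g l r) (y : WCell (W := W) g k l' r') (z : WCell (W := W) f k l'' r'') :
    CellEq (P.liftCell z) (D.vCell (P.liftCell x) (P.liftCell y)) := by
  refine (P.liftCell_cellEq z (HasSpan.of_wCell z)).trans ?_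
  refine (cellEq_of_horArrowHom_eq (spanLift_trans P.squareFunctor (HasSpan.of_wCell x)
    (HasSpan.of_wCell y) _)).trans ?_
  exact (P.liftCell_cellEq x _).symm.vCell (P.liftCell_cellEq y _).symm

/-- The strict functor `C{W} → D` induced by a `W`-friendly functor. -/
noncomputable def lift : DblFunctor (fractionsDbl W) D where
  obj (X : Nabla W) := P.Γ.obj X
  hor {X Y} f := P.liftHor (X := X) (Y := Y) f
  ver {X Y} v := P.liftVer (X := X) (Y := Y) v
  cell {X X' Y Y' _ _ _ _} x := P.liftCell (X := X) (X' := X') (Y := Y) (Y' := Y') x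
  hor_id X := P.liftHor_id X
  hor_comp f g := P.liftHor_comp f g
  ver_id _ := ver_subsingleton _ _
  ver_comp _ _ := ver_subsingleton _ _
  cell_cellH _ := (P.liftCell_cellH _).heq
  cell_cellV _ := (P.liftCell_cellV _).heq
  cell_hCell _ _ := (P.liftCell_hCell _ _ _).heq
  cell_vCell _ _ := (P.liftCell_vCell _ _ _).heq

end WFriendly

/-! ### Essential surjectivity -/

section EssSurj

/-- The horizontal arrows of `VN` are identities, so that naturality with respect to them is
automatic. -/
theorem verDbl_hor_naturality {N : Type uC} [Category.{vC} N] {D : DblCat.{u, v₁, v₂, v₃}}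
    {F G : DblFunctor (verDbl N) D} (app : ∀ a, D.Hor (F.obj a) (G.obj a)) {a b : N}
    (f : (verDbl N).Hor a b) : D.hComp (F.hor f) (app b) = D.hComp (app a) (G.hor f) := by
  obtain ⟨rfl⟩ := f
  exact (congrArg (fun z => D.hComp z (app a)) (F.hor_id a)).trans ((D.hId_comp _).trans
    ((D.hComp_id _).symm.trans (congrArg (D.hComp (app a)) (G.hor_id a).symm)))

variable {C : Type uC} [Category.{vC} C] {W : MorphismProperty C} {D : DblCat.{u, v₁, v₂, v₃}}
  [W.HasRightCalculusOfFractions] (P : WFriendly W D) [hD : D.IsVerticallyThin]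

namespace WFriendly

omit hD in
/-- `γ` is determined by its components at the identities of `C`. -/
theorem γHor_eq (X : Nabla W) : P.γHor X =
    D.hComp (P.liftHor (X := X) (Y := idArrow W (WArrow.dom X)) (𝟙 (WArrow.dom X)))
      (P.γHor (idArrow W (WArrow.dom X))) :=
  ((P.liftHor_γHor (X := X) (Y := idArrow W (WArrow.dom X)) (𝟙 (WArrow.dom X))).trans
    ((congrArg (D.hComp (P.γHor X)) (P.GHor_id _)).trans (D.hComp_id _))).symm

/-- The comparison from the restriction of the induced functor: `γ` at the identities of `C`, and
the identity on `Γ`. -/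
noncomputable def liftHom : (precompJ W D).obj P.lift ⟶ P where
  a := HorTrans.ofHorDbl (F := (inclusionJ W).comp P.lift) (G := P.G)
    (fun A => P.γHor (idArrow W A)) (fun {A B} f =>
      P.liftHor_γHor (X := idArrow W A) (Y := idArrow W B) f)
  α := HorTrans.intoComp (F := (canonicalΦ W).comp P.lift.compMap) (G := P.Γ)
    (fun X => D.hId (P.Γ.obj X)) (fun f => verDbl_hor_naturality
      (F := (canonicalΦ W).comp P.lift.compMap) (G := P.Γ) (fun X => D.hId (P.Γ.obj X)) f)
    (fun u => (D.hId_comp _).trans ((P.liftHor_hom u).symm.trans (D.hComp_id _).symm))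
  comm w := (D.hId_comp _).trans (P.γHor_eq w)

/-- The inverse comparison. -/
noncomputable def liftInv : P ⟶ (precompJ W D).obj P.lift where
  a := HorTrans.ofHorDbl (F := P.G) (G := (inclusionJ W).comp P.lift)
    (fun A => P.γInv (idArrow W A)) (fun {A B} f =>
      (hComp_inv_cancel (f := D.hComp (P.GHor f) (P.γInv (idArrow W B)))
        (P.γInv_γHor (idArrow W A))).symm)
  α := HorTrans.intoComp (F := P.Γ) (G := (canonicalΦ W).comp P.lift.compMap)
    (fun X => D.hId (P.Γ.obj X)) (fun f => verDbl_hor_naturality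
      (F := P.Γ) (G := (canonicalΦ W).comp P.lift.compMap) (fun X => D.hId (P.Γ.obj X)) f)
    (fun u => (D.hId_comp _).trans ((P.liftHor_hom u).trans (D.hComp_id _).symm))
  comm w := (D.hId_comp _).trans (congrArg (D.hComp (P.γHor w))
    ((congrArg (fun z => D.hComp z (P.γInv (idArrow W (WArrow.dom w)))) (P.GHor_id _)).trans
      (D.hId_comp _)))

/-- A `W`-friendly functor is isomorphic to the restriction of the functor it induces on `C{W}`. -/
noncomputable def liftIso : (precompJ W D).obj P.lift ≅ P where
  hom := P.liftHom
  inv := P.liftInv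
  hom_inv_id := WFriendly.Hom.ext (HorTrans.ext_ofHorDbl fun A => P.γHor_γInv (idArrow W A))
    (HorTrans.ext_intoComp fun X => D.hId_comp (D.hId (P.Γ.obj X)))
  inv_hom_id := WFriendly.Hom.ext (HorTrans.ext_ofHorDbl fun A => P.γInv_γHor (idArrow W A))
    (HorTrans.ext_intoComp fun X => D.hId_comp (D.hId (P.Γ.obj X)))

end WFriendly

theorem precompJ_essSurj : (precompJ W D).EssSurj :=
  ⟨fun P => ⟨P.lift, ⟨P.liftIso⟩⟩⟩

end EssSurj

/-! ### Full faithfulness -/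

namespace HorTrans

variable {X : DblCat.{u', v₁', v₂', v₃'}} {D : DblCat.{u, v₁, v₂, v₃}} {F G : DblFunctor X D}
  (β : HorTrans F G)

theorem cellEq_vComp {a b c : X.Obj} (v : X.Ver a b) (w : X.Ver b c) :
    CellEq (β.cell (X.vComp v w)) (D.vCell (β.cell v) (β.cell w)) :=
  .of_heq rfl rfl (F.ver_comp v w) (G.ver_comp v w) (β.cell_comp v w)

theorem cellEq_congr {a b : X.Obj} {v w : X.Ver a b} (h : v = w) :
    CellEq (β.cell v) (β.cell w) := by
  subst h; exact .refl

end HorTrans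

section FullyFaithful

variable {C : Type uC} [Category.{vC} C] {W : MorphismProperty C} {D : DblCat.{u, v₁, v₂, v₃}}
  [W.HasRightCalculusOfFractions] [hD : D.IsVerticallyThin]
  {L L' : DblFunctor (fractionsDbl W) D}

/-- The components of a horizontal transformation at the companions `[1, u]` are determined by its
horizontal components, and every vertical arrow of `C{W}` is a quotient of two of these. -/
theorem HorTrans.ext_fractionsDbl {b b' : HorTrans L L'} (h : ∀ X, b.app X = b'.app X) :
    b = b' := by
  refine HorTrans.ext_of_heq h ?_
  intro X Y v
  obtain ⟨p, -⟩ := Quot.exists_rep v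
  have e {Z : Nabla W} (u : VSpan.obj (W := W) p ⟶ Z) :
      CellEq (b.cell (canonicalCompanion u).ver) (b'.cell (canonicalCompanion u).ver) :=
    CompCell.cellEq (D := D) (b.compMap.cell (canonicalCompanion u))
      (b'.compMap.cell (canonicalCompanion u)) (h _) (h _) rfl rfl
  have k (c : HorTrans L L') : CellEq (D.vCell (c.cell (canonicalCompanion (VSpan.left p)).ver)
      (c.cell v)) (c.cell (canonicalCompanion (VSpan.right p)).ver) :=
    (c.cellEq_vComp _ v).symm.trans (c.cellEq_congr (fractionsDbl_ver_eq W _ _))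
  exact (VInvertible.cancel (CompCell.vInvertible (b.compMap.cell (canonicalCompanion
    (VSpan.left p)))) (e _) ((k b).trans ((e _).trans (k b').symm))).heq

theorem precompJ_faithful : (precompJ W D).Faithful :=
  ⟨fun {L L'} _ _ h => HorTrans.ext_fractionsDbl fun X =>
    congrArg (fun m : (precompJ W D).obj L ⟶ (precompJ W D).obj L' =>
      HorTrans.app (WFriendly.Hom.α m) X) h⟩

variable (m : (precompJ W D).obj L ⟶ (precompJ W D).obj L')

namespace WFriendly.Hom

/-- The horizontal component at an object of `C{W}`. -/
def extendApp (X : Nabla W) : D.Hor (L.obj X) (L'.obj X) := HorTrans.app m.α X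

/-- The cell of companions at an arrow of `∇W`. -/
def companionCell {X Y : Nabla W} (u : X ⟶ Y) :
    CompCell (D := D) (extendApp m X) (extendApp m Y) ((canonicalCompanion u).map L)
      ((canonicalCompanion u).map L') :=
  HorTrans.cell m.α u

/-- The functor on `∇W` given by the cells of companions. -/
noncomputable def nablaFunctor : Nabla W ⥤ HorArrow D where
  obj X := HorArrow.mk _ _ (extendApp m X)
  map u := horArrowHom (companionCell m u).cell
  map_id X := CellEq.horArrowHom_eq (CompCell.cellEq _ (CompCell.cellV (extendApp m X)) rfl rfl
    (((canonicalΦ W).comp L.compMap).ver_id X) (((canonicalΦ W).comp L'.compMap).ver_id X))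
  map_comp u v := CellEq.horArrowHom_eq (CompCell.cellEq _
    ((companionCell m u).vCell (companionCell m v)) rfl rfl
    (((canonicalΦ W).comp L.compMap).ver_comp u v)
    (((canonicalΦ W).comp L'.compMap).ver_comp u v))

instance {X Y : Nabla W} (u : X ⟶ Y) : IsIso ((nablaFunctor m).map u) :=
  VInvertible.isIso (CompCell.vInvertible _)

/-- The component at a vertical arrow of `C{W}`: the extension of the functor on `∇W` along a
diagram representing the vertical arrow. -/
noncomputable def extendCell {X Y : Nabla W} (v : VArrow (W := W) X Y) :
    D.Cell (extendApp m X) (extendApp m Y) (L.ver v) (L'.ver v) :=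
  castCell rfl rfl (ver_subsingleton _ _) (ver_subsingleton _ _)
    (HorArrow.Hom.cell (spanLift (nablaFunctor m) (HasSpan.of_vArrow v)))

theorem extendCell_cellEq {X Y : Nabla W} (v : VArrow (W := W) X Y) (h : HasSpan X Y) :
    CellEq (extendCell m v) (HorArrow.Hom.cell (spanLift (nablaFunctor m) h)) :=
  CellEq.cast _ _ _ _ _

/-- The defining property of `extendCell`, for an arbitrary span in `∇W`. -/
theorem vCell_companionCell_extendCell {X Y Z : Nabla W} (v : VArrow (W := W) X Y) (u : Z ⟶ X)
    (u' : Z ⟶ Y) : CellEq (D.vCell (companionCell m u).cell (extendCell m v))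
      (companionCell m u').cell :=
  (CellEq.refl.vCell (extendCell_cellEq m v (HasSpan.of_vArrow v))).trans
    (cellEq_of_horArrowHom_eq (map_comp_spanLift (nablaFunctor m) (HasSpan.of_vArrow v) u u'))

omit hD in
/-- Naturality with respect to horizontal arrows, which are conjugates of arrows of `C` by the
isomorphisms `φ_w`. -/
theorem extendApp_naturality {X Y : Nabla W} (f : WArrow.dom X ⟶ WArrow.dom Y) :
    D.hComp (L.hor (a := X) (b := Y) f) (extendApp m Y) =
      D.hComp (extendApp m X) (L'.hor (a := X) (b := Y) f) := by
  have hf : (fractionsDbl W).hComp (a := X) (b := Y) f (canonicalIso Y).hom =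
      (fractionsDbl W).hComp (canonicalIso X).hom ((inclusionJ W).hor f) :=
    (Category.comp_id f).trans (Category.id_comp f).symm
  exact hComp_naturality_of_inverse (q'' := L'.hor (canonicalIso Y).inv)
    ((L'.hor_comp _ _).symm.trans ((congrArg L'.hor (canonicalIso Y).hom_inv_id).trans
      (L'.hor_id _)))
    ((L.hor_comp _ _).symm.trans ((congrArg L.hor hf).trans (L.hor_comp _ _)))
    ((L'.hor_comp _ _).symm.trans ((congrArg L'.hor hf).trans (L'.hor_comp _ _)))
    (m.comm X) (m.comm Y) (HorTrans.hor_naturality m.a f)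

/-- Naturality with respect to double cells. Composed from above with the cells of the first of the
two squares whose quotient is `x`, both sides become cells of companions with the same boundary. -/
theorem extendCell_naturality {X X' Y Y' : Nabla W} {f : WArrow.dom X ⟶ WArrow.dom X'}
    {g : WArrow.dom Y ⟶ WArrow.dom Y'} {l : VArrow (W := W) X Y} {r : VArrow (W := W) X' Y'}
    (x : WCell (W := W) f g l r) :
    CellEq (D.hCell (L.cell (a := X) (b := X') (c := Y) (d := Y') x) (extendCell m r))
      (D.hCell (extendCell m l) (L'.cell (a := X) (b := X') (c := Y) (d := Y') x)) := by
  obtain ⟨p, -⟩ := Quot.exists_rep l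
  obtain ⟨q₀, -⟩ := Quot.exists_rep r
  obtain ⟨p, -, φ, -, h₁, h₂⟩ := x.exists_arrow p q₀
  rename VSpan X' Y' => q
  -- the two cells of companions whose quotient is `x`
  obtain ⟨c₁⟩ : Nonempty (CompCell (D := fractionsDbl W) (a := p.obj) (b := q.obj) (c := X)
    (d := X') φ f (canonicalCompanion p.left) (canonicalCompanion q.left)) :=
    CompCell.nonempty h₁
  obtain ⟨c₂⟩ : Nonempty (CompCell (D := fractionsDbl W) (a := p.obj) (b := q.obj) (c := Y)
    (d := Y') φ g (canonicalCompanion p.right) (canonicalCompanion q.right)) :=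
    CompCell.nonempty h₂
  have k (K : DblFunctor (fractionsDbl W) D) : CellEq (D.vCell (K.cell c₁.cell)
      (K.cell (a := X) (b := X') (c := Y) (d := Y') x)) (K.cell c₂.cell) :=
    (CellEq.of_heq rfl rfl (K.ver_comp _ _) (K.ver_comp _ _) (K.cell_vCell _ _)).symm.trans
      (.of_heq rfl rfl (ver_subsingleton _ _) (ver_subsingleton _ _) (K.cell_congr rfl rfl
        (fractionsDbl_ver_eq W _ _) (fractionsDbl_ver_eq W _ _)
        (fractionsDbl_cell_heq W rfl rfl _ _)))
  have e₁ := CompCell.cellEq ((c₁.map L).hCell (companionCell m q.left))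
    ((companionCell m p.left).hCell (c₁.map L'))
    (extendApp_naturality m (X := p.obj) (Y := q.obj) φ) (extendApp_naturality m f) rfl rfl
  have e₂ := CompCell.cellEq ((c₂.map L).hCell (companionCell m q.right))
    ((companionCell m p.right).hCell (c₂.map L'))
    (extendApp_naturality m (X := p.obj) (Y := q.obj) φ) (extendApp_naturality m g) rfl rfl
  refine (CompCell.vInvertible _).cancel e₁ ?_
  refine (CellEq.interchange _ _ _ _).trans (((k L).hCell
    (vCell_companionCell_extendCell m r q.left q.right)).trans (e₂.trans ?_))
  exact ((vCell_companionCell_extendCell m l p.left p.right).hCell (k L')).symm.trans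
    (CellEq.interchange _ _ _ _).symm

/-- The horizontal transformation on `C{W}` induced by a `W`-friendly one. -/
noncomputable def extend : HorTrans L L' where
  app X := extendApp m X
  cell v := extendCell m v
  cell_id X := ((extendCell_cellEq m _ (HasSpan.refl (N := Nabla W) X)).trans
    (cellEq_of_horArrowHom_eq (spanLift_refl (nablaFunctor m) _))).heq
  cell_comp v w := ((extendCell_cellEq m _
    ((HasSpan.of_vArrow v).trans (HasSpan.of_vArrow w))).trans
      ((cellEq_of_horArrowHom_eq (spanLift_trans (nablaFunctor m) (HasSpan.of_vArrow v)
        (HasSpan.of_vArrow w) _)).trans ((extendCell_cellEq m v _).symm.vCell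
          (extendCell_cellEq m w _).symm))).heq
  hor_naturality f := extendApp_naturality m f
  cell_naturality {X X' Y Y' _ _ _ _} x :=
    (extendCell_naturality m (X := X) (X' := X') (Y := Y) (Y' := Y') x).heq

omit hD in
theorem extendApp_idArrow (A : C) : extendApp m (idArrow W A) = HorTrans.app m.a A :=
  (D.hComp_id _).symm.trans <| (congrArg (D.hComp _) (L'.hor_id (idArrow W A)).symm).trans <|
    (m.comm (idArrow W A)).trans <| (congrArg (fun z => D.hComp z (HorTrans.app m.a A))
      (L.hor_id (idArrow W A))).trans (D.hId_comp _)

theorem precompJ_map_extend : (precompJ W D).map (X := L) (Y := L') (extend m) = m :=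
  WFriendly.Hom.ext (HorTrans.ext_ofHorDbl fun A => extendApp_idArrow m A)
    (HorTrans.ext_intoComp fun X => (rfl : extendApp m X = HorTrans.app m.α X))

end WFriendly.Hom

theorem precompJ_full : (precompJ W D).Full :=
  ⟨fun m => ⟨WFriendly.Hom.extend m, WFriendly.Hom.precompJ_map_extend m⟩⟩

end FullyFaithful

/-- Composition with `J_C` is an equivalence from the category of strict functors `C{W} → D` and
horizontal transformations to the category of `W`-friendly functors `HC → D` and `W`-friendly
horizontal transformations. -/
theorem mainTheorem3 {C : Type uC} [Category.{vC} C] (W : MorphismProperty C)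
    [W.HasRightCalculusOfFractions] [W.HasTwoOutOfThreeProperty]
    (hW : MorphismProperty.isomorphisms C ≤ W)
    (D : DblCat.{u, v₁, v₂, v₃}) (hD : D.IsWeaklyGlobular) :
    (precompJ W D).IsEquivalence := by
  have := hD.isVerticallyThin
  exact { faithful := precompJ_faithful, full := precompJ_full, essSurj := precompJ_essSurj }
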